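/- Let $k$ be an algebraically closed field of characteristic zero and let $l,m\ge 2$. **The quiver.** For $2\le n\le m$ the *diamond* $n$ is the set of lattice points $(x,y)$ with $x\equiv y \pmod 2$ and $|y|\le x\le 2l-|y|$, without $(0,0)$ and $(l,\pm l)$; its arrows are all steps $(2,0)$ (east), $(-1,1)$ (northwest) and $(-1,-1)$ (southwest) between its points. The quiver $\overline{\Diamond}{}_l^m$ is obtained from the diamonds $2,\dots,m$ as follows. For $1\le h\le l-1$ and both signs, the right edge vertex $(2l-h,\pm h)$ of the diamond $n$ is glued to the left edge vertex $(l-h,\pm(l-h))$ of the diamond $n+1$ $(2\le n<m)$, and in the diamond $2$ the left edge vertices $(h,h)$ and $(h,-h)$ are glued; corresponding arrows along glued edges are glued as well (other arrows are not, so the two arrows from $(2,0)$ to $(1,\pm1)$ in the diamond $2$ stay distinct). Finally one adds a vertex $1$ and one arrow from it to the vertex $(l-1,l-1)$ of the diamond $2$. For $2\le n\le m$ the right corner $(2l,0)$ of the diamond $n$ is called the vertex $n$. The frozen vertices are $1,\dots,m$ and the *boundary vertices* $v=v_h^\varepsilon$ at $(2l-h,\varepsilon h)$ in the diamond $m$,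 where $1\le h\le l-1$ and $\varepsilon\in\{1,-1\}$. **The potential.** Let $a$ be the sum of all east arrows, let $b$ be the sum of all southwest arrows of even diamonds and all northwest arrows of odd diamonds, and let $c$ be the sum of all northwest arrows of even diamonds and all southwest arrows of odd diamonds. (The glued left edge arrows of the diamond $2$ are summands of both $b$ and $c$.) Let $W=abc-acb$, with paths composed from left to right, let $\overline J=k\overline{\Diamond}{}_l^m/\langle \partial_\alpha W : \alpha \text{ an arrow}\rangle$ be the Jacobian algebra, where all arrows are used, and let $e_v$ be the trivial path at $v$. Modules are right modules. Let $\overline I_v=\operatorname{Hom}_k(\overline J e_v,k)$ be the indecomposable injective $\overline J$-module at $v$; an arrow $\alpha:u\to w$ gives a morphism $\overline I_w\to\overline I_u$, dual to right multiplication by $\alpha$. **The boundary representations.** Let $v=v_h^\varepsilon$. If $h\ge2$, let $v'=v_{h-1}^\varepsilon$ be the predecessor of $v$ and let $a_{v',v}:v'\to v$ be the arrow along the edge; if $h=1$, then $v$ is terminal. For $k_1,\dots,k_m\in\mathbb N$ and a morphism $f_v:\overline I_v\to\bigoplus_{n=1}^m k_n\overline I_n$ let $$T_v=\ker\Big(\overline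 I_v\xrightarrow{(a_{v',v},\,f_v)}\overline I_{v'}\oplus\bigoplus_{n=1}^m k_n\overline I_n\Big)\ (h\ge2),\qquad T_v=\ker\Big(\overline I_v\xrightarrow{f_v}\bigoplus_{n=1}^m k_n\overline I_n\Big)\ (h=1).$$ **The path.** Let $j=h$ if $m$ is even and $j=l-h$ if $m$ is odd. The path $p_v$ ends at $v$ and consists of two parts. The first part passes through the diamonds $m,m-1,\dots,2$; in the diamond $n$ it is the straight line of $l$ arrows from the right edge vertex $(l+j,-\sigma_n(l-j))$ to the left edge vertex $(j,\sigma_n j)$, where $\sigma_n=-\varepsilon$ for even $n$ and $\sigma_n=\varepsilon$ for odd $n$. The second part passes through the diamonds $2,3,\dots,m$; in the diamond $n$ it is the whole horizontal line of east arrows at height $\varepsilon h_n$, where $h_n=j$ for even $n$ and $h_n=l-j$ for odd $n$. **The path module.** For a path $p:v_0\xrightarrow{a_1}v_1\xrightarrow{a_2}\cdots\xrightarrow{a_t}v_t$ (possibly with repeated vertices or arrows), $S(p)$ is the representation with basis $m_0,\dots,m_t$, with $m_i$ at the vertex $v_i$, on which an arrow $\alpha$ acts by $m_{i-1}\alpha=m_i$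 if $\alpha=a_i$, and by $0$ otherwise. **Proposition.** Let $v$ be any boundary vertex. If $k_1,\dots,k_m$ are sufficiently large and $f_v$ is general, then $T_v$ is not supported on any of the vertices $1,\dots,m$. For all $k_1,\dots,k_m$ and $f_v$ for which $T_v$ is not supported on any of the vertices $1,\dots,m$, the module $T_v$ is isomorphic to the path module $S(p_v)$. -/

import Mathlib

/-! ### Quivers, path algebras, potentials and Jacobian algebras -/

/-- A quiver with vertex type `V` and arrow type `A`. -/
structure FQuiver (V A : Type) where
  src : A → V
  tgt : A → V

namespace FQuiver

/-- The free algebra on the vertices and the arrows. -/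
abbrev Gen (k : Type*) (V A : Type) [CommRing k] : Type _ := FreeAlgebra k (V ⊕ A)

abbrev genE (k : Type*) {V : Type} (A : Type) [CommRing k] (u : V) : Gen k V A :=
  FreeAlgebra.ι k (Sum.inl u)

abbrev genA (k : Type*) (V : Type) {A : Type} [CommRing k] (a : A) : Gen k V A :=
  FreeAlgebra.ι k (Sum.inr a)

/-- The relations of the path algebra: the trivial paths are orthogonal idempotents that sum to
`1`, and an arrow `a` satisfies `e_{src a} a = a = a e_{tgt a}`
(paths are composed from left to right). -/
inductive PathRel (k : Type*) [CommRing k] {V A : Type} [Fintype V] (Q : FQuiver V A) :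
    Gen k V A → Gen k V A → Prop
  | idem (u : V) : PathRel k Q (genE k A u * genE k A u) (genE k A u)
  | orth (u w : V) (h : u ≠ w) : PathRel k Q (genE k A u * genE k A w) 0
  | one : PathRel k Q (∑ u, genE k A u) 1
  | src_mul (a : A) : PathRel k Q (genE k A (Q.src a) * genA k V a) (genA k V a)
  | mul_tgt (a : A) : PathRel k Q (genA k V a * genE k A (Q.tgt a)) (genA k V a)

/-- The path algebra `kQ`. -/
abbrev PathAlg (k : Type*) [CommRing k] {V A : Type} [Fintype V] (Q : FQuiver V A) : Type _ :=
  RingQuot (PathRel k Q)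

/-- The trivial path at `u`. -/
noncomputable def idemp (k : Type*) [CommRing k] {V A : Type} [Fintype V] (Q : FQuiver V A)
    (u : V) : PathAlg k Q :=
  RingQuot.mkAlgHom k (PathRel k Q) (genE k A u)

/-- An arrow as an element of the path algebra. -/
noncomputable def arr (k : Type*) [CommRing k] {V A : Type} [Fintype V] (Q : FQuiver V A)
    (a : A) : PathAlg k Q :=
  RingQuot.mkAlgHom k (PathRel k Q) (genA k V a)

theorem arr_mul_idemp (k : Type*) [CommRing k] {V A : Type} [Fintype V] (Q : FQuiver V A) (a : A) :
    arr k Q a * idemp k Q (Q.tgt a) = arr k Q a := by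
  unfold arr idemp
  rw [← map_mul]
  exact RingQuot.mkAlgHom_rel k (PathRel.mul_tgt a)

/-- The cyclic derivative of the word `a₁ ⋯ a_d` with respect to the arrow `a`:
the sum of `a_{i+1} ⋯ a_d a₁ ⋯ a_{i-1}` over all `i` with `a_i = a`. -/
noncomputable def wordDeriv (k : Type*) [CommRing k] {V A : Type} [Fintype V] [DecidableEq A]
    (Q : FQuiver V A) (a : A) (w : List A) : PathAlg k Q :=
  ∑ i : Fin w.length,
    if w[i] = a then ((w.drop (i.1 + 1) ++ w.take i.1).map (arr k Q)).prod else 0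

/-- The cyclic derivative of a potential; a potential is a finite linear combination of
oriented cycles, each of which is written as the list of its arrows. -/
noncomputable def cyclicDeriv (k : Type*) [CommRing k] {V A : Type} [Fintype V] [DecidableEq A]
    (Q : FQuiver V A) (W : List A →₀ k) (a : A) : PathAlg k Q :=
  W.sum fun w c => c • wordDeriv k Q a w

/-- The relations `∂_a W = 0` for all arrows `a`. -/
def JacRel (k : Type*) [CommRing k] {V A : Type} [Fintype V] [DecidableEq A]
    (Q : FQuiver V A) (W : List A →₀ k) (x y : PathAlg k Q) : Prop :=
  ∃ a : A, x = cyclicDeriv k Q W a ∧ y = 0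

/-- The Jacobian algebra: the quotient of the path algebra by the two-sided ideal generated by
all cyclic derivatives of the potential. -/
abbrev Jac (k : Type*) [CommRing k] {V A : Type} [Fintype V] [DecidableEq A]
    (Q : FQuiver V A) (W : List A →₀ k) : Type _ :=
  RingQuot (JacRel k Q W)

/-- The projection from the path algebra to the Jacobian algebra. -/
noncomputable abbrev toJac (k : Type*) [CommRing k] {V A : Type} [Fintype V] [DecidableEq A]
    (Q : FQuiver V A) (W : List A →₀ k) : PathAlg k Q →ₐ[k] Jac k Q W :=
  RingQuot.mkAlgHom k (JacRel k Q W)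

/-! ### Paths and path modules -/

/-- `L` is the list of arrows of a path from `u` to `w`. -/
def IsWalk {V A : Type} (Q : FQuiver V A) : V → List A → V → Prop
  | u, [], w => u = w
  | u, a :: L, w => Q.src a = u ∧ IsWalk Q (Q.tgt a) L w

/-- A path in a quiver. -/
structure QPath {V A : Type} (Q : FQuiver V A) where
  start : V
  arrows : List A
  finish : V
  walk : IsWalk Q start arrows finish

/-- The `i`-th vertex `v_i` of a path `v₀ → v₁ → ⋯ → v_t`. -/
def QPath.vert {V A : Type} {Q : FQuiver V A} (p : QPath Q) (i : Fin (p.arrows.length + 1)) : V :=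
  (p.start :: p.arrows.map Q.tgt)[i.1]'(by simpa using Nat.lt_succ_iff.1 i.2)

theorem QPath.vert_succ {V A : Type} {Q : FQuiver V A} (p : QPath Q) (i : ℕ)
    (h : i < p.arrows.length) :
    p.vert ⟨i + 1, by omega⟩ = Q.tgt p.arrows[i] := by
  simp [QPath.vert]

theorem IsWalk.src_getElem {V A : Type} {Q : FQuiver V A} {u w : V} {L : List A}
    (hL : IsWalk Q u L w) (i : ℕ) (h : i < L.length) :
    Q.src L[i] = (u :: L.map Q.tgt)[i]'(by simp; omega) := by
  induction L generalizing u i with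
  | nil => simp at h
  | cons a L ih =>
    cases i with
    | zero => simpa using hL.1
    | succ i => simpa using ih hL.2 i (by simpa using h)

theorem QPath.vert_castSucc {V A : Type} {Q : FQuiver V A} (p : QPath Q) (i : ℕ)
    (h : i < p.arrows.length) :
    p.vert ⟨i, by omega⟩ = Q.src p.arrows[i] :=
  (p.walk.src_getElem i h).symm

/-- The matrix by which an arrow `a` acts (on row vectors) on the path module: it sends `m_{i}` to
`m_{i+1}` if `a` is the arrow of the path from the `i`-th to the `(i+1)`-st vertex, and to `0`
otherwise. -/
def QPath.arrowMatrix (k : Type*) [CommRing k] {V A : Type} [DecidableEq A]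
    {Q : FQuiver V A} (p : QPath Q) (a : A) :
    Matrix (Fin (p.arrows.length + 1)) (Fin (p.arrows.length + 1)) k :=
  Matrix.of fun i j => if i.1 + 1 = j.1 ∧ p.arrows[i.1]? = some a then 1 else 0

/-- The matrix by which the trivial path at `u` acts on the path module: the projection onto the
span of the `m_i` with `v_i = u`. -/
def QPath.vertexMatrix (k : Type*) [CommRing k] {V A : Type} [DecidableEq V]
    {Q : FQuiver V A} (p : QPath Q) (u : V) :
    Matrix (Fin (p.arrows.length + 1)) (Fin (p.arrows.length + 1)) k :=
  Matrix.diagonal fun i => if p.vert i = u then 1 else 0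

/-- The path module `S(p)` of a path `p : v₀ → v₁ → ⋯ → v_t`: it has a basis
`m₀, …, m_t`, with `m_i` at the vertex `v_i`, on which the arrows act by `m_{i-1} a_i = m_i` and by
`0` otherwise. It is given here by its action of the path algebra by matrices on row vectors. -/
noncomputable def QPath.rep (k : Type*) [CommRing k] {V A : Type} [Fintype V] [DecidableEq V]
    [DecidableEq A] {Q : FQuiver V A} (p : QPath Q) :
    PathAlg k Q →ₐ[k] Matrix (Fin (p.arrows.length + 1)) (Fin (p.arrows.length + 1)) k :=
  RingQuot.liftAlgHom k
    ⟨FreeAlgebra.lift k (Sum.elim (p.vertexMatrix k) (p.arrowMatrix k)), by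
      intro x y h
      induction h with
      | idem u =>
        simp only [map_mul, FreeAlgebra.lift_ι_apply, Sum.elim_inl, QPath.vertexMatrix,
          Matrix.diagonal_mul_diagonal]
        congr 1
        funext i
        split_ifs <;> simp
      | orth u w h =>
        simp only [map_mul, FreeAlgebra.lift_ι_apply, Sum.elim_inl, QPath.vertexMatrix,
          Matrix.diagonal_mul_diagonal, map_zero]
        rw [← Matrix.diagonal_zero]
        congr 1
        funext i
        by_cases h1 : p.vert i = u
        · have h2 : p.vert i ≠ w := fun e => h (h1 ▸ e)
          simp [h2]
        · simp [h1]
      | one =>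
        simp only [map_sum, FreeAlgebra.lift_ι_apply, Sum.elim_inl, QPath.vertexMatrix, map_one]
        ext i j
        rw [Matrix.sum_apply]
        by_cases h : i = j
        · subst h; simp
        · simp [h]
      | src_mul a =>
        simp only [map_mul, FreeAlgebra.lift_ι_apply, Sum.elim_inl, Sum.elim_inr,
          QPath.vertexMatrix]
        ext i j
        rw [Matrix.diagonal_mul]
        simp only [QPath.arrowMatrix, Matrix.of_apply]
        by_cases h : i.1 + 1 = j.1 ∧ p.arrows[i.1]? = some a
        · obtain ⟨hi, he⟩ := List.getElem?_eq_some_iff.1 h.2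
          have := p.vert_castSucc i.1 hi
          rw [he] at this
          rw [if_pos h, if_pos this, one_mul]
        · rw [if_neg h, mul_zero]
      | mul_tgt a =>
        simp only [map_mul, FreeAlgebra.lift_ι_apply, Sum.elim_inl, Sum.elim_inr,
          QPath.vertexMatrix]
        ext i j
        rw [Matrix.mul_diagonal]
        simp only [QPath.arrowMatrix, Matrix.of_apply]
        by_cases h : i.1 + 1 = j.1 ∧ p.arrows[i.1]? = some a
        · obtain ⟨hi, he⟩ := List.getElem?_eq_some_iff.1 h.2
          have h1 := p.vert_succ i.1 hi
          rw [he] at h1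
          have h2 : j = ⟨i.1 + 1, by omega⟩ := Fin.ext h.1.symm
          rw [if_pos h, h2, if_pos h1, one_mul]
        · rw [if_neg h, zero_mul]⟩

end FQuiver

/-! ### Injective modules

Modules are right modules: a right module over `J` is a module over `Jᵐᵒᵖ`. -/

/-- For an idempotent `e` of a `k`-algebra `J`, the right `J`-module `I_e = Hom_k(Je, k)`. For
the trivial path at `v` this is the indecomposable injective module at the vertex `v`. -/
def Inj (k J : Type*) [Field k] [Ring J] [Algebra k J] (e : J) : Type _ :=
  Module.Dual k (Ideal.span {e} : Ideal J)

namespace Inj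

variable {k J : Type*} [Field k] [Ring J] [Algebra k J] {e e' : J}

noncomputable instance : AddCommGroup (Inj k J e) :=
  inferInstanceAs (AddCommGroup (Module.Dual k (Ideal.span {e} : Ideal J)))

noncomputable instance : Module k (Inj k J e) :=
  inferInstanceAs (Module k (Module.Dual k (Ideal.span {e} : Ideal J)))

/-- The right action `(φ c)(x) = φ(c x)`. -/
noncomputable instance : Module Jᵐᵒᵖ (Inj k J e) where
  smul c φ := LinearMap.comp (show Module.Dual k (Ideal.span {e} : Ideal J) from φ)
    (Algebra.lsmul k k (Ideal.span {e} : Ideal J) c.unop)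
  one_smul φ := by
    refine LinearMap.ext fun x => ?_
    exact congrArg (show Module.Dual k (Ideal.span {e} : Ideal J) from φ) (one_smul J x)
  mul_smul a b φ := by
    refine LinearMap.ext fun x => ?_
    exact congrArg (show Module.Dual k (Ideal.span {e} : Ideal J) from φ) (mul_smul _ _ x)
  smul_zero a := LinearMap.ext fun x => rfl
  smul_add a φ ψ := LinearMap.ext fun x => rfl
  add_smul a b φ := by
    refine LinearMap.ext fun x => ?_
    exact (congrArg (show Module.Dual k (Ideal.span {e} : Ideal J) from φ)
      (add_smul a.unop b.unop x)).trans (map_add _ _ _)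
  zero_smul φ := by
    refine LinearMap.ext fun x => ?_
    exact (congrArg (show Module.Dual k (Ideal.span {e} : Ideal J) from φ)
      (zero_smul J x)).trans (map_zero _)

theorem smul_apply (c : Jᵐᵒᵖ) (φ : Inj k J e) (x : (Ideal.span {e} : Ideal J)) :
    (show Module.Dual k (Ideal.span {e} : Ideal J) from c • φ) x =
      (show Module.Dual k (Ideal.span {e} : Ideal J) from φ) (c.unop • x) := rfl

instance : IsScalarTower k Jᵐᵒᵖ (Inj k J e) where
  smul_assoc c a φ := by
    refine LinearMap.ext fun x => ?_
    refine (congrArg (show Module.Dual k (Ideal.span {e} : Ideal J) from φ)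
      (smul_assoc c a.unop x)).trans ?_
    exact map_smul (show Module.Dual k (Ideal.span {e} : Ideal J) from φ) c (a.unop • x)

instance : SMulCommClass Jᵐᵒᵖ k (Inj k J e) where
  smul_comm _ _ _ := LinearMap.ext fun _ => rfl

/-- For `a ∈ Je`, the morphism `I_e → I_{e'}` dual to right multiplication
`Je' → Je`, `x ↦ x a`. -/
noncomputable def map (e' : J) (a : J) (ha : a ∈ (Ideal.span {e} : Ideal J)) :
    Inj k J e →ₗ[Jᵐᵒᵖ] Inj k J e' where
  toFun φ := LinearMap.comp (show Module.Dual k (Ideal.span {e} : Ideal J) from φ)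
    ((((LinearMap.toSpanSingleton J (Ideal.span {e} : Ideal J) ⟨a, ha⟩).comp
      (Submodule.subtype (Ideal.span {e'} : Ideal J)))).restrictScalars k)
  map_add' _ _ := LinearMap.ext fun _ => rfl
  map_smul' c φ := by
    refine LinearMap.ext fun x => ?_
    exact congrArg (show Module.Dual k (Ideal.span {e} : Ideal J) from φ)
      (mul_smul c.unop (x : J) (⟨a, ha⟩ : (Ideal.span {e} : Ideal J))).symm

end Inj

/-- A property `S` holds for a general element of the vector space `X`: it holds at all points
where a suitable nonzero polynomial in finitely many linearly independent linear coordinates does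
not vanish. -/
def HoldsGenerically (k : Type*) [Field k] {X : Type*} [AddCommGroup X] [Module k X]
    (S : X → Prop) : Prop :=
  ∃ (d : ℕ) (L : X →ₗ[k] (Fin d → k)) (P : MvPolynomial (Fin d) k),
    Function.Surjective L ∧ P ≠ 0 ∧ ∀ x, MvPolynomial.eval (L x) P ≠ 0 → S x

/-! ### The ice quiver `◇̄_l^m` with its potential, in the diamond view

For `2 ≤ n ≤ m`, the diamond `n` consists of the lattice points `(x, y)` with `x ≡ y` modulo `2` and
`|y| ≤ x ≤ 2 l - |y|`, without its corners `(0, 0)` and `(l, ± l)`. It is made of two triangles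
(`y ≥ 0` and `y ≤ 0`) glued along the diagonal `y = 0`; the right corner `(2 l, 0)` is the frozen
vertex `n`. Its arrows are the steps `(2, 0)` (east), `(-1, 1)` (northwest) and `(-1, -1)`
(southwest) between its points. For `1 ≤ h ≤ l - 1` and both signs, the vertex
`(2 l - h, ± h)` on the right edge of the diamond `n` is glued to the vertex `(l - h, ± (l - h))` on
the left edge of the diamond `n + 1`, and in the diamond `2` the left edge vertices
`(h, h)` and `(h, - h)` are glued; arrows between two vertices of an edge are glued accordingly.
The apex `(l, l)` of the diamond `2` is used for the frozen vertex `1`. -/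

namespace Diamond

/-- `(x, y)` is a point of the diamond `n`. -/
def IsPoint (l m n : ℕ) (x y : ℤ) : Prop :=
  2 ≤ n ∧ n ≤ m ∧ (x + y) % 2 = 0 ∧ (-x ≤ y ∧ y ≤ x) ∧ (x + y ≤ 2 * l ∧ x - y ≤ 2 * l) ∧
    0 < x ∧ -l < y ∧ y < l

instance (l m n : ℕ) (x y : ℤ) : Decidable (IsPoint l m n x y) := by
  unfold IsPoint; infer_instance

/-- The vertices: each class of glued points is represented by its point on a right edge, or by
its point `(h, h)`, `1 ≤ h ≤ l - 1`, on the upper left edge of the diamond `2`;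
`(l, l)` in the diamond `2` is the frozen vertex `1`. -/
noncomputable def vertexSet (l m : ℕ) : Finset (ℕ × ℤ × ℤ) :=
  (Finset.Icc 2 m ×ˢ Finset.Icc (0 : ℤ) (2 * l) ×ˢ Finset.Icc (-(l : ℤ)) l).filter fun v =>
    (v.2.1 + v.2.2) % 2 = 0 ∧ (v.2.1 + v.2.2 ≤ 2 * l ∧ v.2.1 - v.2.2 ≤ 2 * l) ∧
      ((-v.2.1 < v.2.2 ∧ v.2.2 < v.2.1) ∨ (v.1 = 2 ∧ v.2.1 = v.2.2 ∧ 1 ≤ v.2.2))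

theorem mem_vertexSet {l m n : ℕ} {x y : ℤ} : (n, x, y) ∈ vertexSet l m ↔
    2 ≤ n ∧ n ≤ m ∧ 0 ≤ x ∧ (x + y) % 2 = 0 ∧ x + y ≤ 2 * l ∧ x - y ≤ 2 * l ∧
      ((-x < y ∧ y < x) ∨ (n = 2 ∧ x = y ∧ 1 ≤ y)) := by
  unfold vertexSet
  simp only [Finset.mem_filter, Finset.mem_product, Finset.mem_Icc]
  omega

abbrev Vertex (l m : ℕ) : Type := ↥(vertexSet l m)

/-- The representative of a point under the gluing. -/
def glue (l : ℕ) (n : ℕ) (x y : ℤ) : ℕ × ℤ × ℤ :=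
  if -x < y ∧ y < x then (n, x, y)
  else if n = 2 then (2, x, x)
  else (n - 1, l + x, if 0 < y then l - x else x - l)

theorem glue_mem {l m n : ℕ} {x y : ℤ} (h : IsPoint l m n x y) :
    glue l n x y ∈ vertexSet l m := by
  obtain ⟨h1, h2, h3, h4, h5, h6, h7⟩ := h
  unfold glue
  split_ifs <;> rw [mem_vertexSet] <;> omega

inductive Dir : Type
  | east
  | nw
  | sw
  deriving DecidableEq

def Dir.dx : Dir → ℤ
  | .east => 2
  | .nw => -1
  | .sw => -1

def Dir.dy : Dir → ℤ
  | .east => 0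
  | .nw => 1
  | .sw => -1

/-- The arrow in direction `d` that starts at the point `(x, y)` of the diamond `n`, as raw
data. -/
abbrev RawArrow : Type := Dir × ℕ × ℤ × ℤ

/-- Both ends of the arrow are on the left edges of the diamond. -/
def OnLeftEdge (a : RawArrow) : Prop :=
  (a.2.2.2 = a.2.2.1 ∨ a.2.2.2 = -a.2.2.1) ∧
    (a.2.2.2 + a.1.dy = a.2.2.1 + a.1.dx ∨ a.2.2.2 + a.1.dy = -(a.2.2.1 + a.1.dx))

instance (a : RawArrow) : Decidable (OnLeftEdge a) := by
  unfold OnLeftEdge; infer_instance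

/-- The arrows: all steps between points of a diamond, where an arrow on an edge
is listed only once, namely on the right edge of a diamond or, for the arrows
`(h + 1, h + 1) → (h, h)` on the left edge of the diamond `2`, on its upper left edge; and the
arrow from the frozen vertex `1` to `(l - 1, l - 1)` in the diamond `2`. -/
def IsArrow (l m : ℕ) (a : RawArrow) : Prop :=
  (IsPoint l m a.2.1 a.2.2.1 a.2.2.2 ∧
    IsPoint l m a.2.1 (a.2.2.1 + a.1.dx) (a.2.2.2 + a.1.dy) ∧
    (OnLeftEdge a → a.2.1 = 2 ∧ a.1 = Dir.sw)) ∨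
  (2 ≤ l ∧ 2 ≤ m ∧ a = (Dir.sw, 2, (l : ℤ), (l : ℤ)))

instance (l m : ℕ) (a : RawArrow) : Decidable (IsArrow l m a) := by
  unfold IsArrow; infer_instance

noncomputable def arrowSet (l m : ℕ) : Finset RawArrow :=
  (({Dir.east, Dir.nw, Dir.sw} : Finset Dir) ×ˢ Finset.Icc 2 m ×ˢ Finset.Icc (0 : ℤ) (2 * l) ×ˢ
    Finset.Icc (-(l : ℤ)) l).filter (IsArrow l m)

abbrev Arrow (l m : ℕ) : Type := ↥(arrowSet l m)

theorem mem_arrowSet {l m : ℕ} {a : RawArrow} : a ∈ arrowSet l m ↔ IsArrow l m a := by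
  obtain ⟨d, n, x, y⟩ := a
  unfold arrowSet
  have hd : d ∈ ({Dir.east, Dir.nw, Dir.sw} : Finset Dir) := by cases d <;> simp
  simp only [Finset.mem_filter, Finset.mem_product, hd, Finset.mem_Icc, true_and,
    and_iff_right_iff_imp]
  rintro (⟨⟨h1, h2, h3, h4, h5, h6, h7⟩, -⟩ | ⟨h1, h2, h3⟩)
  · dsimp only at *
    omega
  · simp only [Prod.mk.injEq] at h3
    omega

/-- The source of a raw arrow, as a representative. -/
def rawSrc (l : ℕ) (a : RawArrow) : ℕ × ℤ × ℤ := glue l a.2.1 a.2.2.1 a.2.2.2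

/-- The target of a raw arrow, as a representative. -/
def rawTgt (l : ℕ) (a : RawArrow) : ℕ × ℤ × ℤ :=
  glue l a.2.1 (a.2.2.1 + a.1.dx) (a.2.2.2 + a.1.dy)

theorem rawSrc_mem {l m : ℕ} {a : RawArrow} (h : a ∈ arrowSet l m) :
    rawSrc l a ∈ vertexSet l m := by
  rcases mem_arrowSet.1 h with h | ⟨h1, h2, rfl⟩
  · exact glue_mem h.1
  · simp only [rawSrc, glue]
    split_ifs <;> rw [mem_vertexSet] <;> omega

theorem rawTgt_mem {l m : ℕ} {a : RawArrow} (h : a ∈ arrowSet l m) :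
    rawTgt l a ∈ vertexSet l m := by
  rcases mem_arrowSet.1 h with h | ⟨h1, h2, rfl⟩
  · exact glue_mem h.2.1
  · simp only [rawTgt, glue, Dir.dx, Dir.dy]
    split_ifs <;> rw [mem_vertexSet] <;> omega

/-- The quiver `◇̄_l^m`. -/
def quiver (l m : ℕ) : FQuiver (Vertex l m) (Arrow l m) where
  src a := ⟨rawSrc l a.1, rawSrc_mem a.2⟩
  tgt a := ⟨rawTgt l a.1, rawTgt_mem a.2⟩

/-- Type `A`: east arrows. -/
def IsA (a : RawArrow) : Prop := a.1 = Dir.east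

/-- Type `B`: southwest arrows of the even diamonds and northwest arrows of the odd ones. The
arrows on the (glued) left edges of the diamond `2`, which are southwest on the
upper edge and northwest on the lower one, are of both types `B` and `C`. -/
def IsB (a : RawArrow) : Prop :=
  (Even a.2.1 ∧ a.1 = Dir.sw) ∨ (Odd a.2.1 ∧ a.1 = Dir.nw)

/-- Type `C`: northwest arrows of the even diamonds and southwest arrows of the odd ones, and the
arrows on the left edges of the diamond `2`. -/
def IsC (a : RawArrow) : Prop :=
  (Even a.2.1 ∧ a.1 = Dir.nw) ∨ (Odd a.2.1 ∧ a.1 = Dir.sw) ∨ (a.2.1 = 2 ∧ OnLeftEdge a)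

open Classical in
/-- The potential `abc - acb`, where `a`, `b`, `c` are the sums of the arrows of type `A`, `B`, `C`:
the sum of the oriented cycles `αβγ` minus the sum of the oriented cycles `αγβ`, with
`α`, `β`, `γ` of type `A`, `B`, `C`. -/
noncomputable def potential (k : Type*) [Field k] (l m : ℕ) : List (Arrow l m) →₀ k :=
  ∑ α : Arrow l m, ∑ β : Arrow l m, ∑ γ : Arrow l m,
    if IsA α.1 ∧ IsB β.1 ∧ IsC γ.1 then
      (if (quiver l m).tgt α = (quiver l m).src β ∧ (quiver l m).tgt β = (quiver l m).src γ ∧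
          (quiver l m).tgt γ = (quiver l m).src α then Finsupp.single [α, β, γ] 1 else 0) -
      (if (quiver l m).tgt α = (quiver l m).src γ ∧ (quiver l m).tgt γ = (quiver l m).src β ∧
          (quiver l m).tgt β = (quiver l m).src α then Finsupp.single [α, γ, β] 1 else 0)
    else 0

/-- The Jacobian algebra of `◇̄_l^m` with its potential. -/
abbrev JacAlg (k : Type*) [Field k] (l m : ℕ) : Type _ :=
  FQuiver.Jac k (quiver l m) (potential k l m)

/-- The trivial path at the vertex `v`, in the Jacobian algebra. -/
noncomputable def idem (k : Type*) [Field k] (l m : ℕ) (v : Vertex l m) : JacAlg k l m :=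
  FQuiver.toJac k (quiver l m) (potential k l m) (FQuiver.idemp k (quiver l m) v)

/-- The indecomposable injective module `I_v` of the Jacobian algebra. -/
abbrev injAt (k : Type*) [Field k] (l m : ℕ) (v : Vertex l m) : Type _ :=
  Inj k (JacAlg k l m) (idem k l m v)

/-- The morphism `I_w → I_u` given by an arrow `a : u → w`. -/
noncomputable def arrowMap (k : Type*) [Field k] (l m : ℕ) (a : Arrow l m) {u w : Vertex l m}
    (_hu : (quiver l m).src a = u) (hw : (quiver l m).tgt a = w) :
    injAt k l m w →ₗ[(JacAlg k l m)ᵐᵒᵖ] injAt k l m u :=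
  Inj.map (idem k l m u)
    (FQuiver.toJac k (quiver l m) (potential k l m) (FQuiver.arr k (quiver l m) a)) (by
      subst hw
      rw [← FQuiver.arr_mul_idemp, map_mul]
      exact Ideal.mul_mem_left _ _ (Ideal.subset_span rfl))

/-- The frozen vertices `1, …, m` (those of the central determinants); `i : Fin m` stands for the
frozen vertex `i + 1`. -/
def detVertex (l m : ℕ) (hl : 2 ≤ l) (hm : 2 ≤ m) (i : Fin m) : Vertex l m :=
  ⟨if i.1 = 0 then (2, (l : ℤ), (l : ℤ)) else (i.1 + 1, 2 * (l : ℤ), 0), by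
    have := i.2
    split_ifs <;> rw [mem_vertexSet] <;> omega⟩

theorem right_isPoint {l m h : ℕ} (hm : 2 ≤ m) (h1 : 1 ≤ h) (h2 : h < l) (ε : ℤˣ) :
    IsPoint l m m (2 * l - h) (ε * h) := by
  unfold IsPoint
  rcases Int.units_eq_one_or ε with rfl | rfl <;> simp only [Units.val_one, Units.val_neg,
    one_mul, neg_mul] <;> omega

/-- The frozen vertices other than `1, …, m`: for `1 ≤ h ≤ l - 1` and a sign `ε`, the vertex at
`(2 l - h, ε h)` on the right edge of the last diamond. -/
def boundaryVertex (l m h : ℕ) (hm : 2 ≤ m) (h1 : 1 ≤ h) (h2 : h < l) (ε : ℤˣ) : Vertex l m :=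
  ⟨glue l m (2 * l - h) (ε * h), glue_mem (right_isPoint hm h1 h2 ε)⟩

/-- The direction `(-1, ε)`. -/
def westDir (ε : ℤˣ) : Dir := if ε = 1 then Dir.nw else Dir.sw

theorem westDir_dx (ε : ℤˣ) : (westDir ε).dx = -1 := by
  rcases Int.units_eq_one_or ε with rfl | rfl <;> rfl

theorem westDir_dy (ε : ℤˣ) : (westDir ε).dy = ε := by
  rcases Int.units_eq_one_or ε with rfl | rfl <;> rfl

/-- The arrow `a_{v',v}` from the predecessor `v'` (at height `h - 1`) to `v` (at height `h`) on the
right edge of the last diamond. -/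
def boundaryArrow (l m h : ℕ) (hm : 2 ≤ m) (h1 : 2 ≤ h) (h2 : h < l) (ε : ℤˣ) : Arrow l m :=
  ⟨(westDir ε, m, 2 * l - h + 1, ε * (h - 1)), by
    rw [mem_arrowSet]
    refine Or.inl ⟨?_, ?_, ?_⟩
    · unfold IsPoint
      rcases Int.units_eq_one_or ε with rfl | rfl <;> simp only [Units.val_one, Units.val_neg,
        one_mul, neg_mul] <;> omega
    · unfold IsPoint
      rw [westDir_dx, westDir_dy]
      rcases Int.units_eq_one_or ε with rfl | rfl <;> simp only [Units.val_one, Units.val_neg,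
        one_mul, neg_mul] <;> omega
    · rintro ⟨h3, -⟩
      exfalso
      rcases Int.units_eq_one_or ε with rfl | rfl <;> simp only [Units.val_one, Units.val_neg,
        one_mul, neg_mul] at h3 <;> omega⟩

theorem boundaryArrow_tgt (l m h : ℕ) (hm : 2 ≤ m) (h1 : 2 ≤ h) (h2 : h < l) (ε : ℤˣ) :
    (quiver l m).tgt (boundaryArrow l m h hm h1 h2 ε) =
      boundaryVertex l m h hm (by omega) h2 ε := by
  apply Subtype.ext
  simp only [quiver, rawTgt, boundaryArrow, boundaryVertex, westDir_dx, westDir_dy]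
  congr 1 <;> ring

theorem boundaryArrow_src (l m h : ℕ) (hm : 2 ≤ m) (h1 : 2 ≤ h) (h2 : h < l) (ε : ℤˣ) :
    (quiver l m).src (boundaryArrow l m h hm h1 h2 ε) =
      boundaryVertex l m (h - 1) hm (by omega) (by omega) ε := by
  apply Subtype.ext
  simp only [quiver, rawSrc, boundaryArrow, boundaryVertex]
  push_cast [Nat.cast_sub (show 1 ≤ h by omega)]
  congr 1
  ring

/-! ### The path `p_v` -/

/-- The straight line of `r` arrows in direction `d` from the point `(x, y)` of the
diamond `n`. -/
def line (d : Dir) (n : ℕ) : ℤ → ℤ → ℕ → List RawArrow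
  | _, _, 0 => []
  | x, y, r + 1 => (d, n, x, y) :: line d n (x + d.dx) (y + d.dy) r

/-- The sign of the left edge (upper or lower) at which the first part of `p_v` leaves the
diamond `n`: `- ε` for even `n` and `ε` for odd `n`. -/
def sgn (ε : ℤˣ) (n : ℕ) : ℤˣ := if Even n then -ε else ε

/-- The height of the second part of `p_v` in the diamond `n`: `j` for even `n`
and `l - j` for odd `n`. -/
def rowHeight (l j n : ℕ) : ℕ := if Even n then j else l - j

/-- The first part of `p_v`, from the last diamond down to the left edge of the diamond `2`. In the
diamond `n` it consists of the `l` arrows on the straight line from the right edge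
vertex `(l + j, - σ (l - j))` to the left edge vertex `(j, σ j)`, where `σ = sgn ε n`.
The argument `r` is the number of diamonds, so that the last one is `r + 1`. -/
def firstPart (l j : ℕ) (ε : ℤˣ) : ℕ → List RawArrow
  | 0 => []
  | r + 1 => line (westDir (sgn ε (r + 2))) (r + 2) (l + j) (sgn ε (r + 2) * (j - l)) l ++
      firstPart l j ε r

/-- The second part of `p_v`, from the left edge of the diamond `2` to the right edge of the last
diamond. In the diamond `n` it is the whole horizontal line at height `ε` times `rowHeight l j n`.
The argument `r` is the number of diamonds, so that the last one is `r + 1`. -/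
def secondPart (l j : ℕ) (ε : ℤˣ) : ℕ → List RawArrow
  | 0 => []
  | r + 1 => secondPart l j ε r ++
      line Dir.east (r + 2) (rowHeight l j (r + 2)) (ε * rowHeight l j (r + 2))
        (l - rowHeight l j (r + 2))

/-- The arrows of `p_v` for the boundary vertex `v` at `(2 l - h, ε h)`. -/
def pathRaw (l m h : ℕ) (ε : ℤˣ) : List RawArrow :=
  firstPart l (rowHeight l h m) ε (m - 1) ++ secondPart l (rowHeight l h m) ε (m - 1)

def RawWalk (l : ℕ) : ℕ × ℤ × ℤ → List RawArrow → ℕ × ℤ × ℤ → Prop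
  | u, [], w => u = w
  | u, a :: L, w => rawSrc l a = u ∧ RawWalk l (rawTgt l a) L w

theorem RawWalk.append {l : ℕ} {u v w : ℕ × ℤ × ℤ} {L M : List RawArrow}
    (h1 : RawWalk l u L v) (h2 : RawWalk l v M w) : RawWalk l u (L ++ M) w := by
  induction L generalizing u with
  | nil => cases h1; exact h2
  | cons a L ih => exact ⟨h1.1, ih h1.2⟩

theorem rawWalk_line (l : ℕ) (d : Dir) (n : ℕ) (x y : ℤ) (r : ℕ) :
    RawWalk l (glue l n x y) (line d n x y r) (glue l n (x + r * d.dx) (y + r * d.dy)) := by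
  induction r generalizing x y with
  | zero => simp [line, RawWalk]
  | succ r ih =>
    refine ⟨rfl, ?_⟩
    have := ih (x + d.dx) (y + d.dy)
    have e1 : x + d.dx + r * d.dx = x + ((r + 1 : ℕ) : ℤ) * d.dx := by push_cast; ring
    have e2 : y + d.dy + r * d.dy = y + ((r + 1 : ℕ) : ℤ) * d.dy := by push_cast; ring
    rw [e1, e2] at this
    exact this

theorem mem_line {d : Dir} {n : ℕ} {x y : ℤ} {r : ℕ} {a : RawArrow} (h : a ∈ line d n x y r) :
    ∃ i : ℕ, i < r ∧ a = (d, n, x + i * d.dx, y + i * d.dy) := by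
  induction r generalizing x y with
  | zero => simp [line] at h
  | succ r ih =>
    rcases List.mem_cons.1 h with rfl | h
    · exact ⟨0, by omega, by simp⟩
    · obtain ⟨i, hi, rfl⟩ := ih h
      refine ⟨i + 1, by omega, ?_⟩
      simp only [Prod.mk.injEq, true_and]
      constructor <;> push_cast <;> ring

/-- The vertex at which `p_v` starts, in the diamond `n` (the last one). -/
def startRaw (l j : ℕ) (ε : ℤˣ) (n : ℕ) : ℕ × ℤ × ℤ :=
  glue l n (l + j) (sgn ε n * (j - l))

theorem sgn_succ (ε : ℤˣ) (n : ℕ) : sgn ε (n + 1) = -sgn ε n := by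
  unfold sgn
  by_cases h : Even n
  · simp [h, Nat.even_add_one]
  · simp [h, Nat.even_add_one]

theorem rowHeight_succ {l j : ℕ} (h : j ≤ l) (n : ℕ) :
    rowHeight l j (n + 1) = l - rowHeight l j n := by
  unfold rowHeight
  by_cases hn : Even n
  · simp [hn, Nat.even_add_one]
  · simp [hn, Nat.even_add_one]; omega

theorem rowHeight_bounds {l j : ℕ} (h1 : 1 ≤ j) (h2 : j < l) (n : ℕ) :
    1 ≤ rowHeight l j n ∧ rowHeight l j n < l := by
  unfold rowHeight; split_ifs <;> omega

theorem rowHeight_rowHeight {l h : ℕ} (hl : h ≤ l) (m : ℕ) :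
    rowHeight l (rowHeight l h m) m = h := by
  unfold rowHeight; split_ifs <;> omega

/-- On the left edge of the diamond `n ≥ 3` a point is glued to the right edge of the diamond
`n - 1`. -/
theorem glue_left {l n j : ℕ} (h1 : 1 ≤ j) (h2 : j < l) (σ : ℤˣ) :
    glue l (n + 3) j (σ * j) = glue l (n + 2) (l + j) (σ * (l - j)) := by
  unfold glue
  rcases Int.units_eq_one_or σ with rfl | rfl <;>
    simp only [Units.val_one, Units.val_neg, one_mul, neg_mul] <;>
    split_ifs <;> first | omega | (simp; try omega)

theorem glue_two {l j : ℕ} (σ : ℤˣ) : glue l 2 j (σ * j) = (2, (j : ℤ), (j : ℤ)) := by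
  unfold glue
  rcases Int.units_eq_one_or σ with rfl | rfl <;> simp

theorem firstPart_walk {l j : ℕ} (h1 : 1 ≤ j) (h2 : j < l) (ε : ℤˣ) (r : ℕ) :
    RawWalk l (startRaw l j ε (r + 2)) (firstPart l j ε (r + 1)) (2, (j : ℤ), (j : ℤ)) := by
  have key : ∀ r : ℕ, RawWalk l (startRaw l j ε (r + 2))
      (line (westDir (sgn ε (r + 2))) (r + 2) (l + j) (sgn ε (r + 2) * (j - l)) l)
      (glue l (r + 2) j (sgn ε (r + 2) * j)) := by
    intro r
    have := rawWalk_line l (westDir (sgn ε (r + 2))) (r + 2) (l + j) (sgn ε (r + 2) * (j - l)) l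
    rw [westDir_dx, westDir_dy] at this
    unfold startRaw
    convert this using 2 <;> ring
  induction r with
  | zero =>
    have := key 0
    rw [glue_two] at this
    simpa [firstPart] using this
  | succ r ih =>
    have := key (r + 1)
    rw [glue_left h1 h2] at this
    refine this.append ?_
    convert ih using 2
    unfold startRaw
    congr 1
    rw [show r + 1 + 2 = (r + 2) + 1 by ring, sgn_succ]
    push_cast; ring

theorem secondPart_walk {l j : ℕ} (h1 : 1 ≤ j) (h2 : j < l) (ε : ℤˣ) (r : ℕ) :
    RawWalk l (2, (j : ℤ), (j : ℤ)) (secondPart l j ε (r + 1))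
      (glue l (r + 2) (2 * l - rowHeight l j (r + 2)) (ε * rowHeight l j (r + 2))) := by
  have key : ∀ r : ℕ, RawWalk l
      (glue l (r + 2) (rowHeight l j (r + 2)) (ε * rowHeight l j (r + 2)))
      (line Dir.east (r + 2) (rowHeight l j (r + 2)) (ε * rowHeight l j (r + 2))
        (l - rowHeight l j (r + 2)))
      (glue l (r + 2) (2 * l - rowHeight l j (r + 2)) (ε * rowHeight l j (r + 2))) := by
    intro r
    have := rawWalk_line l Dir.east (r + 2) (rowHeight l j (r + 2)) (ε * rowHeight l j (r + 2))
        (l - rowHeight l j (r + 2))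
    have hb := (rowHeight_bounds h1 h2 (r + 2)).2
    rw [Nat.cast_sub hb.le] at this
    convert this using 2
    · simp only [Dir.dx]; ring
    · simp [Dir.dy]
  induction r with
  | zero =>
    have := key 0
    rw [glue_two] at this
    simpa [secondPart, rowHeight] using this
  | succ r ih =>
    refine RawWalk.append ih ?_
    have := key (r + 1)
    have hb := rowHeight_bounds h1 h2 (r + 3)
    rw [show r + 1 + 2 = r + 3 by ring] at this ⊢
    rw [glue_left hb.1 hb.2] at this
    convert this using 2
    · have e : rowHeight l j (r + 3) = l - rowHeight l j (r + 2) := rowHeight_succ h2.le (r + 2)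
      omega
    · have e : rowHeight l j (r + 3) = l - rowHeight l j (r + 2) := rowHeight_succ h2.le (r + 2)
      have := (rowHeight_bounds h1 h2 (r + 2)).2
      congr 1
      omega

theorem firstPart_mem {l m j : ℕ} (h1 : 1 ≤ j) (h2 : j < l) (ε : ℤˣ) (r : ℕ) (hr : r + 1 ≤ m)
    {a : RawArrow} (ha : a ∈ firstPart l j ε r) : a ∈ arrowSet l m := by
  induction r with
  | zero => simp [firstPart] at ha
  | succ r ih =>
    rcases List.mem_append.1 ha with ha | ha
    · obtain ⟨i, hi, rfl⟩ := mem_line ha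
      rw [mem_arrowSet]
      left
      rw [westDir_dx, westDir_dy]
      unfold IsPoint OnLeftEdge
      simp only [westDir_dx, westDir_dy]
      generalize sgn ε (r + 2) = σ
      rcases Int.units_eq_one_or σ with rfl | rfl <;>
        simp only [Units.val_one, Units.val_neg, one_mul, neg_mul, mul_neg, mul_one] <;>
        refine ⟨?_, ?_, ?_⟩ <;> omega
    · exact ih (by omega) ha

theorem secondPart_mem {l m j : ℕ} (h1 : 1 ≤ j) (h2 : j < l) (ε : ℤˣ) (r : ℕ) (hr : r + 1 ≤ m)
    {a : RawArrow} (ha : a ∈ secondPart l j ε r) : a ∈ arrowSet l m := by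
  induction r with
  | zero => simp [secondPart] at ha
  | succ r ih =>
    rcases List.mem_append.1 ha with ha | ha
    · exact ih (by omega) ha
    · obtain ⟨i, hi, rfl⟩ := mem_line ha
      obtain ⟨hb1, hb2⟩ := rowHeight_bounds h1 h2 (r + 2)
      rw [mem_arrowSet]
      left
      unfold IsPoint OnLeftEdge
      simp only [Dir.dx, Dir.dy]
      rcases Int.units_eq_one_or ε with rfl | rfl <;>
        simp only [Units.val_one, Units.val_neg, one_mul, neg_mul, mul_zero, add_zero] <;>
        refine ⟨?_, ?_, ?_⟩ <;> omega

theorem pathRaw_mem {l m h : ℕ} (hm : 2 ≤ m) (h1 : 1 ≤ h) (h2 : h < l) (ε : ℤˣ)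
    (a : RawArrow) (ha : a ∈ pathRaw l m h ε) : a ∈ arrowSet l m := by
  obtain ⟨hb1, hb2⟩ := rowHeight_bounds h1 h2 m
  rcases List.mem_append.1 ha with ha | ha
  · exact firstPart_mem hb1 hb2 ε _ (by omega) ha
  · exact secondPart_mem hb1 hb2 ε _ (by omega) ha

theorem pathRaw_walk {l m h : ℕ} (hm : 2 ≤ m) (h1 : 1 ≤ h) (h2 : h < l) (ε : ℤˣ) :
    RawWalk l (startRaw l (rowHeight l h m) ε m) (pathRaw l m h ε)
      (glue l m (2 * l - h) (ε * h)) := by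
  obtain ⟨hb1, hb2⟩ := rowHeight_bounds h1 h2 m
  obtain ⟨r, rfl⟩ : ∃ r, m = r + 2 := ⟨m - 2, by omega⟩
  have e := rowHeight_rowHeight h2.le (r + 2)
  have w1 := firstPart_walk hb1 hb2 ε r
  have w2 := secondPart_walk hb1 hb2 ε r
  rw [e] at w2
  exact w1.append w2

theorem isWalk_of_rawWalk {l m : ℕ} {L : List RawArrow} (hL : ∀ a ∈ L, a ∈ arrowSet l m)
    {u w : Vertex l m} (h : RawWalk l u.1 L w.1) :
    (quiver l m).IsWalk u (L.pmap Subtype.mk hL) w := by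
  induction L generalizing u with
  | nil => exact Subtype.ext h
  | cons a L ih =>
    exact ⟨Subtype.ext h.1, ih (fun b hb => hL b (List.mem_cons_of_mem _ hb))
      (u := ⟨rawTgt l a, rawTgt_mem (hL a List.mem_cons_self)⟩) h.2⟩

theorem startRaw_mem {l m j : ℕ} (hm : 2 ≤ m) (h1 : 1 ≤ j) (h2 : j < l) (ε : ℤˣ) :
    startRaw l j ε m ∈ vertexSet l m := by
  apply glue_mem
  unfold IsPoint
  generalize sgn ε m = σ
  rcases Int.units_eq_one_or σ with rfl | rfl <;> simp only [Units.val_one, Units.val_neg,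
    one_mul, neg_mul] <;> omega

/-- The path `p_v` of the boundary vertex `v` at `(2 l - h, ε h)`; it ends at `v`. -/
def boundaryPath (l m h : ℕ) (hm : 2 ≤ m) (h1 : 1 ≤ h) (h2 : h < l) (ε : ℤˣ) :
    FQuiver.QPath (quiver l m) where
  start := ⟨startRaw l (rowHeight l h m) ε m,
    startRaw_mem hm (rowHeight_bounds h1 h2 m).1 (rowHeight_bounds h1 h2 m).2 ε⟩
  arrows := (pathRaw l m h ε).pmap Subtype.mk (pathRaw_mem hm h1 h2 ε)
  finish := boundaryVertex l m h hm h1 h2 ε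
  walk := isWalk_of_rawWalk (pathRaw_mem hm h1 h2 ε) (pathRaw_walk hm h1 h2 ε)

/-! ### The boundary representations -/

/-- The direct sum of `κ n` copies of `I_n` over the frozen vertices `n = 1, …, m`. -/
abbrev detInj (k : Type*) [Field k] (l m : ℕ) (hl : 2 ≤ l) (hm : 2 ≤ m) (κ : Fin m → ℕ) : Type _ :=
  (n : Fin m) → Fin (κ n) → injAt k l m (detVertex l m hl hm n)

/-- The morphism `I_v → I_{v'}` given by the arrow `a_{v',v}`, for the boundary vertex `v` at height
`h ≥ 2`, so that the predecessor `v'` is defined. -/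
noncomputable def predMap (k : Type*) [Field k] (l m h : ℕ) (hm : 2 ≤ m) (h1 : 2 ≤ h) (h2 : h < l)
    (ε : ℤˣ) :
    injAt k l m (boundaryVertex l m h hm (by omega) h2 ε) →ₗ[(JacAlg k l m)ᵐᵒᵖ]
      injAt k l m (boundaryVertex l m (h - 1) hm (by omega) (by omega) ε) :=
  arrowMap k l m (boundaryArrow l m h hm h1 h2 ε) (boundaryArrow_src l m h hm h1 h2 ε)
    (boundaryArrow_tgt l m h hm h1 h2 ε)

/-- The boundary representation `T_v` of the boundary vertex `v` at `(2 l - h, ε h)`, for a given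
morphism `f : I_v → ⨁ κ_n I_n`: the kernel of `(a_{v',v}, f)` if the predecessor `v'` is
defined, that is, if `h ≥ 2`, and the kernel of `f` if `v` is terminal, that is, if `h = 1`. -/
noncomputable def boundaryRep (k : Type*) [Field k] (l m h : ℕ) (hl : 2 ≤ l) (hm : 2 ≤ m)
    (h1 : 1 ≤ h) (h2 : h < l) (ε : ℤˣ) (κ : Fin m → ℕ)
    (f : injAt k l m (boundaryVertex l m h hm h1 h2 ε) →ₗ[(JacAlg k l m)ᵐᵒᵖ]
      detInj k l m hl hm κ) :
    Submodule (JacAlg k l m)ᵐᵒᵖ (injAt k l m (boundaryVertex l m h hm h1 h2 ε)) :=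
  if hp : 2 ≤ h then LinearMap.ker ((predMap k l m h hm hp h2 ε).prod f) else LinearMap.ker f

/-- The module `T` is not supported on any of the frozen vertices `1, …, m`. -/
def DetUnsupported {k : Type*} [Field k] {l m : ℕ} (hl : 2 ≤ l) (hm : 2 ≤ m) {v : Vertex l m}
    (T : Submodule (JacAlg k l m)ᵐᵒᵖ (injAt k l m v)) : Prop :=
  ∀ n : Fin m, ∀ x ∈ T, MulOpposite.op (idem k l m (detVertex l m hl hm n)) • x = 0

/-- The right module `T` over the Jacobian algebra is, as a representation of the
quiver, isomorphic to the path module `S(p)`. -/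
def IsoPathModule {k : Type*} [Field k] {l m : ℕ} {v : Vertex l m}
    (T : Submodule (JacAlg k l m)ᵐᵒᵖ (injAt k l m v)) (p : FQuiver.QPath (quiver l m)) : Prop :=
  ∃ φ : T ≃ₗ[k] (Fin (p.arrows.length + 1) → k),
    ∀ (c : FQuiver.PathAlg k (quiver l m)) (x : T),
      φ (MulOpposite.op (FQuiver.toJac k (quiver l m) (potential k l m) c) • x) =
        Matrix.vecMul (φ x) (p.rep k c)

end Diamond

/-! ### Generalities on path algebras -/

namespace FQuiver

section PathAlgebra

variable (k : Type*) [CommRing k] {V A : Type} [Fintype V] (Q : FQuiver V A)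

/-! Write `J` for the Jacobian algebra. A submodule `T` of `I_v = Hom(J e_v, k)` is studied through
its annihilator `K`, a left ideal of `J` inside `J e_v`. Let `T = T_v`. If `T` is not supported on
the frozen vertices `1, …, m`, then `K` contains `e_n J e_v` for each of them, and if `h ≥ 2` it
also contains the arrow `a_{v',v}`. The point is that this little information, pushed backwards
through the relations of `J`, determines `K`.

The relations say that parallel paths of length two around an arrow agree. Inside a diamond the two
west directions commute with each other (`westArw_mul_westArw`), and a west step commutes with an
east step (`westArw_mul_eastArw`). At a right edge a west-east path continues as an east-west path
in the next diamond (`westArw_mul_eastArw_right`). On the left edge of the diamond `2` the east-west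
paths in the two halves coincide (`eastArw_mul_westArw_left`). Paths that leave a diamond count as
zero, so that these identities hold without exceptions.

Upper bound. One walks along `p_v` backwards from `v` and shows that every arrow ending at the
current vertex, other than the path's own preceding arrow, sends the current suffix of `p_v` into
`K` (`steps_pathRaw`). A foreign step is commuted past the last arrow of the path until it meets a
step already known to lie in `K`. The edge relation of the diamond `2` makes the walk turn from the
row into the diagonal of the other half. At the start of `p_v` no arrow continues, so the suffixes
span `J e_v` modulo `K`. A form in `T` is therefore determined by its values on them, and these
values transform as in `S(p_v)` (`form_smul_suffix`).

Lower bound. The first part of `p_v` consists of arrows of one type, `B` or `C`, and the second of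
arrows of type `A`. No two consecutive arrows lie on a triangle of the potential, hence `S(p_v)` is
a `J`-module (`rep_cyclicDeriv`). Its vectors give forms on `J e_v`. They lie in `T` for every
`f_v`, because `p_v` avoids the frozen vertices `1, …, m` and ends with an east arrow
(`pathForm_mem_boundaryRep`).

Generic vanishing. `J` is finite-dimensional (`finite_jacAlg`), since every element is a combination
of words with west steps first, then climbs along the left edge of the diamond `2`, then east steps,
all of bounded length. Once `k_n ≥ dim e_n J e_v`, the kernel of `f_v` has no support at `n` if a
square matrix of coordinates of `f_v` is invertible, which is an open condition
(`Inj.holdsGenerically_ker_unsupported`). -/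

theorem idemp_mul_self (u : V) : idemp k Q u * idemp k Q u = idemp k Q u := by
  unfold idemp
  rw [← map_mul]
  exact RingQuot.mkAlgHom_rel k (PathRel.idem u)

theorem idemp_mul_of_ne {u w : V} (h : u ≠ w) : idemp k Q u * idemp k Q w = 0 := by
  unfold idemp
  rw [← map_mul, RingQuot.mkAlgHom_rel k (PathRel.orth (k := k) (Q := Q) u w h), map_zero]

theorem sum_idemp : ∑ u, idemp k Q u = 1 := by
  unfold idemp
  rw [← map_sum, RingQuot.mkAlgHom_rel k (PathRel.one (k := k) (Q := Q)), map_one]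

theorem idemp_src_mul_arr (a : A) : idemp k Q (Q.src a) * arr k Q a = arr k Q a := by
  unfold arr idemp
  rw [← map_mul]
  exact RingQuot.mkAlgHom_rel k (PathRel.src_mul a)

theorem idemp_mul_arr [DecidableEq V] (u : V) (a : A) :
    idemp k Q u * arr k Q a = if Q.src a = u then arr k Q a else 0 := by
  split_ifs with h
  · rw [← h, idemp_src_mul_arr]
  · rw [← idemp_src_mul_arr, ← mul_assoc, idemp_mul_of_ne k Q (Ne.symm h), zero_mul]

theorem arr_mul_idemp' [DecidableEq V] (u : V) (a : A) :
    arr k Q a * idemp k Q u = if Q.tgt a = u then arr k Q a else 0 := by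
  split_ifs with h
  · rw [← h, arr_mul_idemp]
  · rw [← arr_mul_idemp, mul_assoc, idemp_mul_of_ne k Q h, mul_zero]

theorem arr_mul_arr_of_ne {a b : A} (h : Q.tgt a ≠ Q.src b) : arr k Q a * arr k Q b = 0 := by
  rw [← arr_mul_idemp k Q a, ← idemp_src_mul_arr k Q b, mul_assoc, ← mul_assoc (idemp k Q (Q.tgt a)),
    idemp_mul_of_ne k Q h, zero_mul, mul_zero]

theorem pathAlg_induction {C : PathAlg k Q → Prop} (hk : ∀ c, C (algebraMap k _ c))
    (he : ∀ u, C (idemp k Q u)) (ha : ∀ a, C (arr k Q a))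
    (hmul : ∀ x y, C x → C y → C (x * y)) (hadd : ∀ x y, C x → C y → C (x + y))
    (x : PathAlg k Q) : C x := by
  obtain ⟨x, rfl⟩ := RingQuot.mkAlgHom_surjective k (PathRel k Q) x
  induction x using FreeAlgebra.induction with
  | grade0 r => rw [AlgHom.commutes]; exact hk r
  | grade1 x =>
    rcases x with u | a
    · exact he u
    · exact ha a
  | mul x y hx hy => rw [map_mul]; exact hmul _ _ hx hy
  | add x y hx hy => rw [map_add]; exact hadd _ _ hx hy

theorem wordDeriv_triple [DecidableEq A] (a α β γ : A) :
    wordDeriv k Q a [α, β, γ] = (if α = a then arr k Q β * arr k Q γ else 0) +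
      (if β = a then arr k Q γ * arr k Q α else 0) +
      (if γ = a then arr k Q α * arr k Q β else 0) := by
  simp [wordDeriv, Fin.sum_univ_three]

end PathAlgebra

end FQuiver

/-! ### Cyclic derivatives of the potential. -/

namespace Diamond

open FQuiver

section Potential

variable (k : Type*) [Field k] (l m : ℕ)

open Classical in
/-- The sum of the arrows with the property `p`. -/
noncomputable def arrSum (p : RawArrow → Prop) : PathAlg k (quiver l m) :=
  ∑ α : Arrow l m, if p α.1 then arr k (quiver l m) α else 0

/-- A triangle of arrows of types `A`, `B`, `C`, traversed in the order in which they are given. -/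
def IsTriangle (α β γ : Arrow l m) : Prop :=
  (quiver l m).tgt α = (quiver l m).src β ∧ (quiver l m).tgt β = (quiver l m).src γ ∧
    (quiver l m).tgt γ = (quiver l m).src α

open Classical in
theorem cyclicDeriv_potential_eq_sum (a : Arrow l m) :
    cyclicDeriv k (quiver l m) (potential k l m) a =
      ∑ α : Arrow l m, ∑ β : Arrow l m, ∑ γ : Arrow l m,
        if IsA α.1 ∧ IsB β.1 ∧ IsC γ.1 then
          (if IsTriangle l m α β γ then wordDeriv k (quiver l m) a [α, β, γ] else 0) -
          (if IsTriangle l m α γ β then wordDeriv k (quiver l m) a [α, γ, β] else 0)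
        else 0 := by
  have h : ∀ W : List (Arrow l m) →₀ k, cyclicDeriv k (quiver l m) W a =
      Finsupp.linearCombination k (wordDeriv k (quiver l m) a) W := fun W => rfl
  rw [h, potential]
  simp only [map_sum]
  refine Finset.sum_congr rfl fun α _ => Finset.sum_congr rfl fun β _ =>
    Finset.sum_congr rfl fun γ _ => ?_
  unfold IsTriangle
  split_ifs <;> simp

open Classical in
theorem idemp_arrSum_arrSum_idemp (p q : RawArrow → Prop) (t s : Vertex l m) :
    idemp k (quiver l m) t * (arrSum k l m p * arrSum k l m q) * idemp k (quiver l m) s =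
      ∑ β : Arrow l m, ∑ γ : Arrow l m,
        if p β.1 ∧ q γ.1 ∧ t = (quiver l m).src β ∧ (quiver l m).tgt β = (quiver l m).src γ ∧
          (quiver l m).tgt γ = s then arr k (quiver l m) β * arr k (quiver l m) γ else 0 := by
  unfold arrSum
  rw [Finset.sum_mul_sum, Finset.mul_sum, Finset.sum_mul]
  refine Finset.sum_congr rfl fun β _ => ?_
  rw [Finset.mul_sum, Finset.sum_mul]
  refine Finset.sum_congr rfl fun γ _ => ?_
  by_cases hp : p β.1
  · by_cases hq : q γ.1
    · simp only [hp, hq, if_true, true_and]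
      rw [← mul_assoc, idemp_mul_arr, mul_assoc, arr_mul_idemp']
      by_cases h1 : (quiver l m).src β = t
      · by_cases h2 : (quiver l m).tgt γ = s
        · by_cases h3 : (quiver l m).tgt β = (quiver l m).src γ
          · simp [h1, h2, h3]
          · simp [h1, h2, h3, arr_mul_arr_of_ne k (quiver l m) h3]
        · simp [h2]
      · simp [h1, Ne.symm h1]
    · simp [hq]
  · simp [hp]

open Classical in
-- Removing `a` from a triangle leaves a path of length two from `tgt a` to `src a`, so the closing
-- conditions of the triangle turn into the two outer idempotents. In terms of the global sums each
-- relation is a commutator cut down by idempotents. An arrow of two types contributes two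
-- commutators.
theorem cyclicDeriv_potential (a : Arrow l m) :
    cyclicDeriv k (quiver l m) (potential k l m) a =
      idemp k (quiver l m) ((quiver l m).tgt a) *
        ((if IsA a.1 then arrSum k l m IsB * arrSum k l m IsC -
            arrSum k l m IsC * arrSum k l m IsB else 0) +
          (if IsB a.1 then arrSum k l m IsC * arrSum k l m IsA -
            arrSum k l m IsA * arrSum k l m IsC else 0) +
          (if IsC a.1 then arrSum k l m IsA * arrSum k l m IsB -
            arrSum k l m IsB * arrSum k l m IsA else 0)) *
        idemp k (quiver l m) ((quiver l m).src a) := by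
  rw [cyclicDeriv_potential_eq_sum]
  set t := (quiver l m).tgt a with ht
  set s := (quiver l m).src a with hs
  have e : ∀ (c : Prop) (x y : PathAlg k (quiver l m)),
      idemp k (quiver l m) t * (if c then x - y else 0) * idemp k (quiver l m) s =
        (if c then idemp k (quiver l m) t * x * idemp k (quiver l m) s else 0) -
        (if c then idemp k (quiver l m) t * y * idemp k (quiver l m) s else 0) := by
    intro c x y
    split_ifs <;> simp [mul_sub, sub_mul]
  rw [mul_add, mul_add, add_mul, add_mul, e, e, e]
  simp only [idemp_arrSum_arrSum_idemp]
  let P (α β γ : Arrow l m) : Prop := IsA α.1 ∧ IsB β.1 ∧ IsC γ.1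
  let f (x y : Arrow l m) : PathAlg k (quiver l m) := arr k (quiver l m) x * arr k (quiver l m) y
  -- Each triangle is differentiated at its first, second or third arrow. The six indicator terms
  -- let every triple sum collapse at the arrow `a`.
  have key : ∀ α β γ : Arrow l m,
      (if IsA α.1 ∧ IsB β.1 ∧ IsC γ.1 then
          (if IsTriangle l m α β γ then wordDeriv k (quiver l m) a [α, β, γ] else 0) -
          (if IsTriangle l m α γ β then wordDeriv k (quiver l m) a [α, γ, β] else 0)
        else 0) =
      ((if α = a then if P α β γ ∧ IsTriangle l m α β γ then f β γ else 0 else 0) -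
       (if α = a then if P α β γ ∧ IsTriangle l m α γ β then f γ β else 0 else 0)) +
      ((if β = a then if P α β γ ∧ IsTriangle l m α β γ then f γ α else 0 else 0) -
       (if β = a then if P α β γ ∧ IsTriangle l m α γ β then f α γ else 0 else 0)) +
      ((if γ = a then if P α β γ ∧ IsTriangle l m α β γ then f α β else 0 else 0) -
       (if γ = a then if P α β γ ∧ IsTriangle l m α γ β then f β α else 0 else 0)) := by
    intro α β γ
    simp only [wordDeriv_triple, P, f]
    by_cases h : IsA α.1 ∧ IsB β.1 ∧ IsC γ.1
    · by_cases h1 : IsTriangle l m α β γ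
      · by_cases h2 : IsTriangle l m α γ β
        · simp only [h, h1, h2, if_true, and_self]; abel
        · simp only [h, h1, h2, if_true, and_self, if_false, and_false, ite_self]; abel
      · by_cases h2 : IsTriangle l m α γ β
        · simp only [h, h1, h2, if_true, and_self, if_false, and_false, ite_self]; abel
        · simp only [h, h1, h2, if_true, and_self, if_false, and_false, ite_self]; abel
    · simp only [h, if_false, false_and, ite_self, sub_self, add_zero]
  simp only [key, Finset.sum_add_distrib, Finset.sum_sub_distrib]
  have s1 : ∀ g : Arrow l m → Arrow l m → Arrow l m → PathAlg k (quiver l m),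
      (∑ α, ∑ β, ∑ γ, if α = a then g α β γ else 0) = ∑ β, ∑ γ, g a β γ := by
    intro g
    rw [Finset.sum_eq_single a]
    · simp
    · intro b _ hb; simp [hb]
    · simp
  have s2 : ∀ g : Arrow l m → Arrow l m → Arrow l m → PathAlg k (quiver l m),
      (∑ α, ∑ β, ∑ γ, if β = a then g α β γ else 0) = ∑ α, ∑ γ, g α a γ := by
    intro g
    refine Finset.sum_congr rfl fun α _ => ?_
    rw [Finset.sum_eq_single a]
    · simp
    · intro b _ hb; simp [hb]
    · simp
  have s3 : ∀ g : Arrow l m → Arrow l m → Arrow l m → PathAlg k (quiver l m),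
      (∑ α, ∑ β, ∑ γ, if γ = a then g α β γ else 0) = ∑ α, ∑ β, g α β a := by
    intro g
    refine Finset.sum_congr rfl fun α _ => Finset.sum_congr rfl fun β _ => ?_
    simp
  rw [s1, s1, s2, s2, s3, s3]
  have fin : ∀ (c : Prop) (g h : Arrow l m → Arrow l m → PathAlg k (quiver l m)),
      (∀ x y, g x y = if c then h x y else 0) →
      (∑ x, ∑ y, g x y) = if c then ∑ x, ∑ y, h x y else 0 := by
    intro c g h hh
    simp only [hh]
    split_ifs <;> simp
  congr 1
  · congr 1
    · congr 1
      · refine fin _ _ _ fun x y => ?_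
        rw [← ite_and]; refine if_congr ?_ rfl rfl; simp only [P, IsTriangle]; grind
      · rw [Finset.sum_comm]
        refine fin _ _ _ fun x y => ?_
        rw [← ite_and]; refine if_congr ?_ rfl rfl; simp only [P, IsTriangle]; grind
    · congr 1
      · rw [Finset.sum_comm]
        refine fin _ _ _ fun x y => ?_
        rw [← ite_and]; refine if_congr ?_ rfl rfl; simp only [P, IsTriangle]; grind
      · refine fin _ _ _ fun x y => ?_
        rw [← ite_and]; refine if_congr ?_ rfl rfl; simp only [P, IsTriangle]; grind
  · congr 1
    · refine fin _ _ _ fun x y => ?_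
      rw [← ite_and]; refine if_congr ?_ rfl rfl; simp only [P, IsTriangle]; grind
    · rw [Finset.sum_comm]
      refine fin _ _ _ fun x y => ?_
      rw [← ite_and]; refine if_congr ?_ rfl rfl; simp only [P, IsTriangle]; grind

end Potential

end Diamond

namespace Diamond

open FQuiver

/-! ### Combinatorics of the glued diamonds -/

theorem glue_cases {l m n : ℕ} {x y : ℤ} (h : IsPoint l m n x y) :
    (-x < y ∧ y < x ∧ glue l n x y = (n, x, y)) ∨
    (n = 2 ∧ (y = x ∨ y = -x) ∧ glue l n x y = (2, x, x)) ∨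
    (3 ≤ n ∧ y = x ∧ glue l n x y = (n - 1, l + x, l - x)) ∨
    (3 ≤ n ∧ y = -x ∧ glue l n x y = (n - 1, l + x, x - l)) := by
  obtain ⟨h1, h2, h3, h4, h5, h6, h7⟩ := h
  unfold glue
  by_cases a : -x < y ∧ y < x
  · exact Or.inl ⟨a.1, a.2, if_pos a⟩
  · rw [if_neg a]
    by_cases b : n = 2
    · exact Or.inr (Or.inl ⟨b, by omega, if_pos b⟩)
    · rw [if_neg b]
      by_cases c : 0 < y
      · exact Or.inr (Or.inr (Or.inl ⟨by omega, by omega, by rw [if_pos c]⟩))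
      · exact Or.inr (Or.inr (Or.inr ⟨by omega, by omega, by rw [if_neg c]⟩))

/-- The arrows other than the one that starts at the frozen vertex `1`. -/
theorem arrow_cases {l m : ℕ} {a : RawArrow} (h : a ∈ arrowSet l m) :
    (IsPoint l m a.2.1 a.2.2.1 a.2.2.2 ∧
      IsPoint l m a.2.1 (a.2.2.1 + a.1.dx) (a.2.2.2 + a.1.dy) ∧
      (OnLeftEdge a → a.2.1 = 2 ∧ a.1 = Dir.sw)) ∨
    (2 ≤ l ∧ 2 ≤ m ∧ a = (Dir.sw, 2, (l : ℤ), (l : ℤ))) := mem_arrowSet.1 h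

/-- Edge arrows are listed only on right edges or on the upper left edge of the diamond `2`, and
there points represent themselves. Only east arrows can start at a point that gluing moves. -/
theorem rawSrc_of_ne_east {l m : ℕ} {a : RawArrow} (h : a ∈ arrowSet l m) (hd : a.1 ≠ Dir.east) :
    rawSrc l a = a.2 := by
  obtain ⟨d, n, x, y⟩ := a
  rcases arrow_cases h with ⟨h1, h2, h3⟩ | ⟨hl, hm, h⟩
  · dsimp only at h1 h2 h3 hd
    rcases glue_cases h1 with h | h | h | h
    · exact h.2.2
    all_goals
      refine h.2.2.trans ?_
      unfold OnLeftEdge at h3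
      unfold IsPoint at h1 h2
      cases d
      · exact absurd rfl hd
      all_goals
        simp only [Dir.dx, Dir.dy, reduceCtorEq, and_false, imp_false, and_true] at h1 h2 h3
        change _ = (n, x, y)
        simp only [Prod.mk.injEq, true_and]
        omega
  · simp only [Prod.mk.injEq] at h
    obtain ⟨rfl, rfl, rfl, rfl⟩ := h
    simp [rawSrc, glue]

/-- An east step cannot end on a left edge. -/
theorem rawTgt_of_east {l m n : ℕ} {x y : ℤ} (h : (Dir.east, n, x, y) ∈ arrowSet l m) :
    rawTgt l (Dir.east, n, x, y) = (n, x + 2, y) := by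
  rcases arrow_cases h with ⟨h1, h2, h3⟩ | ⟨hl, hm, h⟩
  · simp only [Dir.dx, Dir.dy] at h2 ⊢
    unfold rawTgt
    simp only [Dir.dx, Dir.dy, add_zero]
    rw [glue, if_pos]
    unfold IsPoint at h1 h2
    dsimp only at h1 h2
    omega
  · simp at h

theorem east_mem_arrowSet {l m n : ℕ} {x y : ℤ} :
    (Dir.east, n, x, y) ∈ arrowSet l m ↔ IsPoint l m n x y ∧ IsPoint l m n (x + 2) y := by
  rw [mem_arrowSet]
  unfold IsArrow OnLeftEdge
  simp only [Dir.dx, Dir.dy, add_zero, Prod.mk.injEq, reduceCtorEq, false_and, and_false, or_false,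
    imp_false]
  constructor
  · rintro ⟨h1, h2, -⟩
    exact ⟨h1, h2⟩
  · rintro ⟨h1, h2⟩
    refine ⟨h1, h2, ?_⟩
    unfold IsPoint at h1 h2
    omega

/-- The direction `(-1, τ)` of the arrows of type `B` in the diamond `n`. -/
def typeSign (n : ℕ) : ℤˣ := if Even n then -1 else 1

theorem typeSign_succ (n : ℕ) : typeSign (n + 1) = -typeSign n := by
  unfold typeSign
  by_cases h : Even n <;> simp [h, Nat.even_add_one]

theorem typeSign_two : typeSign 2 = -1 := by simp [typeSign]

theorem westDir_ne_east (τ : ℤˣ) : westDir τ ≠ Dir.east := by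
  unfold westDir; split_ifs <;> simp

theorem westDir_one : westDir 1 = Dir.nw := by simp [westDir]

theorem westDir_neg_one : westDir (-1) = Dir.sw := by
  have : (-1 : ℤˣ) ≠ 1 := by decide
  simp [westDir, this]

theorem isB_iff {a : RawArrow} : IsB a ↔ a.1 = westDir (typeSign a.2.1) := by
  unfold IsB typeSign
  rcases Nat.even_or_odd a.2.1 with h | h
  · have h' : ¬ Odd a.2.1 := Nat.not_odd_iff_even.2 h
    rw [if_pos h, westDir_neg_one]
    tauto
  · have h' : ¬ Even a.2.1 := Nat.not_even_iff_odd.2 h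
    rw [if_neg h', westDir_one]
    tauto

theorem isC_iff {a : RawArrow} : IsC a ↔ a.1 = westDir (-typeSign a.2.1) ∨
    (a.2.1 = 2 ∧ OnLeftEdge a) := by
  unfold IsC typeSign
  rcases Nat.even_or_odd a.2.1 with h | h
  · have h' : ¬ Odd a.2.1 := Nat.not_odd_iff_even.2 h
    rw [if_pos h, neg_neg, westDir_one]
    tauto
  · have h' : ¬ Even a.2.1 := Nat.not_even_iff_odd.2 h
    rw [if_neg h', westDir_neg_one]
    tauto

/-! ### Arrows and vertices in the Jacobian algebra -/

section Elements

variable (k : Type*) [Field k] (l m : ℕ)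

/-- The trivial path at a representative, or `0`. -/
noncomputable def vtx (v : ℕ × ℤ × ℤ) : JacAlg k l m :=
  if h : v ∈ vertexSet l m then idem k l m ⟨v, h⟩ else 0

/-- An arrow as an element of the Jacobian algebra, or `0`. -/
noncomputable def arw (a : RawArrow) : JacAlg k l m :=
  if h : a ∈ arrowSet l m then
    toJac k (quiver l m) (potential k l m) (arr k (quiver l m) ⟨a, h⟩) else 0

/-- The sum of the arrows with the property `p`, in the Jacobian algebra. -/
noncomputable def jacSum (p : RawArrow → Prop) : JacAlg k l m :=
  toJac k (quiver l m) (potential k l m) (arrSum k l m p)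

theorem vtx_coe (v : Vertex l m) : vtx k l m v.1 = idem k l m v := dif_pos v.2

theorem arw_coe (a : Arrow l m) :
    arw k l m a.1 = toJac k (quiver l m) (potential k l m) (arr k (quiver l m) a) := dif_pos a.2

theorem vtx_mul_arw (v : ℕ × ℤ × ℤ) (a : RawArrow) :
    vtx k l m v * arw k l m a = if rawSrc l a = v then arw k l m a else 0 := by
  unfold arw
  by_cases ha : a ∈ arrowSet l m
  · rw [dif_pos ha]
    unfold vtx
    by_cases hv : v ∈ vertexSet l m
    · have e : (quiver l m).src ⟨a, ha⟩ = ⟨v, hv⟩ ↔ rawSrc l a = v := Subtype.ext_iff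
      rw [dif_pos hv, idem, ← map_mul, idemp_mul_arr]
      by_cases h : rawSrc l a = v
      · rw [if_pos (e.2 h), if_pos h]
      · rw [if_neg (fun h' => h (e.1 h')), if_neg h, map_zero]
    · have : rawSrc l a ≠ v := fun h => hv (h ▸ rawSrc_mem ha)
      simp [hv, this]
  · simp [ha]

theorem arw_mul_vtx (v : ℕ × ℤ × ℤ) (a : RawArrow) :
    arw k l m a * vtx k l m v = if rawTgt l a = v then arw k l m a else 0 := by
  unfold arw
  by_cases ha : a ∈ arrowSet l m
  · rw [dif_pos ha]
    unfold vtx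
    by_cases hv : v ∈ vertexSet l m
    · have e : (quiver l m).tgt ⟨a, ha⟩ = ⟨v, hv⟩ ↔ rawTgt l a = v := Subtype.ext_iff
      rw [dif_pos hv, idem, ← map_mul, arr_mul_idemp']
      by_cases h : rawTgt l a = v
      · rw [if_pos (e.2 h), if_pos h]
      · rw [if_neg (fun h' => h (e.1 h')), if_neg h, map_zero]
    · have : rawTgt l a ≠ v := fun h => hv (h ▸ rawTgt_mem ha)
      simp [hv, this]
  · simp [ha]

theorem vtx_mul_jacSum_eq_sum (p : RawArrow → Prop) (v : ℕ × ℤ × ℤ) (S : Finset RawArrow)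
    (h : ∀ a ∈ arrowSet l m, p a ∧ rawSrc l a = v ↔ a ∈ S) :
    vtx k l m v * jacSum k l m p = ∑ a ∈ S, arw k l m a := by
  classical
  have e : ∑ a ∈ S, arw k l m a = ∑ a ∈ arrowSet l m, if a ∈ S then arw k l m a else 0 := by
    rw [← Finset.sum_filter]
    symm
    apply Finset.sum_subset
    · intro a ha; exact (Finset.mem_filter.1 ha).2
    · intro a ha hn
      have : a ∉ arrowSet l m := fun h' => hn (Finset.mem_filter.2 ⟨h', ha⟩)
      simp [arw, this]
  rw [e, ← Finset.sum_coe_sort, jacSum, arrSum, map_sum, Finset.mul_sum]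
  refine Finset.sum_congr rfl fun a _ => ?_
  by_cases hp : p a.1
  · rw [if_pos hp, ← arw_coe, vtx_mul_arw]
    refine if_congr ?_ rfl rfl
    rw [← h a.1 a.2]; simp [hp]
  · rw [if_neg hp, if_neg]
    · simp
    · rw [← h a.1 a.2]; simp [hp]

theorem jacSum_mul_vtx_eq_sum (p : RawArrow → Prop) (v : ℕ × ℤ × ℤ) (S : Finset RawArrow)
    (h : ∀ a ∈ arrowSet l m, p a ∧ rawTgt l a = v ↔ a ∈ S) :
    jacSum k l m p * vtx k l m v = ∑ a ∈ S, arw k l m a := by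
  classical
  have e : ∑ a ∈ S, arw k l m a = ∑ a ∈ arrowSet l m, if a ∈ S then arw k l m a else 0 := by
    rw [← Finset.sum_filter]
    symm
    apply Finset.sum_subset
    · intro a ha; exact (Finset.mem_filter.1 ha).2
    · intro a ha hn
      have : a ∉ arrowSet l m := fun h' => hn (Finset.mem_filter.2 ⟨h', ha⟩)
      simp [arw, this]
  rw [e, ← Finset.sum_coe_sort, jacSum, arrSum, map_sum, Finset.sum_mul]
  refine Finset.sum_congr rfl fun a _ => ?_
  by_cases hp : p a.1
  · rw [if_pos hp, ← arw_coe, arw_mul_vtx]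
    refine if_congr ?_ rfl rfl
    rw [← h a.1 a.2]; simp [hp]
  · rw [if_neg hp, if_neg]
    · simp
    · rw [← h a.1 a.2]; simp [hp]

/-- The east arrow that starts at `(x, y)` in the diamond `n`, or `0`. -/
noncomputable def eastArw (n : ℕ) (x y : ℤ) : JacAlg k l m := arw k l m (Dir.east, n, x, y)

/-- The raw arrow that represents the step `(-1, τ)` from `(x, y)` in the diamond `n`. -/
def westRaw (l : ℕ) (τ : ℤˣ) (n : ℕ) (x y : ℤ) : RawArrow :=
  if τ * y = -x then
    if n = 2 then (Dir.sw, 2, x, x) else (westDir (-τ), n - 1, l + x, -τ * (l - x))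
  else (westDir τ, n, x, y)

open Classical in
/-- The step `(-1, τ)` from `(x, y)` in the diamond `n`, or `0` if one of its ends is not in
the diamond. -/
noncomputable def westArw (τ : ℤˣ) (n : ℕ) (x y : ℤ) : JacAlg k l m :=
  if IsPoint l m n x y ∧ IsPoint l m n (x - 1) (y + τ) then arw k l m (westRaw l τ n x y) else 0

/-- The sum of the arrows of the type to which the arrows in direction `(-1, τ)` of
the diamond `n` belong. -/
noncomputable def typeSum (n : ℕ) (τ : ℤˣ) : JacAlg k l m :=
  if τ = typeSign n then jacSum k l m IsB else jacSum k l m IsC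

/-- At most one arrow of type `B` starts at a vertex, and the parity of the diamond fixes its
direction. If there is none, both sides are zero by the default value of `arw`. -/
theorem vtx_mul_jacSum_isB (v : ℕ × ℤ × ℤ) :
    vtx k l m v * jacSum k l m IsB = arw k l m (westDir (typeSign v.1), v) := by
  rw [vtx_mul_jacSum_eq_sum k l m IsB v {(westDir (typeSign v.1), v)}, Finset.sum_singleton]
  intro a ha
  rw [isB_iff, Finset.mem_singleton]
  constructor
  · rintro ⟨h1, h2⟩
    have : a.1 ≠ Dir.east := h1 ▸ westDir_ne_east _
    rw [rawSrc_of_ne_east ha this] at h2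
    rw [← h2, ← h1]
  · rintro rfl
    exact ⟨rfl, rawSrc_of_ne_east ha (westDir_ne_east _)⟩

/-- Parity fixes the direction except on the left edge of the diamond `2`. There northwest would
leave the diamond, and the edge arrow, which is also of type `B`, takes its place. -/
theorem vtx_mul_jacSum_isC (v : ℕ × ℤ × ℤ) (hv : v ∈ vertexSet l m) :
    vtx k l m v * jacSum k l m IsC =
      if v.1 = 2 ∧ v.2.1 = v.2.2 then arw k l m (Dir.sw, v)
      else arw k l m (westDir (-typeSign v.1), v) := by
  have key : ∀ a ∈ arrowSet l m, (IsC a ∧ rawSrc l a = v ↔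
      a = if v.1 = 2 ∧ v.2.1 = v.2.2 then (Dir.sw, v) else (westDir (-typeSign v.1), v)) := by
    intro a ha
    obtain ⟨n, x, y⟩ := v
    rw [isC_iff]
    simp only
    by_cases h : n = 2 ∧ x = y
    · rw [if_pos h]
      obtain ⟨rfl, rfl⟩ := h
      constructor
      · rintro ⟨h1, h2⟩
        obtain ⟨d, n', x', y'⟩ := a
        have hd : d ≠ Dir.east := by
          rcases h1 with h1 | h1
          · rintro rfl
            exact westDir_ne_east _ h1.symm
          · rintro rfl
            rcases arrow_cases ha with h | h
            · exact absurd (h.2.2 h1.2).2 (by simp)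
            · exact absurd h.2.2 (by simp)
        rw [rawSrc_of_ne_east ha hd] at h2
        simp only [Prod.mk.injEq] at h2
        obtain ⟨rfl, rfl, rfl⟩ := h2
        cases d
        · exact absurd rfl hd
        · exfalso
          rcases arrow_cases ha with ⟨h1, h2, h3⟩ | h
          · unfold IsPoint at h1 h2
            simp only [Dir.dx, Dir.dy] at h1 h2
            omega
          · simp at h
        · rfl
      · rintro rfl
        refine ⟨Or.inr ⟨rfl, ?_⟩, rawSrc_of_ne_east ha (by simp)⟩
        unfold OnLeftEdge
        simp [Dir.dx, Dir.dy]
    · rw [if_neg h]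
      constructor
      · rintro ⟨h1, h2⟩
        obtain ⟨d, n', x', y'⟩ := a
        have hd : d ≠ Dir.east := by
          rcases h1 with h1 | h1
          · rintro rfl
            exact westDir_ne_east _ h1.symm
          · rintro rfl
            rcases arrow_cases ha with h | h
            · exact absurd (h.2.2 h1.2).2 (by simp)
            · exact absurd h.2.2 (by simp)
        rw [rawSrc_of_ne_east ha hd] at h2
        simp only [Prod.mk.injEq] at h2
        obtain ⟨rfl, rfl, rfl⟩ := h2
        rcases h1 with h1 | ⟨h1, h2⟩
        · rw [← h1]
        · exfalso
          simp only at h1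
          subst h1
          rw [mem_vertexSet] at hv
          unfold OnLeftEdge at h2
          simp only at h2
          omega
      · rintro rfl
        exact ⟨Or.inl rfl, rawSrc_of_ne_east ha (westDir_ne_east _)⟩
  rw [vtx_mul_jacSum_eq_sum k l m IsC v
    {if v.1 = 2 ∧ v.2.1 = v.2.2 then (Dir.sw, v) else (westDir (-typeSign v.1), v)},
    Finset.sum_singleton]
  · split_ifs <;> rfl
  · intro a ha
    rw [Finset.mem_singleton, key a ha]

theorem jacSum_isA_mul_vtx (n : ℕ) (x y : ℤ) :
    jacSum k l m IsA * vtx k l m (n, x, y) = eastArw k l m n (x - 2) y := by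
  rw [jacSum_mul_vtx_eq_sum k l m IsA (n, x, y) {(Dir.east, n, x - 2, y)}, Finset.sum_singleton]
  · rfl
  · intro a ha
    obtain ⟨d, n', x', y'⟩ := a
    unfold IsA
    rw [Finset.mem_singleton]
    constructor
    · rintro ⟨h1, h2⟩
      simp only at h1
      subst h1
      rw [rawTgt_of_east ha] at h2
      simp only [Prod.mk.injEq] at h2 ⊢
      exact ⟨trivial, h2.1, by omega, h2.2.2⟩
    · intro h
      simp only [Prod.mk.injEq] at h
      obtain ⟨rfl, rfl, rfl, rfl⟩ := h
      refine ⟨rfl, ?_⟩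
      rw [rawTgt_of_east ha]
      simp

theorem vtx_rawSrc (a : Arrow l m) : vtx k l m (rawSrc l a.1) =
    toJac k (quiver l m) (potential k l m) (idemp k (quiver l m) ((quiver l m).src a)) :=
  vtx_coe k l m ((quiver l m).src a)

theorem vtx_rawTgt (a : Arrow l m) : vtx k l m (rawTgt l a.1) =
    toJac k (quiver l m) (potential k l m) (idemp k (quiver l m) ((quiver l m).tgt a)) :=
  vtx_coe k l m ((quiver l m).tgt a)

theorem toJac_eq_of_cyclicDeriv_eq (a : Arrow l m) {x y : PathAlg k (quiver l m)}
    (h : cyclicDeriv k (quiver l m) (potential k l m) a = x - y) :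
    toJac k (quiver l m) (potential k l m) x = toJac k (quiver l m) (potential k l m) y := by
  have h0 : toJac k (quiver l m) (potential k l m) (x - y) = 0 := by
    rw [← h, ← map_zero (toJac k (quiver l m) (potential k l m))]
    exact RingQuot.mkAlgHom_rel k ⟨a, rfl, rfl⟩
  have h1 := map_add (toJac k (quiver l m) (potential k l m)) (x - y) y
  rwa [h0, zero_add, sub_add_cancel] at h1

/-- The relation of an arrow that is only of type `A`. -/
theorem relation_of_isA (a : Arrow l m) (hA : IsA a.1) (hB : ¬ IsB a.1) (hC : ¬ IsC a.1) :
    vtx k l m (rawTgt l a.1) * (jacSum k l m IsB * jacSum k l m IsC) * vtx k l m (rawSrc l a.1) =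
      vtx k l m (rawTgt l a.1) * (jacSum k l m IsC * jacSum k l m IsB) *
        vtx k l m (rawSrc l a.1) := by
  have h := cyclicDeriv_potential k l m a
  rw [if_pos hA, if_neg hB, if_neg hC, add_zero, add_zero, mul_sub, sub_mul] at h
  have := toJac_eq_of_cyclicDeriv_eq k l m a h
  simpa only [map_mul, vtx_rawSrc, vtx_rawTgt, jacSum] using this

/-- The relation of an arrow that is only of type `B`. -/
theorem relation_of_isB (a : Arrow l m) (hA : ¬ IsA a.1) (hB : IsB a.1) (hC : ¬ IsC a.1) :
    vtx k l m (rawTgt l a.1) * (jacSum k l m IsC * jacSum k l m IsA) * vtx k l m (rawSrc l a.1) =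
      vtx k l m (rawTgt l a.1) * (jacSum k l m IsA * jacSum k l m IsC) *
        vtx k l m (rawSrc l a.1) := by
  have h := cyclicDeriv_potential k l m a
  rw [if_neg hA, if_pos hB, if_neg hC, add_zero, zero_add, mul_sub, sub_mul] at h
  have := toJac_eq_of_cyclicDeriv_eq k l m a h
  simpa only [map_mul, vtx_rawSrc, vtx_rawTgt, jacSum] using this

/-- The relation of an arrow that is only of type `C`. -/
theorem relation_of_isC (a : Arrow l m) (hA : ¬ IsA a.1) (hB : ¬ IsB a.1) (hC : IsC a.1) :
    vtx k l m (rawTgt l a.1) * (jacSum k l m IsA * jacSum k l m IsB) * vtx k l m (rawSrc l a.1) =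
      vtx k l m (rawTgt l a.1) * (jacSum k l m IsB * jacSum k l m IsA) *
        vtx k l m (rawSrc l a.1) := by
  have h := cyclicDeriv_potential k l m a
  rw [if_neg hA, if_neg hB, if_pos hC, zero_add, zero_add, mul_sub, sub_mul] at h
  have := toJac_eq_of_cyclicDeriv_eq k l m a h
  simpa only [map_mul, vtx_rawSrc, vtx_rawTgt, jacSum] using this

/-- The relation of an arrow of both types `B` and `C`. -/
theorem relation_of_isB_isC (a : Arrow l m) (hA : ¬ IsA a.1) (hB : IsB a.1) (hC : IsC a.1) :
    vtx k l m (rawTgt l a.1) * (jacSum k l m IsA * jacSum k l m IsB) * vtx k l m (rawSrc l a.1) +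
        vtx k l m (rawTgt l a.1) * (jacSum k l m IsC * jacSum k l m IsA) *
          vtx k l m (rawSrc l a.1) =
      vtx k l m (rawTgt l a.1) * (jacSum k l m IsA * jacSum k l m IsC) *
          vtx k l m (rawSrc l a.1) +
        vtx k l m (rawTgt l a.1) * (jacSum k l m IsB * jacSum k l m IsA) *
          vtx k l m (rawSrc l a.1) := by
  have h := cyclicDeriv_potential k l m a
  rw [if_neg hA, if_pos hB, if_pos hC, zero_add, mul_add, add_mul, mul_sub, sub_mul, mul_sub,
    sub_mul, sub_add_sub_comm, add_comm, add_comm (idemp k (quiver l m) ((quiver l m).tgt a) *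
      (arrSum k l m IsA * arrSum k l m IsC) * idemp k (quiver l m) ((quiver l m).src a))] at h
  have := (toJac_eq_of_cyclicDeriv_eq k l m a h).trans
    (congrArg (toJac k (quiver l m) (potential k l m)) (add_comm _ _))
  simpa only [map_mul, map_add, vtx_rawSrc, vtx_rawTgt, jacSum] using this

end Elements

end Diamond

namespace Diamond

open FQuiver

/-! ### The relations of the Jacobian algebra -/

theorem glue_of_lt {l n : ℕ} {x y : ℤ} (h1 : -x < y) (h2 : y < x) : glue l n x y = (n, x, y) :=
  if_pos ⟨h1, h2⟩

theorem glue_two_edge {l : ℕ} {x : ℤ} (σ : ℤˣ) : glue l 2 x (σ * x) = (2, x, x) := by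
  unfold glue
  rcases Int.units_eq_one_or σ with rfl | rfl <;> simp

theorem glue_edge {l n : ℕ} {x : ℤ} (hn : 3 ≤ n) (hx : 0 < x) (σ : ℤˣ) :
    glue l n x (σ * x) = (n - 1, (l : ℤ) + x, σ * ((l : ℤ) - x)) := by
  have h2 : n ≠ 2 := by omega
  unfold glue
  rcases Int.units_eq_one_or σ with rfl | rfl
  · simp [h2, hx]
  · have : ¬ (x < 0) := by omega
    simp [h2, this]

theorem units_mul_self_mul (σ : ℤˣ) (x : ℤ) : (σ : ℤ) * (σ * x) = x := by
  rcases Int.units_eq_one_or σ with rfl | rfl <;> simp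

section West

variable {l m : ℕ} {τ : ℤˣ} {n : ℕ} {x y : ℤ}

theorem rawSrc_westRaw (h : IsPoint l m n x y) (h' : IsPoint l m n (x - 1) (y + τ)) :
    rawSrc l (westRaw l τ n x y) = glue l n x y := by
  unfold westRaw
  by_cases e : τ * y = -x
  · rw [if_pos e]
    obtain rfl : y = (-τ : ℤˣ) * x := by
      rcases Int.units_eq_one_or τ with rfl | rfl <;> simp at e ⊢ <;> omega
    split_ifs with hn
    · subst hn
      rw [glue_two_edge]
      simp [rawSrc, glue]
    · rw [glue_edge (by have := h.1; omega) h.2.2.2.2.2.1]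
      refine (glue_of_lt ?_ ?_).trans ?_
      all_goals
        unfold IsPoint at h h'
        rcases Int.units_eq_one_or τ with rfl | rfl <;> simp at h h' ⊢ <;> omega
  · rw [if_neg e]; rfl

theorem rawTgt_westRaw (h : IsPoint l m n x y) (h' : IsPoint l m n (x - 1) (y + τ)) :
    rawTgt l (westRaw l τ n x y) = glue l n (x - 1) (y + τ) := by
  unfold westRaw
  by_cases e : τ * y = -x
  · rw [if_pos e]
    obtain rfl : y = (-τ : ℤˣ) * x := by
      rcases Int.units_eq_one_or τ with rfl | rfl <;> simp at e ⊢ <;> omega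
    have e2 : ((-τ : ℤˣ) : ℤ) * x + τ = (-τ : ℤˣ) * (x - 1) := by push_cast; ring
    rw [e2] at h' ⊢
    split_ifs with hn
    · subst hn
      rw [glue_two_edge]
      simp [rawTgt, glue, Dir.dx, Dir.dy, sub_eq_add_neg]
    · rw [glue_edge (by have := h.1; omega) h'.2.2.2.2.2.1]
      unfold rawTgt
      simp only [westDir_dx, westDir_dy]
      refine (glue_of_lt ?_ ?_).trans ?_
      all_goals
        unfold IsPoint at h h'
        rcases Int.units_eq_one_or τ with rfl | rfl <;> simp at h h' ⊢ <;> omega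
  · rw [if_neg e]
    unfold rawTgt
    simp only [westDir_dx, westDir_dy]
    rfl

theorem westRaw_mem (h : IsPoint l m n x y) (h' : IsPoint l m n (x - 1) (y + τ)) :
    westRaw l τ n x y ∈ arrowSet l m := by
  rw [mem_arrowSet]
  left
  unfold westRaw
  by_cases e : τ * y = -x
  · rw [if_pos e]
    obtain rfl : y = (-τ : ℤˣ) * x := by
      rcases Int.units_eq_one_or τ with rfl | rfl <;> simp at e ⊢ <;> omega
    unfold IsPoint at h h'
    split_ifs with hn
    · subst hn
      unfold IsPoint
      refine ⟨?_, ?_, fun _ => ⟨rfl, rfl⟩⟩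
      all_goals
        simp only [Dir.dx, Dir.dy]
        rcases Int.units_eq_one_or τ with rfl | rfl <;> simp at h h' ⊢ <;> omega
    · unfold IsPoint OnLeftEdge
      simp only [westDir_dx, westDir_dy]
      refine ⟨?_, ?_, ?_⟩
      all_goals
        rcases Int.units_eq_one_or τ with rfl | rfl <;> simp at h h' ⊢ <;> omega
  · rw [if_neg e]
    simp only [westDir_dx, westDir_dy]
    refine ⟨h, h', ?_⟩
    unfold IsPoint at h h'
    unfold OnLeftEdge
    simp only [westDir_dx, westDir_dy]
    rcases Int.units_eq_one_or τ with rfl | rfl <;> simp at e h h' ⊢ <;> omega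

theorem not_isA_westRaw : ¬ IsA (westRaw l τ n x y) := by
  unfold IsA westRaw
  split_ifs
  · simp
  · exact westDir_ne_east _
  · exact westDir_ne_east _

theorem westDir_inj {σ τ : ℤˣ} : westDir σ = westDir τ ↔ σ = τ := by
  rcases Int.units_eq_one_or σ with rfl | rfl <;> rcases Int.units_eq_one_or τ with rfl | rfl <;>
    simp [westDir_one, westDir_neg_one]

/-- Crossing the gluing reverses the vertical direction and changes the parity of the diamond. The
two sign changes cancel, so the type can be read in either diamond. -/
theorem isB_westRaw (h : IsPoint l m n x y) (hn : ¬ (n = 2 ∧ τ * y = -x)) :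
    IsB (westRaw l τ n x y) ↔ τ = typeSign n := by
  rw [isB_iff]
  unfold westRaw
  split_ifs with e e2
  · exact absurd ⟨e2, e⟩ hn
  · simp only
    obtain ⟨r, rfl⟩ : ∃ r, n = r + 1 := ⟨n - 1, by have := h.1; omega⟩
    rw [Nat.add_sub_cancel, typeSign_succ, westDir_inj, neg_eq_iff_eq_neg]
  · rw [westDir_inj]

theorem isC_westRaw (h : IsPoint l m n x y) (h' : IsPoint l m n (x - 1) (y + τ))
    (hn : ¬ (n = 2 ∧ τ * y = -x)) :
    IsC (westRaw l τ n x y) ↔ τ = -typeSign n := by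
  rw [isC_iff]
  have e : ¬ ((westRaw l τ n x y).2.1 = 2 ∧ OnLeftEdge (westRaw l τ n x y)) := by
    rintro ⟨h1, h2⟩
    unfold westRaw at h1 h2
    unfold IsPoint at h h'
    unfold OnLeftEdge at h2
    split_ifs at h1 h2 with e e2
    · exact absurd ⟨e2, e⟩ hn
    · simp only [westDir_dx, westDir_dy] at h1 h2
      rcases Int.units_eq_one_or τ with rfl | rfl <;> simp at e h h' h1 h2 <;> omega
    · simp only [westDir_dx, westDir_dy] at h1 h2
      rcases Int.units_eq_one_or τ with rfl | rfl <;> simp at e h h' h1 h2 <;> omega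
  rw [or_iff_left e]
  unfold westRaw
  split_ifs with e e2
  · exact absurd ⟨e2, e⟩ hn
  · simp only
    obtain ⟨r, rfl⟩ : ∃ r, n = r + 1 := ⟨n - 1, by have := h.1; omega⟩
    rw [Nat.add_sub_cancel, typeSign_succ, westDir_inj, neg_inj, neg_neg]
  · rw [westDir_inj]

theorem westRaw_two_edge (h : τ * y = -x) : westRaw l τ 2 x y = (Dir.sw, 2, x, x) := by
  unfold westRaw; simp [h]

end West

section Relations

variable (k : Type*) [Field k] (l m : ℕ)

theorem westArw_of_isPoint {τ : ℤˣ} {n : ℕ} {x y : ℤ} (h : IsPoint l m n x y)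
    (h' : IsPoint l m n (x - 1) (y + τ)) :
    westArw k l m τ n x y = arw k l m (westRaw l τ n x y) := if_pos ⟨h, h'⟩

theorem westArw_of_not_src {τ : ℤˣ} {n : ℕ} {x y : ℤ} (h : ¬ IsPoint l m n x y) :
    westArw k l m τ n x y = 0 := if_neg fun h' => h h'.1

theorem westArw_of_not_tgt {τ : ℤˣ} {n : ℕ} {x y : ℤ} (h : ¬ IsPoint l m n (x - 1) (y + τ)) :
    westArw k l m τ n x y = 0 := if_neg fun h' => h h'.2

theorem eastArw_of_not_src {n : ℕ} {x y : ℤ} (h : ¬ IsPoint l m n x y) :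
    eastArw k l m n x y = 0 := dif_neg fun h' => h (east_mem_arrowSet.1 h').1

theorem eastArw_of_not_tgt {n : ℕ} {x y : ℤ} (h : ¬ IsPoint l m n (x + 2) y) :
    eastArw k l m n x y = 0 := dif_neg fun h' => h (east_mem_arrowSet.1 h').2

open Classical in
theorem vtx_mul_westArw (v : ℕ × ℤ × ℤ) (τ : ℤˣ) (n : ℕ) (x y : ℤ) :
    vtx k l m v * westArw k l m τ n x y =
      if glue l n x y = v then westArw k l m τ n x y else 0 := by
  by_cases h : IsPoint l m n x y ∧ IsPoint l m n (x - 1) (y + τ)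
  · rw [westArw_of_isPoint k l m h.1 h.2, vtx_mul_arw, rawSrc_westRaw h.1 h.2]
  · simp [westArw, h]

open Classical in
theorem westArw_mul_vtx (v : ℕ × ℤ × ℤ) (τ : ℤˣ) (n : ℕ) (x y : ℤ) :
    westArw k l m τ n x y * vtx k l m v =
      if glue l n (x - 1) (y + τ) = v then westArw k l m τ n x y else 0 := by
  by_cases h : IsPoint l m n x y ∧ IsPoint l m n (x - 1) (y + τ)
  · rw [westArw_of_isPoint k l m h.1 h.2, arw_mul_vtx, rawTgt_westRaw h.1 h.2]
  · simp [westArw, h]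

theorem westArw_mul_vtx_glue (τ : ℤˣ) (n : ℕ) (x y : ℤ) :
    westArw k l m τ n x y * vtx k l m (glue l n (x - 1) (y + τ)) = westArw k l m τ n x y := by
  rw [westArw_mul_vtx, if_pos rfl]

theorem vtx_mul_eastArw (v : ℕ × ℤ × ℤ) (n : ℕ) (x y : ℤ) :
    vtx k l m v * eastArw k l m n x y =
      if glue l n x y = v then eastArw k l m n x y else 0 := vtx_mul_arw k l m v _

theorem eastArw_mul_vtx (v : ℕ × ℤ × ℤ) (n : ℕ) (x y : ℤ) :
    eastArw k l m n x y * vtx k l m v =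
      if (n, x + 2, y) = v then eastArw k l m n x y else 0 := by
  by_cases h : (Dir.east, n, x, y) ∈ arrowSet l m
  · rw [eastArw, arw_mul_vtx, rawTgt_of_east h]
  · simp [eastArw, arw, h]

/-- The sign `τ` selects the left edge on which the glued arrow is read. The bound `x < l` excludes
the arrow out of the frozen vertex `1`. -/
theorem arw_sw_two (τ : ℤˣ) (x : ℤ) (hx : x < l) :
    arw k l m (Dir.sw, 2, x, x) = westArw k l m τ 2 x (-τ * x) := by
  by_cases h : IsPoint l m 2 x (-τ * x) ∧ IsPoint l m 2 (x - 1) (-τ * x + τ)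
  · rw [westArw_of_isPoint k l m h.1 h.2, westRaw_two_edge]
    rw [neg_mul, mul_neg, units_mul_self_mul]
  · rw [westArw, if_neg h, arw, dif_neg]
    rw [mem_arrowSet]
    rintro (⟨h1, h2, -⟩ | h1)
    · apply h
      unfold IsPoint at *
      simp only [Dir.dx, Dir.dy] at h1 h2
      rcases Int.units_eq_one_or τ with rfl | rfl <;> simp <;> omega
    · simp only [Prod.mk.injEq] at h1
      omega

/-- The arrows of the type of the direction `(-1, τ)` out of a point of the diamond `n`. -/
theorem vtx_glue_mul_typeSum {τ : ℤˣ} {n : ℕ} {x y : ℤ} (h : IsPoint l m n x y)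
    (hxy : x ≠ τ * y) :
    vtx k l m (glue l n x y) * typeSum k l m n τ = westArw k l m τ n x y := by
  have hB := vtx_mul_jacSum_isB k l m (glue l n x y)
  have hC := vtx_mul_jacSum_isC k l m (glue l n x y) (glue_mem h)
  have hτ : τ = typeSign n ∨ τ = -typeSign n := by
    rcases Int.units_eq_one_or τ with rfl | rfl <;>
      rcases Int.units_eq_one_or (typeSign n) with h | h <;> rw [h] <;> simp
  have hne : -typeSign n ≠ typeSign n := by
    rcases Int.units_eq_one_or (typeSign n) with h | h <;> rw [h] <;> decide
  by_cases h1 : -x < y ∧ y < x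
  · rw [glue_of_lt h1.1 h1.2] at hB hC ⊢
    have e : ∀ σ : ℤˣ, arw k l m (westDir σ, n, x, y) = westArw k l m σ n x y := by
      intro σ
      have e0 : ¬ (σ * y = -x) := by
        rcases Int.units_eq_one_or σ with rfl | rfl <;> simp <;> omega
      by_cases h' : IsPoint l m n (x - 1) (y + σ)
      · rw [westArw_of_isPoint k l m h h', westRaw, if_neg e0]
      · rw [westArw_of_not_tgt k l m h', arw, dif_neg]
        intro h2
        rcases arrow_cases h2 with ⟨-, h2, -⟩ | ⟨-, -, h2⟩
        · simp only [westDir_dx, westDir_dy] at h2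
          exact h' h2
        · simp only [Prod.mk.injEq] at h2
          omega
    unfold typeSum
    rcases hτ with rfl | rfl
    · rw [if_pos rfl, hB, e]
    · rw [if_neg hne, hC, if_neg, e]
      simp only
      omega
  -- A left edge point with `x ≠ τ y` lies on the edge along which the step `(-1, τ)` runs. On the
  -- other edge this step would leave the diamond.
  · obtain rfl : y = (-τ : ℤˣ) * x := by
      unfold IsPoint at h
      rcases Int.units_eq_one_or τ with rfl | rfl <;> simp at hxy ⊢ <;> omega
    by_cases hn : n = 2
    · subst hn
      rw [glue_two_edge] at hB hC ⊢
      rw [typeSign_two] at hB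
      rw [westDir_neg_one] at hB
      have hl : x < l := by
        unfold IsPoint at h
        rcases Int.units_eq_one_or τ with rfl | rfl <;> simp at h <;> omega
      rw [if_pos ⟨rfl, rfl⟩] at hC
      have := arw_sw_two k l m τ x hl
      rw [Units.val_neg]
      unfold typeSum
      split_ifs
      · rw [hB, this]
      · rw [hC, this]
    · obtain ⟨r, rfl⟩ : ∃ r, n = r + 1 := ⟨n - 1, by have := h.1; omega⟩
      have hx : 0 < x := h.2.2.2.2.2.1
      have hr : 3 ≤ r + 1 := by have := h.1; omega
      rw [glue_edge hr hx] at hB hC ⊢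
      rw [Nat.add_sub_cancel] at hB hC ⊢
      simp only at hB hC
      have hl : x < l := by
        unfold IsPoint at h
        rcases Int.units_eq_one_or τ with rfl | rfl <;> simp at h <;> omega
      have e : arw k l m (westDir (-τ), r, (l : ℤ) + x, (-τ : ℤˣ) * ((l : ℤ) - x)) =
          westArw k l m τ (r + 1) x ((-τ : ℤˣ) * x) := by
        by_cases h' : IsPoint l m (r + 1) (x - 1) ((-τ : ℤˣ) * x + τ)
        · rw [westArw_of_isPoint k l m h h', westRaw, if_pos, if_neg hn, Nat.add_sub_cancel]
          · push_cast; rfl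
          · rw [Units.val_neg, neg_mul, mul_neg, units_mul_self_mul]
        · rw [westArw_of_not_tgt k l m h', arw, dif_neg]
          intro h2
          apply h'
          rcases arrow_cases h2 with ⟨-, h2, -⟩ | ⟨-, -, h2⟩
          · simp only [westDir_dx, westDir_dy] at h2
            unfold IsPoint at *
            rcases Int.units_eq_one_or τ with rfl | rfl <;> simp at h h2 ⊢ <;> omega
          · simp only [Prod.mk.injEq] at h2
            omega
      have hnl : ¬ (r = 2 ∧ (l : ℤ) + x = (-τ : ℤˣ) * ((l : ℤ) - x)) := by
        rcases Int.units_eq_one_or τ with rfl | rfl <;> simp <;> omega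
      rw [if_neg hnl] at hC
      unfold typeSum
      rw [typeSign_succ] at *
      rw [neg_neg] at *
      rcases hτ with rfl | rfl
      · rw [if_pos rfl, hB, ← e, neg_neg]
      · rw [if_neg hne, hC, ← e]

end Relations

end Diamond

namespace Diamond

open FQuiver

section Relations

variable (k : Type*) [Field k] (l m : ℕ)

theorem typeSum_eq_or (n : ℕ) (τ : ℤˣ) :
    (τ = typeSign n ∧ typeSum k l m n τ = jacSum k l m IsB ∧
      typeSum k l m n (-τ) = jacSum k l m IsC) ∨
    (τ = -typeSign n ∧ typeSum k l m n τ = jacSum k l m IsC ∧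
      typeSum k l m n (-τ) = jacSum k l m IsB) := by
  have hτ : τ = typeSign n ∨ τ = -typeSign n := by
    rcases Int.units_eq_one_or τ with rfl | rfl <;>
      rcases Int.units_eq_one_or (typeSign n) with h | h <;> rw [h] <;> simp
  have hne : -typeSign n ≠ typeSign n := by
    rcases Int.units_eq_one_or (typeSign n) with h | h <;> rw [h] <;> decide
  unfold typeSum
  rcases hτ with rfl | rfl
  · left; exact ⟨rfl, if_pos rfl, if_neg hne⟩
  · right; exact ⟨rfl, if_neg hne, by rw [neg_neg, if_pos rfl]⟩

theorem typeSum_succ (n : ℕ) (τ : ℤˣ) : typeSum k l m (n + 1) τ = typeSum k l m n (-τ) := by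
  unfold typeSum
  simp only [typeSign_succ, neg_eq_iff_eq_neg]

/-- The relation of an east arrow. -/
theorem east_relation {n : ℕ} {x y : ℤ} (h : IsPoint l m n x y) (h' : IsPoint l m n (x + 2) y)
    (τ : ℤˣ) :
    vtx k l m (glue l n (x + 2) y) * (typeSum k l m n (-τ) * typeSum k l m n τ) *
        vtx k l m (glue l n x y) =
      vtx k l m (glue l n (x + 2) y) * (typeSum k l m n τ * typeSum k l m n (-τ)) *
        vtx k l m (glue l n x y) := by
  have hm : (Dir.east, n, x, y) ∈ arrowSet l m := east_mem_arrowSet.2 ⟨h, h'⟩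
  have hA : IsA (Dir.east, n, x, y) := rfl
  have hB : ¬ IsB (Dir.east, n, x, y) := by unfold IsB; simp
  have hC : ¬ IsC (Dir.east, n, x, y) := by
    unfold IsC OnLeftEdge
    unfold IsPoint at h h'
    simp [Dir.dx, Dir.dy]
    omega
  have hrel := relation_of_isA k l m ⟨_, hm⟩ hA hB hC
  have e1 : rawSrc l (Dir.east, n, x, y) = glue l n x y := rfl
  have e2 : rawTgt l (Dir.east, n, x, y) = glue l n (x + 2) y := by
    simp [rawTgt, Dir.dx, Dir.dy]
  rw [e1, e2] at hrel
  rcases typeSum_eq_or k l m n τ with ⟨-, h1, h2⟩ | ⟨-, h1, h2⟩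
  · rw [h1, h2]; exact hrel.symm
  · rw [h1, h2]; exact hrel

/-- The relation of an arrow in direction `(-1, τ)`. -/
theorem west_relation {τ : ℤˣ} {n : ℕ} {x y : ℤ} (h : IsPoint l m n x y)
    (h' : IsPoint l m n (x - 1) (y + τ)) (hn : ¬ (n = 2 ∧ τ * y = -x)) :
    vtx k l m (glue l n (x - 1) (y + τ)) * (typeSum k l m n (-τ) * jacSum k l m IsA) *
        vtx k l m (glue l n x y) =
      vtx k l m (glue l n (x - 1) (y + τ)) * (jacSum k l m IsA * typeSum k l m n (-τ)) *
        vtx k l m (glue l n x y) := by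
  have hm := westRaw_mem h h'
  have hA : ¬ IsA (westRaw l τ n x y) := not_isA_westRaw
  have hne : -typeSign n ≠ typeSign n := by
    rcases Int.units_eq_one_or (typeSign n) with h | h <;> rw [h] <;> decide
  rcases typeSum_eq_or k l m n τ with ⟨hτ, h1, h2⟩ | ⟨hτ, h1, h2⟩
  · have hτ' : τ ≠ -typeSign n := by rw [hτ]; exact hne.symm
    have hrel := relation_of_isB k l m ⟨_, hm⟩ hA ((isB_westRaw h hn).2 hτ)
      (mt (isC_westRaw h h' hn).1 hτ')
    simp only [rawSrc_westRaw h h', rawTgt_westRaw h h'] at hrel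
    rw [h2]; exact hrel
  · have hτ' : τ ≠ typeSign n := by rw [hτ]; exact hne
    have hrel := relation_of_isC k l m ⟨_, hm⟩ hA (mt (isB_westRaw h hn).1 hτ')
      ((isC_westRaw h h' hn).2 hτ)
    simp only [rawSrc_westRaw h h', rawTgt_westRaw h h'] at hrel
    rw [h2]; exact hrel.symm

/-- The relation of an arrow on the left edge of the diamond `2`. -/
theorem edge_relation {x : ℤ} (hm : 2 ≤ m) (hx : 1 ≤ x) (hxl : x + 1 < l) :
    vtx k l m (2, x, x) * (jacSum k l m IsA * jacSum k l m IsB) * vtx k l m (2, x + 1, x + 1) +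
      vtx k l m (2, x, x) * (jacSum k l m IsC * jacSum k l m IsA) * vtx k l m (2, x + 1, x + 1) =
    vtx k l m (2, x, x) * (jacSum k l m IsA * jacSum k l m IsC) * vtx k l m (2, x + 1, x + 1) +
      vtx k l m (2, x, x) * (jacSum k l m IsB * jacSum k l m IsA) * vtx k l m (2, x + 1, x + 1) := by
  have hm : (Dir.sw, 2, x + 1, x + 1) ∈ arrowSet l m := by
    rw [mem_arrowSet]
    left
    unfold IsPoint
    simp only [Dir.dx, Dir.dy]
    refine ⟨?_, ?_, fun _ => by simp⟩ <;> omega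
  have hA : ¬ IsA (Dir.sw, 2, x + 1, x + 1) := by unfold IsA; simp
  have hB : IsB (Dir.sw, 2, x + 1, x + 1) := Or.inl ⟨even_two, rfl⟩
  have hC : IsC (Dir.sw, 2, x + 1, x + 1) := by
    refine Or.inr (Or.inr ⟨rfl, ?_⟩)
    unfold OnLeftEdge
    simp [Dir.dx, Dir.dy]
  have hrel := relation_of_isB_isC k l m ⟨_, hm⟩ hA hB hC
  have e1 : rawSrc l (Dir.sw, 2, x + 1, x + 1) = (2, x + 1, x + 1) := by
    simp [rawSrc, glue]
  have e2 : rawTgt l (Dir.sw, 2, x + 1, x + 1) = (2, x, x) := by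
    simp [rawTgt, glue, Dir.dx, Dir.dy]
  rwa [e1, e2] at hrel

/-- After a given step the sum over a type reduces to the one next step of this type. The hypothesis
prevents that step from leaving the diamond through a left edge. -/
theorem westArw_mul_typeSum {τ σ : ℤˣ} {n : ℕ} {x y : ℤ} (h : x - 1 ≠ σ * (y + τ)) :
    westArw k l m τ n x y * typeSum k l m n σ =
      westArw k l m τ n x y * westArw k l m σ n (x - 1) (y + τ) := by
  by_cases h' : IsPoint l m n (x - 1) (y + τ)
  · rw [← vtx_glue_mul_typeSum k l m h' h, ← mul_assoc, westArw_mul_vtx_glue]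
  · rw [westArw_of_not_tgt k l m h', zero_mul, zero_mul]

theorem eastArw_mul_typeSum (σ : ℤˣ) (n : ℕ) (x y : ℤ) :
    eastArw k l m n x y * typeSum k l m n σ =
      eastArw k l m n x y * westArw k l m σ n (x + 2) y := by
  by_cases h : IsPoint l m n x y
  · by_cases h' : IsPoint l m n (x + 2) y
    · have e : glue l n (x + 2) y = (n, x + 2, y) :=
        glue_of_lt (by unfold IsPoint at h; omega) (by unfold IsPoint at h; omega)
      rw [← vtx_glue_mul_typeSum k l m h', e, ← mul_assoc, eastArw_mul_vtx, if_pos rfl]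
      unfold IsPoint at h
      rcases Int.units_eq_one_or σ with rfl | rfl <;> simp <;> omega
    · rw [eastArw_of_not_tgt k l m h', zero_mul, zero_mul]
  · rw [eastArw_of_not_src k l m h, zero_mul, zero_mul]

/-- The relation of an east arrow, at the point `(x, y)` in which it ends. -/
theorem westArw_mul_westArw (τ : ℤˣ) (n : ℕ) (x y : ℤ) :
    westArw k l m (-τ) n x y * westArw k l m τ n (x - 1) (y - τ) =
      westArw k l m τ n x y * westArw k l m (-τ) n (x - 1) (y + τ) := by
  by_cases hp : IsPoint l m n x y
  swap
  · rw [westArw_of_not_src k l m hp, westArw_of_not_src k l m hp, zero_mul, zero_mul]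
  -- Without the point `(x - 2, y)` there is no east arrow and hence no relation, but then both
  -- second factors are zero by convention.
  by_cases hq : IsPoint l m n (x - 2) y
  swap
  · have e1 : ¬ IsPoint l m n (x - 1 - 1) (y - τ + τ) := by
      rwa [sub_add_cancel, sub_sub]
    have e2 : ¬ IsPoint l m n (x - 1 - 1) (y + τ + (-τ : ℤˣ)) := by
      rwa [Units.val_neg, add_neg_cancel_right, sub_sub]
    rw [westArw_of_not_tgt k l m e1, westArw_of_not_tgt k l m e2, mul_zero, mul_zero]
  have key : ∀ σ : ℤˣ, vtx k l m (glue l n x y) * (typeSum k l m n (-σ) * typeSum k l m n σ) *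
      vtx k l m (glue l n (x - 2) y) =
      westArw k l m (-σ) n x y * westArw k l m σ n (x - 1) (y - σ) := by
    intro σ
    have h1 : x ≠ ((-σ : ℤˣ) : ℤ) * y := by
      unfold IsPoint at hp hq
      rcases Int.units_eq_one_or σ with rfl | rfl <;> simp <;> omega
    have h2 : x - 1 ≠ σ * (y + (-σ : ℤˣ)) := by
      unfold IsPoint at hp hq
      rcases Int.units_eq_one_or σ with rfl | rfl <;> simp <;> omega
    rw [← mul_assoc, vtx_glue_mul_typeSum k l m hp h1, westArw_mul_typeSum k l m h2, mul_assoc,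
      Units.val_neg, ← sub_eq_add_neg, westArw_mul_vtx, if_pos]
    rw [sub_add_cancel, sub_sub]; norm_num
  have hE := east_relation k l m (x := x - 2) hq (by rwa [sub_add_cancel]) τ
  rw [sub_add_cancel, key] at hE
  rw [hE]
  have := key (-τ)
  rw [neg_neg] at this
  rw [this, Units.val_neg, sub_neg_eq_add]

/-- The east arrows out of a point that is neither on a right edge nor on the left edge of
the diamond `2`. -/
theorem vtx_mul_isA {n : ℕ} {x y : ℤ} (h : IsPoint l m n x y) (h1 : x + y ≠ 2 * l)
    (h2 : x - y ≠ 2 * l) (h3 : n = 2 → x ≠ y ∧ x ≠ -y) :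
    vtx k l m (glue l n x y) * jacSum k l m IsA = eastArw k l m n x y := by
  rw [vtx_mul_jacSum_eq_sum k l m IsA _ {(Dir.east, n, x, y)}, Finset.sum_singleton]
  · rfl
  · intro a ha
    rw [Finset.mem_singleton]
    obtain ⟨d, n', x', y'⟩ := a
    unfold IsA
    constructor
    · rintro ⟨rfl, e⟩
      obtain ⟨p1, p2⟩ := east_mem_arrowSet.1 ha
      simp only [rawSrc] at e
      rcases glue_cases p1 with g | g | g | g <;> rcases glue_cases h with g' | g' | g' | g' <;>
        rw [g.2.2, g'.2.2] at e <;> simp only [Prod.mk.injEq, true_and] at e ⊢ <;>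
        unfold IsPoint at h p1 p2 <;> omega
    · intro e
      simp only [Prod.mk.injEq] at e
      obtain ⟨rfl, rfl, rfl, rfl⟩ := e
      exact ⟨rfl, rfl⟩

/-- The east arrows out of a point of a right edge. -/
theorem vtx_right_mul_isA {n : ℕ} {x : ℤ} {σ : ℤˣ} (h : IsPoint l m n x (σ * (2 * l - x)))
    (hx : x < 2 * l) :
    vtx k l m (n, x, σ * (2 * l - x)) * jacSum k l m IsA =
      eastArw k l m (n + 1) (x - l) (σ * (x - l)) := by
  rw [vtx_mul_jacSum_eq_sum k l m IsA _ {(Dir.east, n + 1, x - l, σ * (x - l))},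
    Finset.sum_singleton]
  · rfl
  · intro a ha
    rw [Finset.mem_singleton]
    obtain ⟨d, n', x', y'⟩ := a
    unfold IsA
    constructor
    · rintro ⟨rfl, e⟩
      obtain ⟨p1, p2⟩ := east_mem_arrowSet.1 ha
      simp only [rawSrc] at e
      rcases Int.units_eq_one_or σ with rfl | rfl <;> simp only [Units.val_one, Units.val_neg, 
        one_mul, neg_mul] at * <;>
      rcases glue_cases p1 with g | g | g | g <;> 
        rw [g.2.2] at e <;> simp only [Prod.mk.injEq, true_and] at e ⊢ <;>
        unfold IsPoint at h p1 p2 <;> omega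
    · intro e
      simp only [Prod.mk.injEq] at e
      obtain ⟨rfl, rfl, rfl, rfl⟩ := e
      obtain ⟨p1, p2⟩ := east_mem_arrowSet.1 ha
      refine ⟨rfl, ?_⟩
      simp only [rawSrc]
      rw [glue_edge (by have := h.1; omega) p1.2.2.2.2.2.1]
      simp only [Nat.add_sub_cancel, Prod.mk.injEq, true_and]
      refine ⟨by ring, by ring⟩

/-- The east arrows out of a point of the left edge of the diamond `2`. -/
theorem vtx_left_mul_isA {x : ℤ} (hx : 0 < x) (σ : ℤˣ) :
    vtx k l m (2, x, x) * jacSum k l m IsA =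
      eastArw k l m 2 x (σ * x) + eastArw k l m 2 x (-σ * x) := by
  have hne : ((Dir.east, 2, x, σ * x) : RawArrow) ≠ (Dir.east, 2, x, -σ * x) := by
    simp only [ne_eq, Prod.mk.injEq, true_and]
    rcases Int.units_eq_one_or σ with rfl | rfl <;> simp <;> omega
  rw [vtx_mul_jacSum_eq_sum k l m IsA _ {(Dir.east, 2, x, σ * x), (Dir.east, 2, x, -σ * x)},
    Finset.sum_pair hne]
  · rfl
  · intro a ha
    rw [Finset.mem_insert, Finset.mem_singleton]
    obtain ⟨d, n', x', y'⟩ := a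
    unfold IsA
    constructor
    · rintro ⟨rfl, e⟩
      obtain ⟨p1, p2⟩ := east_mem_arrowSet.1 ha
      simp only [rawSrc] at e
      rcases Int.units_eq_one_or σ with rfl | rfl <;> simp only [Units.val_one, Units.val_neg, 
        one_mul, neg_mul, neg_neg] at * <;>
      rcases glue_cases p1 with g | g | g | g <;> 
        rw [g.2.2] at e <;> simp only [Prod.mk.injEq, true_and] at e ⊢ <;>
        unfold IsPoint at p1 p2 <;> omega
    · rintro (e | e) <;> simp only [Prod.mk.injEq] at e <;>
        obtain ⟨rfl, rfl, rfl, rfl⟩ := e <;> refine ⟨rfl, ?_⟩ <;> simp only [rawSrc]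
      · exact glue_two_edge σ
      · rw [← Units.val_neg]
        exact glue_two_edge (-σ)

/-- The relation of an arrow from `(x + 1, y + τ)` to `(x, y)` that is on one diamond only. -/
theorem westArw_mul_eastArw {τ : ℤˣ} {n : ℕ} {x y : ℤ} (h1 : x ≠ τ * y)
    (h2 : x - τ * y ≠ 2 * l) :
    westArw k l m τ n x y * eastArw k l m n (x - 1) (y + τ) =
      eastArw k l m n x y * westArw k l m τ n (x + 2) y := by
  by_cases hp : IsPoint l m n x y
  swap
  · rw [westArw_of_not_src k l m hp, eastArw_of_not_src k l m hp, zero_mul, zero_mul]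
  by_cases hq : IsPoint l m n (x + 1) (y + τ)
  swap
  · have e1 : ¬ IsPoint l m n (x - 1 + 2) (y + τ) := by
      rwa [show x - 1 + 2 = x + 1 by ring]
    have e2 : ¬ IsPoint l m n (x + 2 - 1) (y + τ) := by
      rwa [show x + 2 - 1 = x + 1 by ring]
    rw [westArw_of_not_tgt k l m e2, eastArw_of_not_tgt k l m e1, mul_zero, mul_zero]
  have hq' : glue l n (x + 1) (y + τ) = (n, x + 1, y + τ) := by
    apply glue_of_lt <;> unfold IsPoint at hp <;>
      rcases Int.units_eq_one_or τ with rfl | rfl <;> simp at h1 ⊢ <;> omega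
  have hrel := west_relation k l m (τ := -τ) hq (by simpa using hp) (by
    rintro ⟨-, h⟩
    apply h1
    rcases Int.units_eq_one_or τ with rfl | rfl <;> simp at h ⊢ <;> omega)
  have e1 : x + 1 - 1 = x := by ring
  have e2 : y + τ + ((-τ : ℤˣ) : ℤ) = y := by push_cast; ring
  have e3 : x + 1 - 2 = x - 1 := by ring
  rw [e1, e2, neg_neg, ← mul_assoc, vtx_glue_mul_typeSum k l m hp h1, hq', mul_assoc,
    jacSum_isA_mul_vtx, e3] at hrel
  rw [hrel]
  -- From a left edge vertex of the diamond `2` there are two east arrows, one in each half. The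
  -- idempotent at `(x + 1, y + τ)` removes the path through the wrong half.
  by_cases hn : n = 2 ∧ x = -(τ * y)
  · obtain ⟨rfl, hy⟩ := hn
    obtain rfl : y = (-τ : ℤˣ) * x := by
      rcases Int.units_eq_one_or τ with rfl | rfl <;> simp at hy ⊢ <;> omega
    have hx : 0 < x := hp.2.2.2.2.2.1
    rw [glue_two_edge, ← mul_assoc, vtx_left_mul_isA k l m hx (-τ), add_mul, add_mul,
      eastArw_mul_typeSum, mul_assoc, westArw_mul_vtx, if_pos, eastArw_mul_typeSum, mul_assoc,
      westArw_mul_vtx, if_neg, mul_zero, add_zero]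
    · have e4 : x + 2 - 1 = x + 1 := by ring
      have e5 : -((-τ : ℤˣ) : ℤ) * x + τ = τ * (x + 1) := by push_cast; ring
      rw [e4, e5, glue_two_edge]
      simp only [Prod.mk.injEq, true_and]
      rcases Int.units_eq_one_or τ with rfl | rfl <;> simp <;> omega
    · rw [show x + 2 - 1 = x + 1 by ring, hq']
  · rw [← mul_assoc, vtx_mul_isA k l m hp, eastArw_mul_typeSum, mul_assoc, westArw_mul_vtx, if_pos]
    · rw [show x + 2 - 1 = x + 1 by ring, hq']
    · unfold IsPoint at hq hp
      rcases Int.units_eq_one_or τ with rfl | rfl <;> simp at hq h2 ⊢ <;> omega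
    · unfold IsPoint at hq hp
      rcases Int.units_eq_one_or τ with rfl | rfl <;> simp at hq h2 ⊢ <;> omega
    · intro hn2
      unfold IsPoint at hq hp
      rcases Int.units_eq_one_or τ with rfl | rfl <;> simp [hn2] at hn hq h1 ⊢ <;> omega

/-- The relation of an arrow of a right edge. -/
theorem westArw_mul_eastArw_right {τ : ℤˣ} {n : ℕ} {x y : ℤ} (hn : 2 ≤ n)
    (h : x - τ * y = 2 * l) :
    westArw k l m τ n x y * eastArw k l m n (x - 1) (y + τ) =
      eastArw k l m (n + 1) (x - l) (-τ * (x - l)) *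
        westArw k l m (-τ) (n + 1) (x - l + 2) (-τ * (x - l)) := by
  obtain rfl : y = (-τ : ℤˣ) * (2 * l - x) := by
    rcases Int.units_eq_one_or τ with rfl | rfl <;> simp at h ⊢ <;> omega
  by_cases hp : IsPoint l m n x ((-τ : ℤˣ) * (2 * l - x))
  swap
  · rw [westArw_of_not_src k l m hp, zero_mul, eastArw_of_not_src, zero_mul]
    intro hp'
    apply hp
    unfold IsPoint at hp' ⊢
    rcases Int.units_eq_one_or τ with rfl | rfl <;> simp at hp' ⊢ <;> omega
  by_cases hq : IsPoint l m n (x + 1) ((-τ : ℤˣ) * (2 * l - x) + τ)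
  swap
  · have e1 : ¬ IsPoint l m n (x - 1 + 2) ((-τ : ℤˣ) * (2 * l - x) + τ) := by
      rwa [show x - 1 + 2 = x + 1 by ring]
    rw [eastArw_of_not_tgt k l m e1, mul_zero]
    by_cases hr : IsPoint l m (n + 1) (x - l) (-τ * (x - l))
    · rw [westArw_of_not_tgt, mul_zero]
      intro hq'
      apply hq
      unfold IsPoint at hr hq' ⊢
      rcases Int.units_eq_one_or τ with rfl | rfl <;> simp at hr hq' ⊢ <;> omega
    · rw [eastArw_of_not_src k l m hr, zero_mul]
  have hlx : l < x ∧ x < 2 * l := by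
    unfold IsPoint at hp hq
    rcases Int.units_eq_one_or τ with rfl | rfl <;> simp at hp hq ⊢ <;> omega
  have hp' : glue l n x ((-τ : ℤˣ) * (2 * l - x)) = (n, x, (-τ : ℤˣ) * (2 * (l : ℤ) - x)) := by
    apply glue_of_lt <;> rcases Int.units_eq_one_or τ with rfl | rfl <;> simp <;> omega
  have hq' : glue l n (x + 1) ((-τ : ℤˣ) * (2 * l - x) + τ) =
      (n, x + 1, (-τ : ℤˣ) * (2 * (l : ℤ) - x) + τ) := by
    apply glue_of_lt <;> rcases Int.units_eq_one_or τ with rfl | rfl <;> simp <;> omega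
  have e1 : x + 1 - 1 = x := by ring
  have e2 : ((-τ : ℤˣ) : ℤ) * (2 * (l : ℤ) - x) + τ + ((-τ : ℤˣ) : ℤ) =
      ((-τ : ℤˣ) : ℤ) * (2 * (l : ℤ) - x) := by
    push_cast; ring
  have e3 : x + 1 - 2 = x - 1 := by ring
  have hrel := west_relation k l m (τ := -τ) hq (by rwa [e1, e2]) (by
    rintro ⟨-, h⟩
    rcases Int.units_eq_one_or τ with rfl | rfl <;> simp at h <;> omega)
  rw [e1, e2, neg_neg, ← mul_assoc, vtx_glue_mul_typeSum k l m hp, hq', mul_assoc,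
    jacSum_isA_mul_vtx, e3] at hrel
  -- For `n = m` there is no diamond `n + 1`, and the product with the east arrows is zero by the
  -- convention for `eastArw`.
  · rw [hrel, hp', ← mul_assoc, vtx_right_mul_isA k l m hp hlx.2]
    -- The same type has the sign `τ` in the diamond `n` and `-τ` in the diamond `n + 1`.
    have e4 : typeSum k l m n τ = typeSum k l m (n + 1) (-τ) := by rw [typeSum_succ, neg_neg]
    rw [e4, eastArw_mul_typeSum, mul_assoc, westArw_mul_vtx, if_pos, Units.val_neg]
    have e5 : x - l + 2 - 1 = x - l + 1 := by ring
    have e6 : ((-τ : ℤˣ) : ℤ) * (x - l) + (-τ : ℤˣ) = (-τ : ℤˣ) * (x - l + 1) := by ring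
    rw [e5, e6, glue_edge (by omega) (by omega), Nat.add_sub_cancel, Prod.mk.injEq, Prod.mk.injEq]
    refine ⟨rfl, by ring, ?_⟩
    push_cast; ring
  · rcases Int.units_eq_one_or τ with rfl | rfl <;> simp <;> omega

/-- The edge arrow is of both types `B` and `C`, so its relation has four terms. Two of them contain
an east arrow that ends on the left edge, and there is none. The remaining two are the paths through
the two halves. -/
theorem eastArw_mul_westArw_one {x : ℤ} :
    eastArw k l m 2 x x * westArw k l m 1 2 (x + 2) x =
      eastArw k l m 2 x (-x) * westArw k l m (-1) 2 (x + 2) (-x) := by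
  by_cases h : 2 ≤ m ∧ 1 ≤ x ∧ x + 1 < l
  · obtain ⟨hm, hx, hxl⟩ := h
    have hrel := edge_relation k l m hm hx hxl
    have z : jacSum k l m IsA * vtx k l m (2, x + 1, x + 1) = 0 := by
      rw [jacSum_isA_mul_vtx, eastArw_of_not_src]
      unfold IsPoint; omega
    have eB : jacSum k l m IsB = typeSum k l m 2 (-1) := by
      unfold typeSum; rw [typeSign_two, if_pos rfl]
    have eC : jacSum k l m IsC = typeSum k l m 2 1 := by
      unfold typeSum; rw [typeSign_two, if_neg (by decide)]
    have hA := vtx_left_mul_isA k l m (x := x) (by omega) 1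
    simp only [Units.val_one, one_mul, neg_mul] at hA
    have g : ∀ y : ℤ, y = x + 1 ∨ y = -(x + 1) → glue l 2 (x + 2 - 1) y = (2, x + 1, x + 1) := by
      intro y hy
      rw [show x + 2 - 1 = x + 1 by ring]
      unfold glue
      rw [if_neg (by omega), if_pos rfl]
    have g' : ∀ y : ℤ, -(x + 1) < y → y < x + 1 →
        glue l 2 (x + 2 - 1) y ≠ (2, x + 1, x + 1) := by
      intro y h1 h2
      rw [show x + 2 - 1 = x + 1 by ring, glue_of_lt h1 h2]
      simp only [ne_eq, Prod.mk.injEq, true_and]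
      omega
    have z2 : ∀ b : JacAlg k l m, vtx k l m (2, x, x) * (b * jacSum k l m IsA) *
        vtx k l m (2, x + 1, x + 1) = 0 := by
      intro b
      rw [mul_assoc, mul_assoc, z, mul_zero, mul_zero]
    rw [z2, z2, add_zero, add_zero, ← mul_assoc, ← mul_assoc, hA, eB, eC, add_mul, add_mul, add_mul, add_mul] at hrel
    simp only [eastArw_mul_typeSum, mul_assoc, westArw_mul_vtx] at hrel
    -- The products `AB` and `AC` each give one path per half. In each of them exactly one path
    -- returns to the edge vertex `(x + 1, x + 1)`; the other ends inside the diamond and is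
    -- removed.
    rw [if_neg (g' _ (by simp; omega) (by simp)), if_pos (g _ (by simp; omega)),
      if_pos (g _ (by simp)), if_neg (g' _ (by simp) (by simp; omega))] at hrel
    simpa using hrel.symm
  · have h1 : ∀ (σ : ℤˣ), eastArw k l m 2 x (σ * x) * westArw k l m σ 2 (x + 2) (σ * x) = 0 := by
      intro σ
      by_cases hp : IsPoint l m 2 x (σ * x)
      · rw [westArw_of_not_tgt, mul_zero]
        intro hq
        apply h
        unfold IsPoint at hp hq
        rcases Int.units_eq_one_or σ with rfl | rfl <;> simp at hp hq <;> omega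
      · rw [eastArw_of_not_src k l m hp, zero_mul]
    have h2 := h1 1
    have h3 := h1 (-1)
    simp only [Units.val_one, Units.val_neg, one_mul, neg_mul] at h2 h3
    rw [h2, h3]

/-- The relation of an arrow of the left edge of the diamond `2`. -/
theorem eastArw_mul_westArw_left (τ : ℤˣ) (x : ℤ) :
    eastArw k l m 2 x (τ * x) * westArw k l m τ 2 (x + 2) (τ * x) =
      eastArw k l m 2 x (-τ * x) * westArw k l m (-τ) 2 (x + 2) (-τ * x) := by
  rcases Int.units_eq_one_or τ with rfl | rfl
  · simpa using eastArw_mul_westArw_one k l m (x := x)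
  · simpa using (eastArw_mul_westArw_one k l m (x := x)).symm

/-- The arrows of the right edges are glued to those of the left edges. -/
theorem westArw_right {τ : ℤˣ} {n : ℕ} {x y : ℤ} (hn : 2 ≤ n) (hm : n < m)
    (h : x + τ * y = 2 * l) (hx : x < 2 * l) :
    westArw k l m τ n x y = westArw k l m (-τ) (n + 1) (x - l) (τ * (x - l)) := by
  obtain rfl : y = τ * (2 * l - x) := by
    rcases Int.units_eq_one_or τ with rfl | rfl <;> simp at h ⊢ <;> omega
  have e : westRaw l (-τ) (n + 1) (x - l) (τ * (x - l)) = (westDir τ, n, x, τ * (2 * (l : ℤ) - x)) := by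
    unfold westRaw
    rw [if_pos, if_neg, neg_neg, Nat.add_sub_cancel]
    · simp only [Prod.mk.injEq, true_and, Units.val_neg, neg_neg]
      refine ⟨by ring, by ring⟩
    · omega
    · rw [Units.val_neg, neg_mul, units_mul_self_mul]
  unfold westArw
  rw [e]
  by_cases hp : IsPoint l m n x (τ * (2 * l - x)) ∧ IsPoint l m n (x - 1) (τ * (2 * l - x) + τ)
  · have e' : westRaw l τ n x (τ * (2 * l - x)) = (westDir τ, n, x, τ * (2 * (l : ℤ) - x)) := by
      unfold westRaw
      rw [if_neg]
      rw [units_mul_self_mul]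
      have := hp.1.2.2.2.2.2.1
      unfold IsPoint at hp
      omega
    rw [if_pos hp, if_pos, e']
    unfold IsPoint at hp ⊢
    rcases Int.units_eq_one_or τ with rfl | rfl <;> simp at hp ⊢ <;> omega
  · rw [if_neg hp, if_neg]
    intro hp'
    apply hp
    unfold IsPoint at hp' ⊢
    rcases Int.units_eq_one_or τ with rfl | rfl <;> simp at hp' ⊢ <;> omega

/-- The two left edges of the diamond `2` are glued. -/
theorem westArw_two_left (τ : ℤˣ) (x : ℤ) :
    westArw k l m (-τ) 2 x (τ * x) = westArw k l m τ 2 x (-τ * x) := by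
  unfold westArw
  rw [westRaw_two_edge (τ := τ), westRaw_two_edge (τ := -τ)]
  · congr 1
    unfold IsPoint
    rcases Int.units_eq_one_or τ with rfl | rfl <;> simp <;> omega
  · rw [Units.val_neg, neg_mul, units_mul_self_mul]
  · rw [neg_mul, mul_neg, units_mul_self_mul]

end Relations

end Diamond

/-! ### Ordered idempotent semirings -/

section IdemSemiring

variable {K : Type*} [IdemSemiring K]

theorem pow_mul_le_mul_pow {a b c : K} (h : a * b ≤ b * c) (n : ℕ) : a ^ n * b ≤ b * c ^ n := by
  induction n with
  | zero => simp
  | succ n ih =>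
    calc a ^ (n + 1) * b = a ^ n * (a * b) := by rw [pow_succ, mul_assoc]
      _ ≤ a ^ n * (b * c) := mul_le_mul_right h _
      _ = a ^ n * b * c := (mul_assoc _ _ _).symm
      _ ≤ b * c ^ n * c := mul_le_mul_left ih _
      _ = b * c ^ (n + 1) := by rw [pow_succ, mul_assoc]

theorem mul_pow_le_pow_mul {a b : K} (h : a * b ≤ b * a) (n : ℕ) : a * b ^ n ≤ b ^ n * a := by
  induction n with
  | zero => simp
  | succ n ih =>
    calc a * b ^ (n + 1) = a * b ^ n * b := by rw [pow_succ, mul_assoc]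
      _ ≤ b ^ n * a * b := mul_le_mul_left ih _
      _ = b ^ n * (a * b) := mul_assoc _ _ _
      _ ≤ b ^ n * (b * a) := mul_le_mul_right h _
      _ = b ^ (n + 1) * a := by rw [pow_succ, mul_assoc]

/-- The powers of `s + a` are eventually constant if `a` is nilpotent. -/
theorem exists_pow_mul_le {s a : K} (hss : s * s ≤ s) (hsa : s * a ≤ a) (has : a * s ≤ a)
    (hs : 1 ≤ s) (ha : ∃ n, a ^ n = 0) :
    ∃ n, (s + a) ^ n * (s + a) ≤ (s + a) ^ n ∧ s + a ≤ (s + a) ^ n := by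
  obtain ⟨N, hN⟩ := ha
  have h1 : 1 ≤ s + a := hs.trans le_self_add
  -- A word of length `n + 2` either contains `s`, which is absorbed by a neighbour and shortens the
  -- word, or it is `a ^ (n + 2)`.
  have key : ∀ n : ℕ, (s + a) ^ (n + 2) ≤ (s + a) ^ (n + 1) + a ^ (n + 2) := by
    intro n
    induction n with
    | zero =>
      have : (s + a) ^ 2 = s * s + s * a + (a * s + a * a) := by rw [sq, add_mul, mul_add, mul_add]
      rw [zero_add, zero_add, pow_one, this, sq]
      refine add_le (add_le ?_ ?_) (add_le ?_ ?_)
      · exact hss.trans (le_self_add.trans le_self_add)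
      · exact hsa.trans (le_add_self.trans le_self_add)
      · exact has.trans (le_add_self.trans le_self_add)
      · exact le_add_self
    | succ n ih =>
      calc (s + a) ^ (n + 1 + 2) = (s + a) ^ (n + 2) * (s + a) := pow_succ _ _
        _ ≤ ((s + a) ^ (n + 1) + a ^ (n + 2)) * (s + a) := mul_le_mul_left ih _
        _ = (s + a) ^ (n + 2) + (a ^ (n + 1) * (a * s) + a ^ (n + 3)) := by
          rw [add_mul, ← pow_succ, mul_add, ← pow_succ, pow_succ a (n + 1), mul_assoc]
        _ ≤ (s + a) ^ (n + 2) + a ^ (n + 3) := by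
          refine add_le le_self_add (add_le ?_ le_add_self)
          refine le_trans ?_ le_self_add
          calc a ^ (n + 1) * (a * s) ≤ a ^ (n + 1) * a := mul_le_mul_right has _
            _ = a ^ (n + 2) := (pow_succ _ _).symm
            _ ≤ (s + a) ^ (n + 2) := pow_le_pow_left₀ zero_le le_add_self _
  refine ⟨N + 1, ?_, ?_⟩
  · have := key N
    rwa [pow_succ' a (N + 1), pow_succ' a N, hN, mul_zero, mul_zero, add_zero, pow_succ] at this
  · exact le_self_pow h1 (by omega)

/-- A normal form for words in `s`, `w`, `a`: if `a` can be moved to the right across `w`, up to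
an error term `r`, then a product of three powers is closed under right multiplication. -/
theorem exists_mul_closed {s w a r : K} (hs : 1 ≤ s) (hss : s * s ≤ s)
    (hsa : s * a ≤ a) (has : a * s ≤ a) (hsw : s * w ≤ w) (hws : w * s ≤ w)
    (hsr : s * r ≤ r) (hrs : r * s ≤ r)
    (ha : ∃ n, a ^ n = 0) (hw : ∃ n, w ^ n = 0) (hr : ∃ n, r ^ n = 0)
    (haw : a * w ≤ w * a + r) (har : a * r = 0) (hrw : r * w ≤ w * r) :
    ∃ i j n, 1 ≤ (s + w) ^ i * (s + r) ^ j * (s + a) ^ n ∧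
      (s + w) ^ i * (s + r) ^ j * (s + a) ^ n * (s + a + w) ≤
        (s + w) ^ i * (s + r) ^ j * (s + a) ^ n := by
  obtain ⟨i, hi, hi'⟩ := exists_pow_mul_le hss hsw hws hs hw
  obtain ⟨j, hj, hj'⟩ := exists_pow_mul_le hss hsr hrs hs hr
  obtain ⟨n, hn, -⟩ := exists_pow_mul_le hss hsa has hs ha
  have hx : 1 ≤ s + w := hs.trans le_self_add
  have hb : 1 ≤ s + r := hs.trans le_self_add
  have hc : 1 ≤ s + a := hs.trans le_self_add
  refine ⟨i, j, n, ?_, ?_⟩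
  · calc (1 : K) = 1 * 1 * 1 := by simp
      _ ≤ _ := mul_le_mul' (mul_le_mul' (one_le_pow₀ hx) (one_le_pow₀ hb)) (one_le_pow₀ hc)
  generalize hX : s + w = X at *
  generalize hB : s + r = B at *
  generalize hA : s + a = A at *
  have hwX : w ≤ X := hX ▸ le_add_self
  have hrB : r ≤ B := hB ▸ le_add_self
  have haA : a ≤ A := hA ▸ le_add_self
  have hsX : s ≤ X := hX ▸ le_self_add
  have hsB : s ≤ B := hB ▸ le_self_add
  have hsA : s ≤ A := hA ▸ le_self_add
  have hBX : B * X ≤ X * B := by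
    rw [← hB, ← hX, add_mul, mul_add, mul_add, hB, hX]
    refine add_le (add_le ?_ ?_) (add_le ?_ ?_)
    · exact mul_le_mul' hsX hsB
    · calc s * w ≤ w := hsw
        _ = w * 1 := (mul_one _).symm
        _ ≤ X * B := mul_le_mul' hwX hb
    · calc r * s ≤ r := hrs
        _ = 1 * r := (one_mul _).symm
        _ ≤ X * B := mul_le_mul' hx hrB
    · exact hrw.trans (mul_le_mul' hwX hrB)
  have hAB : A * B ≤ B * A := by
    rw [← hB, ← hA, add_mul, mul_add, mul_add, hB, hA, har, add_zero]
    refine add_le (add_le ?_ ?_) ?_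
    · exact mul_le_mul' hsB hsA
    · calc s * r ≤ r := hsr
        _ = r * 1 := (mul_one _).symm
        _ ≤ B * A := mul_le_mul' hrB hc
    · calc a * s ≤ a := has
        _ = 1 * a := (one_mul _).symm
        _ ≤ B * A := mul_le_mul' hb haA
  -- The error term of the exchange is collected in one new factor `B` between `X` and `A`.
  have hAX : A * X ≤ X * (B * A) := by
    rw [← hX, ← hA, add_mul, mul_add, mul_add, hX, hA]
    refine add_le (add_le ?_ ?_) (add_le ?_ ?_)
    · calc s * s = s * (1 * s) := by rw [one_mul]
        _ ≤ X * (B * A) := mul_le_mul' hsX (mul_le_mul' hb hsA)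
    · calc s * w ≤ w := hsw
        _ = w * (1 * 1) := by simp
        _ ≤ X * (B * A) := mul_le_mul' hwX (mul_le_mul' hb hc)
    · calc a * s ≤ a := has
        _ = 1 * (1 * a) := by simp
        _ ≤ X * (B * A) := mul_le_mul' hx (mul_le_mul' hb haA)
    · refine haw.trans (add_le ?_ ?_)
      · calc w * a = w * (1 * a) := by simp
          _ ≤ X * (B * A) := mul_le_mul' hwX (mul_le_mul' hb haA)
      · calc r = 1 * (r * 1) := by simp
          _ ≤ X * (B * A) := mul_le_mul' hx (mul_le_mul' hrB hc)
  -- Each further `A` creates another `B`. Moving `A` to the right of `B ^ j` brings the new factor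
  -- next to `B ^ j`, which absorbs it; so one exponent `j` serves all `q`.
  have h1 : ∀ q : ℕ, A ^ q * X ≤ X * (B ^ j * A ^ q) := by
    intro q
    induction q with
    | zero =>
      calc A ^ 0 * X = X * (1 * 1) := by simp
        _ ≤ X * (B ^ j * A ^ 0) := by
          rw [pow_zero]; exact mul_le_mul_right (mul_le_mul_left (one_le_pow₀ hb) _) _
    | succ q ih =>
      calc A ^ (q + 1) * X = A * (A ^ q * X) := by rw [pow_succ', mul_assoc]
        _ ≤ A * (X * (B ^ j * A ^ q)) := mul_le_mul_right ih _
        _ = A * X * (B ^ j * A ^ q) := (mul_assoc _ _ _).symm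
        _ ≤ X * (B * A) * (B ^ j * A ^ q) := mul_le_mul_left hAX _
        _ = X * (B * (A * B ^ j) * A ^ q) := by simp only [mul_assoc]
        _ ≤ X * (B * (B ^ j * A) * A ^ q) :=
          mul_le_mul_right (mul_le_mul_left (mul_le_mul_right (mul_pow_le_pow_mul hAB j) _) _) _
        _ = X * (B ^ j * B * A ^ (q + 1)) := by
          rw [← mul_assoc B, ← pow_succ', pow_succ A, ← pow_succ, mul_assoc (B ^ (j + 1)),
            ← pow_succ, ← pow_succ']
        _ ≤ X * (B ^ j * A ^ (q + 1)) := mul_le_mul_right (mul_le_mul_left hj _) _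
  have hBB : ∀ q : ℕ, B ^ j * B ^ q ≤ B ^ j := by
    intro q
    induction q with
    | zero => simp
    | succ q ih =>
      rw [pow_succ, ← mul_assoc]
      exact (mul_le_mul_left ih _).trans hj
  rw [mul_add]
  refine add_le ?_ ?_
  · rw [mul_assoc]
    exact mul_le_mul_right hn _
  · calc X ^ i * B ^ j * A ^ n * w ≤ X ^ i * B ^ j * A ^ n * X := mul_le_mul_right hwX _
      _ = X ^ i * B ^ j * (A ^ n * X) := mul_assoc _ _ _
      _ ≤ X ^ i * B ^ j * (X * (B ^ j * A ^ n)) := mul_le_mul_right (h1 n) _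
      _ = X ^ i * (B ^ j * X) * (B ^ j * A ^ n) := by simp only [mul_assoc]
      _ ≤ X ^ i * (X * B ^ j) * (B ^ j * A ^ n) :=
        mul_le_mul_left (mul_le_mul_right (pow_mul_le_mul_pow hBX j) _) _
      _ = X ^ i * X * (B ^ j * B ^ j) * A ^ n := by simp only [mul_assoc]
      _ ≤ X ^ i * B ^ j * A ^ n := mul_le_mul_left (mul_le_mul' hi (hBB j)) _

end IdemSemiring

/-! ### Finite-dimensionality of the Jacobian algebra. -/

namespace Diamond

open FQuiver

section Finite

variable (k : Type*) [Field k] (l m : ℕ)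

theorem vtx_mul_self (v : ℕ × ℤ × ℤ) : vtx k l m v * vtx k l m v = vtx k l m v := by
  unfold vtx
  split_ifs
  · rw [idem, ← map_mul, idemp_mul_self]
  · simp

theorem vtx_mul_of_ne {u v : ℕ × ℤ × ℤ} (h : u ≠ v) : vtx k l m u * vtx k l m v = 0 := by
  unfold vtx
  split_ifs
  · rw [idem, idem, ← map_mul, idemp_mul_of_ne, map_zero]
    simpa using h
  all_goals simp

theorem sum_vtx : ∑ v ∈ vertexSet l m, vtx k l m v = 1 := by
  rw [← Finset.sum_coe_sort, ← map_one (toJac k (quiver l m) (potential k l m)), ← sum_idemp,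
    map_sum]
  exact Finset.sum_congr rfl fun v _ => vtx_coe k l m v

theorem jac_induction {C : JacAlg k l m → Prop} (hk : ∀ c, C (algebraMap k _ c))
    (he : ∀ v ∈ vertexSet l m, C (vtx k l m v)) (ha : ∀ a ∈ arrowSet l m, C (arw k l m a))
    (hmul : ∀ x y, C x → C y → C (x * y)) (hadd : ∀ x y, C x → C y → C (x + y))
    (x : JacAlg k l m) : C x := by
  obtain ⟨x, rfl⟩ := RingQuot.mkAlgHom_surjective k (JacRel k (quiver l m) (potential k l m)) x
  refine pathAlg_induction k (quiver l m)
    (C := fun x => C (toJac k (quiver l m) (potential k l m) x)) ?_ ?_ ?_ ?_ ?_ x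
  · intro c; rw [AlgHom.commutes]; exact hk c
  · intro u; have := he u.1 u.2; rwa [vtx_coe] at this
  · intro a; have := ha a.1 a.2; rwa [arw_coe] at this
  · intro x y hx hy; rw [map_mul]; exact hmul _ _ hx hy
  · intro x y hx hy; rw [map_add]; exact hadd _ _ hx hy

/-- A span of elements that strictly increase a rank of the vertices is nilpotent. -/
theorem span_pow_eq_zero (s : Set (JacAlg k l m)) (D : ℕ × ℤ × ℤ → ℤ) (N : ℕ)
    (hD : ∀ v ∈ vertexSet l m, 0 ≤ D v ∧ D v < N)
    (hs : ∀ z ∈ s, ∃ u w, vtx k l m u * z = z ∧ z * vtx k l m w = z ∧ D u < D w) :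
    (Submodule.span k s) ^ N = 0 := by
  -- Each factor raises the rank by at least one, so a product of `n` factors out of `v` would have
  -- to end at rank at least `D v + n`, beyond the range of `D`.
  have key : ∀ (n : ℕ) (v : ℕ × ℤ × ℤ), v ∈ vertexSet l m → N ≤ D v + n →
      ∀ z ∈ (Submodule.span k s) ^ n, vtx k l m v * z = 0 := by
    intro n
    induction n with
    | zero => intro v hv h; have := (hD v hv).2; push_cast at h; omega
    | succ n ih =>
      intro v hv h z hz
      rw [pow_succ'] at hz
      refine Submodule.mul_induction_on hz (fun y hy z hz => ?_) fun x y hx hy => ?_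
      · induction hy using Submodule.span_induction with
        | mem y hy =>
          obtain ⟨u, w, h1, h2, h3⟩ := hs y hy
          by_cases hv' : v = u
          · by_cases hw : w ∈ vertexSet l m
            · rw [← h2, mul_assoc y, ih w hw (by subst hv'; push_cast at h; omega) z hz, mul_zero,
                mul_zero]
            · have : vtx k l m w = 0 := dif_neg hw
              rw [← h2, this, mul_zero, zero_mul, mul_zero]
          · rw [← h1, mul_assoc, ← mul_assoc (vtx k l m v), vtx_mul_of_ne k l m hv', zero_mul]
        | zero => rw [zero_mul, mul_zero]
        | add x y _ _ hx hy => rw [add_mul, mul_add, hx, hy, add_zero]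
        | smul c x _ hx => rw [smul_mul_assoc, mul_smul_comm, hx, smul_zero]
      · rw [mul_add, hx, hy, add_zero]
  rw [Submodule.zero_eq_bot, eq_bot_iff]
  intro z hz
  rw [Submodule.mem_bot, ← one_mul z, ← sum_vtx k l m, Finset.sum_mul]
  refine Finset.sum_eq_zero fun v hv => key N v hv ?_ z hz
  have := (hD v hv).1
  omega

theorem span_mul_span_le {s t : Set (JacAlg k l m)} {U : Submodule k (JacAlg k l m)}
    (h : ∀ x ∈ s, ∀ y ∈ t, x * y ∈ U) : Submodule.span k s * Submodule.span k t ≤ U := by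
  rw [Submodule.span_mul_span, Submodule.span_le]
  rintro _ ⟨x, hx, y, hy, rfl⟩
  exact h x hx y hy

/-- The coordinate along which all arrows of the same kind point in the same direction. -/
def rank (l : ℕ) (v : ℕ × ℤ × ℤ) : ℤ := v.1 * l + v.2.1

/-- Passing from a right edge to the next left edge raises the number of the diamond by one and
lowers `x` by `l`. The two glued points of the diamond `2` have the same `x`. -/
theorem rank_glue {n : ℕ} {x y : ℤ} (h : IsPoint l m n x y) :
    rank l (glue l n x y) = n * l + x := by
  rcases glue_cases h with g | g | g | g <;> rw [g.2.2, rank] <;> simp only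
  · rw [g.1]
  all_goals
    rw [Nat.cast_sub (by omega)]
    push_cast
    ring

theorem rank_rawTgt {a : RawArrow} (h : a ∈ arrowSet l m) :
    rank l (rawTgt l a) = rank l (rawSrc l a) + a.1.dx := by
  rcases arrow_cases h with ⟨h1, h2, -⟩ | ⟨hl, hm, rfl⟩
  · rw [rawTgt, rawSrc, rank_glue l m h1, rank_glue l m h2]
    ring
  · simp [rawTgt, rawSrc, glue, rank, Dir.dx, Dir.dy]
    ring

theorem rank_bounds {v : ℕ × ℤ × ℤ} (h : v ∈ vertexSet l m) :
    0 ≤ rank l v ∧ rank l v ≤ m * l + 2 * l := by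
  obtain ⟨n, x, y⟩ := v
  rw [mem_vertexSet] at h
  unfold rank
  simp only
  have h1 : (n : ℤ) * l ≤ m * l := by
    have : (n : ℤ) ≤ m := by omega
    exact mul_le_mul_of_nonneg_right this (by omega)
  have h2 : 0 ≤ (n : ℤ) * l := by positivity
  omega

/-- The path of length two from `(x, x)` to `(x + 1, x + 1)` in the diamond `2`. -/
noncomputable def edgeUp (x : ℤ) : JacAlg k l m :=
  eastArw k l m 2 x x * westArw k l m 1 2 (x + 2) x

/-- By the edge relation of the diamond `2`, it does not matter through which half one climbs. -/
theorem edgeUp_eq (τ : ℤˣ) (x : ℤ) :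
    eastArw k l m 2 x (τ * x) * westArw k l m τ 2 (x + 2) (τ * x) = edgeUp k l m x := by
  unfold edgeUp
  rcases Int.units_eq_one_or τ with rfl | rfl
  · simp
  · simpa using eastArw_mul_westArw_left k l m (-1) x

theorem vtx_mul_edgeUp (x : ℤ) : vtx k l m (2, x, x) * edgeUp k l m x = edgeUp k l m x := by
  unfold edgeUp
  rw [← mul_assoc, vtx_mul_eastArw, if_pos]
  simp [glue]

theorem edgeUp_mul_vtx (x : ℤ) :
    edgeUp k l m x * vtx k l m (2, x + 1, x + 1) = edgeUp k l m x := by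
  unfold edgeUp
  rw [mul_assoc, westArw_mul_vtx, if_pos]
  rw [show x + 2 - 1 = x + 1 by ring, Units.val_one]
  simp [glue]

theorem edgeUp_eq_zero {x : ℤ} (h : ¬ (0 < x ∧ x + 1 < l)) : edgeUp k l m x = 0 := by
  unfold edgeUp
  by_cases hp : IsPoint l m 2 x x
  · rw [westArw_of_not_tgt, mul_zero]
    unfold IsPoint at hp ⊢
    rw [Units.val_one]
    omega
  · rw [eastArw_of_not_src k l m hp, zero_mul]

theorem exists_west {d : Dir} (h : d ≠ Dir.east) : ∃ τ, d = westDir τ := by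
  cases d
  · exact absurd rfl h
  · exact ⟨1, westDir_one.symm⟩
  · exact ⟨-1, westDir_neg_one.symm⟩

theorem arw_westDir {τ : ℤˣ} {n : ℕ} {x y : ℤ} (ha : (westDir τ, n, x, y) ∈ arrowSet l m)
    (hp : IsPoint l m n x y) : arw k l m (westDir τ, n, x, y) = westArw k l m τ n x y := by
  rcases arrow_cases ha with ⟨-, h2, h3⟩ | ⟨-, -, h⟩
  · simp only [westDir_dx, westDir_dy] at h2
    rw [westArw_of_isPoint k l m hp h2]
    by_cases e : τ * y = -x
    · have hE : OnLeftEdge (westDir τ, n, x, y) := by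
        unfold OnLeftEdge
        simp only [westDir_dx, westDir_dy]
        rcases Int.units_eq_one_or τ with rfl | rfl <;> simp at e ⊢ <;> omega
      obtain ⟨rfl, h4⟩ := h3 hE
      simp only at h4
      rw [← westDir_neg_one, westDir_inj] at h4
      subst h4
      rw [westRaw_two_edge e, westDir_neg_one]
      simp at e
      rw [e]
    · rw [westRaw, if_neg e]
  · simp only [Prod.mk.injEq] at h
    unfold IsPoint at hp
    omega

/-- The spans of the trivial paths, of the east arrows, of the other arrows, and of the elements
`edgeUp x`. -/
noncomputable def vtxSpan : Submodule k (JacAlg k l m) :=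
  Submodule.span k (vtx k l m '' vertexSet l m)

noncomputable def eastSpan : Submodule k (JacAlg k l m) :=
  Submodule.span k (arw k l m '' {a ∈ arrowSet l m | a.1 = Dir.east})

noncomputable def westSpan : Submodule k (JacAlg k l m) :=
  Submodule.span k (arw k l m '' {a ∈ arrowSet l m | a.1 ≠ Dir.east})

noncomputable def edgeSpan : Submodule k (JacAlg k l m) :=
  Submodule.span k (edgeUp k l m '' Finset.Icc 0 (l : ℤ))

theorem eastArw_mem (n : ℕ) (x y : ℤ) : eastArw k l m n x y ∈ eastSpan k l m := by
  by_cases h : (Dir.east, n, x, y) ∈ arrowSet l m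
  · exact Submodule.subset_span ⟨_, by simpa using h, rfl⟩
  · rw [eastArw, arw, dif_neg h]; exact zero_mem _

theorem westArw_mem (τ : ℤˣ) (n : ℕ) (x y : ℤ) : westArw k l m τ n x y ∈ westSpan k l m := by
  by_cases h : IsPoint l m n x y ∧ IsPoint l m n (x - 1) (y + τ)
  · rw [westArw_of_isPoint k l m h.1 h.2]
    refine Submodule.subset_span ⟨_, ?_, rfl⟩
    simp only [Set.mem_ofPred_eq]
    exact ⟨westRaw_mem h.1 h.2, not_isA_westRaw⟩
  · rw [westArw, if_neg h]; exact zero_mem _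

theorem edgeUp_mem (x : ℤ) : edgeUp k l m x ∈ edgeSpan k l m := by
  by_cases h : 0 < x ∧ x + 1 < l
  · exact Submodule.subset_span ⟨x, by simp; omega, rfl⟩
  · rw [edgeUp_eq_zero k l m h]; exact zero_mem _

theorem vtxSpan_mul_le {s : Set (JacAlg k l m)}
    (hs : ∀ z ∈ s, ∃ u, vtx k l m u * z = z) :
    vtxSpan k l m * Submodule.span k s ≤ Submodule.span k s := by
  refine span_mul_span_le k l m ?_
  rintro _ ⟨v, -, rfl⟩ z hz
  obtain ⟨u, hu⟩ := hs z hz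
  by_cases h : v = u
  · rw [h, hu]; exact Submodule.subset_span hz
  · rw [← hu, ← mul_assoc, vtx_mul_of_ne k l m h, zero_mul]; exact zero_mem _

theorem mul_vtxSpan_le {s : Set (JacAlg k l m)}
    (hs : ∀ z ∈ s, ∃ u, z * vtx k l m u = z) :
    Submodule.span k s * vtxSpan k l m ≤ Submodule.span k s := by
  refine span_mul_span_le k l m ?_
  rintro z hz _ ⟨v, -, rfl⟩
  obtain ⟨u, hu⟩ := hs z hz
  by_cases h : u = v
  · rw [← h, hu]; exact Submodule.subset_span hz
  · rw [← hu, mul_assoc, vtx_mul_of_ne k l m h, mul_zero]; exact zero_mem _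

theorem vtx_rawSrc_mul_arw (a : RawArrow) : vtx k l m (rawSrc l a) * arw k l m a = arw k l m a := by
  rw [vtx_mul_arw, if_pos rfl]

theorem arw_mul_vtx_rawTgt (a : RawArrow) : arw k l m a * vtx k l m (rawTgt l a) = arw k l m a := by
  rw [arw_mul_vtx, if_pos rfl]

theorem arw_mul_arw_of_ne {a b : RawArrow} (h : rawTgt l a ≠ rawSrc l b) :
    arw k l m a * arw k l m b = 0 := by
  rw [← arw_mul_vtx_rawTgt, mul_assoc, vtx_mul_arw, if_neg h.symm, mul_zero]

theorem exists_eastSpan_pow : ∃ n, eastSpan k l m ^ n = 0 := by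
  refine ⟨m * l + 2 * l + 1, span_pow_eq_zero k l m _ (rank l) _ ?_ ?_⟩
  · intro v hv
    have := rank_bounds l m hv
    push_cast
    omega
  · rintro _ ⟨a, ha, rfl⟩
    simp only [Set.mem_ofPred_eq] at ha
    refine ⟨_, _, vtx_rawSrc_mul_arw k l m a, arw_mul_vtx_rawTgt k l m a, ?_⟩
    rw [rank_rawTgt l m ha.1, ha.2, Dir.dx]
    omega

theorem exists_westSpan_pow : ∃ n, westSpan k l m ^ n = 0 := by
  refine ⟨m * l + 2 * l + 1, span_pow_eq_zero k l m _ (fun v => m * l + 2 * l - rank l v) _ ?_ ?_⟩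
  · intro v hv
    have := rank_bounds l m hv
    push_cast
    omega
  · rintro _ ⟨a, ha, rfl⟩
    simp only [Set.mem_ofPred_eq] at ha
    refine ⟨_, _, vtx_rawSrc_mul_arw k l m a, arw_mul_vtx_rawTgt k l m a, ?_⟩
    obtain ⟨τ, hτ⟩ := exists_west ha.2
    rw [rank_rawTgt l m ha.1, hτ, westDir_dx]
    omega

theorem exists_edgeSpan_pow : ∃ n, edgeSpan k l m ^ n = 0 := by
  refine ⟨m * l + 2 * l + 1, span_pow_eq_zero k l m _ (rank l) _ ?_ ?_⟩
  · intro v hv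
    have := rank_bounds l m hv
    push_cast
    omega
  · rintro _ ⟨x, -, rfl⟩
    refine ⟨_, _, vtx_mul_edgeUp k l m x, edgeUp_mul_vtx k l m x, ?_⟩
    simp [rank]

/-- The relations replace an east-west path by a west-east path, in the same diamond or, if the path
joins two points of one left edge, in the preceding diamond. The diamond `2` has no predecessor,
which is the origin of the error term `edgeSpan`. -/
theorem eastSpan_mul_westSpan :
    eastSpan k l m * westSpan k l m ≤ westSpan k l m * eastSpan k l m + edgeSpan k l m := by
  refine span_mul_span_le k l m ?_
  rintro _ ⟨⟨d, n, x, y⟩, ha, rfl⟩ _ ⟨⟨d', n', x', y'⟩, hb, rfl⟩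
  simp only [Set.mem_ofPred_eq] at ha hb
  obtain ⟨ha, rfl⟩ := ha
  obtain ⟨hb, hd⟩ := hb
  by_cases h : rawTgt l (Dir.east, n, x, y) = rawSrc l (d', n', x', y')
  swap
  · rw [arw_mul_arw_of_ne k l m h]; exact zero_mem _
  rw [rawTgt_of_east ha, rawSrc_of_ne_east hb hd] at h
  simp only [Prod.mk.injEq] at h
  obtain ⟨rfl, rfl, rfl⟩ := h
  obtain ⟨τ, rfl⟩ := exists_west hd
  obtain ⟨hp, hq⟩ := east_mem_arrowSet.1 ha
  rw [arw_westDir k l m hb hq]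
  change eastArw k l m n x y * _ ∈ _
  have hW : ∀ (σ : ℤˣ) (n n' : ℕ) (x y x' y' : ℤ),
      westArw k l m σ n x y * eastArw k l m n' x' y' ∈
        westSpan k l m * eastSpan k l m + edgeSpan k l m := fun σ n n' x y x' y' =>
    (le_self_add : westSpan k l m * eastSpan k l m ≤ _)
      (Submodule.mul_mem_mul (westArw_mem k l m _ _ _ _) (eastArw_mem k l m _ _ _))
  by_cases h1 : x = τ * y
  · obtain rfl : y = τ * x := by rw [h1, units_mul_self_mul]
    by_cases hn : n = 2
    · subst hn
      rw [edgeUp_eq]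
      exact (le_add_self : edgeSpan k l m ≤ _) (edgeUp_mem k l m x)
    · obtain ⟨r, rfl⟩ : ∃ r, n = r + 1 := ⟨n - 1, by have := hp.1; omega⟩
      have := westArw_mul_eastArw_right k l m (τ := -τ) (n := r) (x := x + l) (y := τ * (l - x))
        (by have := hp.1; omega) (by
          rw [Units.val_neg, neg_mul, units_mul_self_mul]; ring)
      rw [add_sub_cancel_right, Units.val_neg, neg_neg, neg_neg] at this
      rw [← this]
      exact hW _ _ _ _ _ _ _
  · rw [← westArw_mul_eastArw k l m h1]
    · exact hW _ _ _ _ _ _ _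
    · unfold IsPoint at hp hq
      rcases Int.units_eq_one_or τ with rfl | rfl <;> simp <;> omega

/-- A climb starts on the left edge of the diamond `2`, where no east arrow ends. -/
theorem eastSpan_mul_edgeSpan : eastSpan k l m * edgeSpan k l m = 0 := by
  rw [Submodule.zero_eq_bot, eq_bot_iff]
  refine span_mul_span_le k l m ?_
  rintro _ ⟨⟨d, n, x, y⟩, ha, rfl⟩ _ ⟨z, -, rfl⟩
  simp only [Set.mem_ofPred_eq] at ha
  obtain ⟨ha, rfl⟩ := ha
  rw [Submodule.mem_bot, ← vtx_mul_edgeUp, ← mul_assoc, arw_mul_vtx, if_neg, zero_mul]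
  rw [rawTgt_of_east ha]
  simp only [Prod.mk.injEq]
  obtain ⟨hp, hq⟩ := east_mem_arrowSet.1 ha
  unfold IsPoint at hp
  omega

/-- From `(x + 1, x + 1)` the only possible west step descends along the edge. Writing `E`, `N`, `S`
for east, northwest and southwest steps, `E N S = E S N = S E N`, and `E N` on the right is again a
climb, one place lower. -/
theorem edgeSpan_mul_westSpan :
    edgeSpan k l m * westSpan k l m ≤ westSpan k l m * edgeSpan k l m := by
  refine span_mul_span_le k l m ?_
  rintro _ ⟨x, -, rfl⟩ _ ⟨⟨d, n, x', y'⟩, hb, rfl⟩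
  simp only [Set.mem_ofPred_eq] at hb
  obtain ⟨hb, hd⟩ := hb
  by_cases hx : 0 < x ∧ x + 1 < l
  swap
  · rw [edgeUp_eq_zero k l m hx, zero_mul]; exact zero_mem _
  by_cases h : (2, x + 1, x + 1) = rawSrc l (d, n, x', y')
  swap
  · rw [← edgeUp_mul_vtx, mul_assoc, vtx_mul_arw, if_neg (Ne.symm h), mul_zero]; exact zero_mem _
  rw [rawSrc_of_ne_east hb hd] at h
  simp only [Prod.mk.injEq] at h
  obtain ⟨rfl, rfl, rfl⟩ := h
  obtain ⟨τ, rfl⟩ := exists_west hd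
  have hm : 2 ≤ m := by
    rcases arrow_cases hb with ⟨h, -, -⟩ | ⟨-, h, -⟩
    · exact h.2.1
    · exact h
  rw [arw_westDir k l m hb (by unfold IsPoint; omega)]
  rcases Int.units_eq_one_or τ with rfl | rfl
  · rw [westArw_of_not_tgt, mul_zero]
    · exact zero_mem _
    · unfold IsPoint
      rw [Units.val_one]
      omega
  · have e1 := westArw_mul_westArw k l m 1 2 (x + 2) x
    have e2 := westArw_mul_eastArw k l m (τ := -1) (n := 2) (x := x) (y := x)
      (by simp; omega) (by simp; omega)
    have e3 : x + 2 - 1 = x + 1 := by ring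
    rw [Units.val_one, e3] at e1
    rw [Units.val_neg, Units.val_one, ← sub_eq_add_neg] at e2
    have e4 : edgeUp k l m (x - 1) =
        eastArw k l m 2 (x - 1) (x - 1) * westArw k l m 1 2 (x + 1) (x - 1) := by
      unfold edgeUp
      rw [show x - 1 + 2 = x + 1 by ring]
    rw [edgeUp, mul_assoc, ← e1, ← mul_assoc, ← e2, mul_assoc, ← e4]
    exact Submodule.mul_mem_mul (westArw_mem k l m _ _ _ _) (edgeUp_mem k l m _)

theorem one_le_vtxSpan : 1 ≤ vtxSpan k l m := by
  rw [Submodule.one_le, ← sum_vtx]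
  exact Submodule.sum_mem _ fun v hv => Submodule.subset_span ⟨v, hv, rfl⟩

/-- The normal form: west steps, then climbs along the edge, then east steps, with bounded
exponents. -/
theorem exists_span_mul_closed : ∃ i j n,
    1 ≤ (vtxSpan k l m + westSpan k l m) ^ i * (vtxSpan k l m + edgeSpan k l m) ^ j *
      (vtxSpan k l m + eastSpan k l m) ^ n ∧
    (vtxSpan k l m + westSpan k l m) ^ i * (vtxSpan k l m + edgeSpan k l m) ^ j *
      (vtxSpan k l m + eastSpan k l m) ^ n * (vtxSpan k l m + eastSpan k l m + westSpan k l m) ≤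
    (vtxSpan k l m + westSpan k l m) ^ i * (vtxSpan k l m + edgeSpan k l m) ^ j *
      (vtxSpan k l m + eastSpan k l m) ^ n := by
  have hsrc : ∀ s : Set RawArrow, ∀ z ∈ arw k l m '' s, ∃ u, vtx k l m u * z = z := by
    rintro s _ ⟨a, -, rfl⟩
    exact ⟨_, vtx_rawSrc_mul_arw k l m a⟩
  have htgt : ∀ s : Set RawArrow, ∀ z ∈ arw k l m '' s, ∃ u, z * vtx k l m u = z := by
    rintro s _ ⟨a, -, rfl⟩
    exact ⟨_, arw_mul_vtx_rawTgt k l m a⟩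
  have hss : vtxSpan k l m * vtxSpan k l m ≤ vtxSpan k l m :=
    vtxSpan_mul_le k l m (by rintro _ ⟨v, -, rfl⟩; exact ⟨v, vtx_mul_self k l m v⟩)
  have hsa : vtxSpan k l m * eastSpan k l m ≤ eastSpan k l m := vtxSpan_mul_le k l m (hsrc _)
  have has : eastSpan k l m * vtxSpan k l m ≤ eastSpan k l m := mul_vtxSpan_le k l m (htgt _)
  have hsw : vtxSpan k l m * westSpan k l m ≤ westSpan k l m := vtxSpan_mul_le k l m (hsrc _)
  have hws : westSpan k l m * vtxSpan k l m ≤ westSpan k l m := mul_vtxSpan_le k l m (htgt _)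
  have hsr : vtxSpan k l m * edgeSpan k l m ≤ edgeSpan k l m :=
    vtxSpan_mul_le k l m (by rintro _ ⟨x, -, rfl⟩; exact ⟨_, vtx_mul_edgeUp k l m x⟩)
  have hrs : edgeSpan k l m * vtxSpan k l m ≤ edgeSpan k l m :=
    mul_vtxSpan_le k l m (by rintro _ ⟨x, -, rfl⟩; exact ⟨_, edgeUp_mul_vtx k l m x⟩)
  exact exists_mul_closed (s := vtxSpan k l m) (w := westSpan k l m)
    (a := eastSpan k l m) (r := edgeSpan k l m) (one_le_vtxSpan k l m) hss hsa has hsw hws hsr hrs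
    (exists_eastSpan_pow k l m) (exists_westSpan_pow k l m) (exists_edgeSpan_pow k l m)
    (eastSpan_mul_westSpan k l m) (eastSpan_mul_edgeSpan k l m) (edgeSpan_mul_westSpan k l m)

theorem mul_mem_of_mul_span_le {U : Submodule k (JacAlg k l m)}
    (h2 : U * (vtxSpan k l m + eastSpan k l m + westSpan k l m) ≤ U) (z : JacAlg k l m) :
    ∀ u ∈ U, u * z ∈ U := by
  have hgen : ∀ z ∈ vtxSpan k l m + eastSpan k l m + westSpan k l m, ∀ u ∈ U, u * z ∈ U :=
    fun z hz u hu => h2 (Submodule.mul_mem_mul hu hz)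
  induction z using jac_induction with
  | hk c =>
    intro u hu
    rw [← Algebra.commutes, ← Algebra.smul_def]
    exact U.smul_mem c hu
  | he v hv =>
    refine hgen _ ?_
    exact (le_self_add.trans le_self_add : vtxSpan k l m ≤ _) (Submodule.subset_span ⟨v, hv, rfl⟩)
  | ha a ha =>
    refine hgen _ ?_
    by_cases hd : a.1 = Dir.east
    · refine (le_add_self.trans le_self_add : eastSpan k l m ≤ _) (Submodule.subset_span ⟨a, ?_, rfl⟩)
      simpa using ⟨ha, hd⟩
    · refine (le_add_self : westSpan k l m ≤ _) (Submodule.subset_span ⟨a, ?_, rfl⟩)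
      simpa using ⟨ha, hd⟩
  | hmul x y hx hy =>
    intro u hu
    rw [← mul_assoc]
    exact hy _ (hx u hu)
  | hadd x y hx hy =>
    intro u hu
    rw [mul_add]
    exact add_mem (hx u hu) (hy u hu)

theorem fg_vtxSpan : (vtxSpan k l m).FG :=
  Submodule.fg_span ((vertexSet l m).finite_toSet.image _)

theorem fg_eastSpan : (eastSpan k l m).FG :=
  Submodule.fg_span (((arrowSet l m).finite_toSet.subset fun _ ha => ha.1).image _)

theorem fg_westSpan : (westSpan k l m).FG :=
  Submodule.fg_span (((arrowSet l m).finite_toSet.subset fun _ ha => ha.1).image _)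

theorem fg_edgeSpan : (edgeSpan k l m).FG :=
  Submodule.fg_span ((Finset.Icc 0 (l : ℤ)).finite_toSet.image _)

/-- The Jacobian algebra is finite-dimensional. -/
theorem finite_jacAlg : Module.Finite k (JacAlg k l m) := by
  obtain ⟨i, j, n, h1, h2⟩ := exists_span_mul_closed k l m
  generalize hU : (vtxSpan k l m + westSpan k l m) ^ i * (vtxSpan k l m + edgeSpan k l m) ^ j *
    (vtxSpan k l m + eastSpan k l m) ^ n = U at h1 h2
  -- A subspace that contains `1` and is stable under right multiplication by the generators is all
  -- of `J`.
  have htop : U = ⊤ := by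
    rw [eq_top_iff]
    intro z _
    have := mul_mem_of_mul_span_le k l m h2 z 1 (Submodule.one_le.1 h1)
    rwa [one_mul] at this
  refine ⟨?_⟩
  rw [← htop, ← hU]
  exact ((((fg_vtxSpan k l m).sup (fg_westSpan k l m)).pow i).mul
    (((fg_vtxSpan k l m).sup (fg_edgeSpan k l m)).pow j)).mul
    (((fg_vtxSpan k l m).sup (fg_eastSpan k l m)).pow n)

end Finite

end Diamond

/-! ### Injective modules and kernels of general morphisms. -/

namespace Inj

open MulOpposite

variable {k J : Type*} [Field k] [Ring J] [Algebra k J] {e : J}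

/-- An element of `I_e` as a linear form on `Je`. -/
noncomputable def form : Inj k J e ≃ₗ[k] Module.Dual k (Ideal.span {e} : Ideal J) := LinearEquiv.refl k _

theorem form_smul (c : Jᵐᵒᵖ) (φ : Inj k J e) (x : (Ideal.span {e} : Ideal J)) :
    form (c • φ) x = form φ (c.unop • x) := rfl

theorem form_map (e' a : J) (ha : a ∈ (Ideal.span {e} : Ideal J)) (φ : Inj k J e)
    (x : (Ideal.span {e'} : Ideal J)) :
    form (map e' a ha φ) x = form φ ((x : J) • ⟨a, ha⟩) := rfl

@[ext]
theorem ext_form {φ ψ : Inj k J e} (h : ∀ x, form φ x = form ψ x) : φ = ψ :=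
  form.injective (LinearMap.ext h)

/-- The generator of `Je`. -/
def gen (e : J) : (Ideal.span {e} : Ideal J) := ⟨e, Ideal.subset_span rfl⟩

theorem coe_smul_gen {e : J} (he : e * e = e) (x : (Ideal.span {e} : Ideal J)) :
    (x : J) • gen e = x := by
  obtain ⟨x, hx⟩ := x
  obtain ⟨c, rfl⟩ := Ideal.mem_span_singleton'.1 hx
  refine Subtype.ext ?_
  change c * e * e = c * e
  rw [mul_assoc, he]

/-- `φ(y e' z)` is the value at `z` of `e' • (y • φ)`, and `y • φ` stays in `T`. -/
theorem form_eq_zero_of_unsupported {e' : J} {T : Submodule Jᵐᵒᵖ (Inj k J e)}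
    (hT : ∀ φ ∈ T, op e' • φ = 0) {φ : Inj k J e} (hφ : φ ∈ T) (y : J)
    (z : (Ideal.span {e} : Ideal J)) : form φ (y • e' • z) = 0 := by
  have h : form (op e' • op y • φ) z = 0 := by
    rw [hT _ (T.smul_mem (op y) hφ), map_zero, LinearMap.zero_apply]
  exact h

/-- For `x ∈ J e'` one has `(f φ)(x) = (f (x • φ))(e')`. Since `x = x e'`, the form `x • φ` sends
`z` to `φ(x e' z) = 0`. -/
theorem apply_eq_zero_of_form_eq_zero {e' : J} (he' : e' * e' = e')
    (f : Inj k J e →ₗ[Jᵐᵒᵖ] Inj k J e') {φ : Inj k J e}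
    (h : ∀ (y : J) (z : (Ideal.span {e} : Ideal J)), form φ (y • e' • z) = 0) : f φ = 0 := by
  ext x
  have hx : op (x : J) • φ = 0 := by
    ext z
    have : (x : J) * e' = x := congrArg Subtype.val (coe_smul_gen he' x)
    have := h x z
    rw [← mul_smul, ‹(x : J) * e' = x›] at this
    exact this
  have h1 : form (op (x : J) • f φ) (gen e') = 0 := by
    rw [← map_smul f, hx, map_zero, map_zero, LinearMap.zero_apply]
  rw [form_smul, unop_op, coe_smul_gen he'] at h1
  rw [h1, map_zero, LinearMap.zero_apply]

section Generic

/-- The subspace `e' J e` of `Je`. -/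
def corner (k : Type*) [Field k] [Algebra k J] (e e' : J) :
    Submodule k (Ideal.span {e} : Ideal J) :=
  LinearMap.range (Algebra.lsmul k k (Ideal.span {e} : Ideal J) e')

theorem smul_mem_corner (e' : J) (z : (Ideal.span {e} : Ideal J)) : e' • z ∈ corner k e e' :=
  ⟨z, rfl⟩

theorem smul_of_mem_corner {e' : J} (he' : e' * e' = e') {z : (Ideal.span {e} : Ideal J)}
    (hz : z ∈ corner k e e') : e' • z = z := by
  obtain ⟨z, rfl⟩ := hz
  change e' • e' • z = e' • z
  rw [← mul_smul, he']

variable {ι : Type*} [Fintype ι]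

/-- If `f = (f_i) : I_e → I_{e'}ᵈ` is given, where `d = dim e' J e`, and the matrix of the
numbers `f_i(φ_j)(e')` is invertible, where the `φ_j` restrict to a basis of the dual of `e' J e`,
then the kernel of `f` is not supported on `e'`. -/
theorem smul_eq_zero_of_det_ne_zero {e' : J} (he' : e' * e' = e') [DecidableEq ι]
    (b : Module.Basis ι k (corner k e e')) (ψ : ι → Inj k J e)
    (hψ : ∀ j, (form (ψ j)).comp (corner k e e').subtype = b.coord j)
    (f : ι → Inj k J e →ₗ[Jᵐᵒᵖ] Inj k J e')
    (hf : (Matrix.of fun i j => form (f i (ψ j)) (gen e')).det ≠ 0)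
    {φ : Inj k J e} (hφ : ∀ i, f i φ = 0) : op e' • φ = 0 := by
  -- The form `e' • φ` depends only on the restriction of `φ` to `e' J e`, which is expanded in the
  -- dual basis.
  have key : op e' • φ = ∑ j, form φ (b j : (Ideal.span {e} : Ideal J)) • op e' • ψ j := by
    ext z
    rw [map_sum, LinearMap.sum_apply, form_smul, unop_op]
    have h := congrArg (fun w : corner k e e' => form φ (w : (Ideal.span {e} : Ideal J)))
      (b.sum_repr ⟨e' • z, smul_mem_corner e' z⟩)
    simp only [Submodule.coe_sum, Submodule.coe_smul, map_sum, map_smul] at h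
    rw [← h]
    refine Finset.sum_congr rfl fun j _ => ?_
    rw [map_smul, LinearMap.smul_apply, form_smul, unop_op]
    have h2 := LinearMap.congr_fun (hψ j) ⟨e' • z, smul_mem_corner e' z⟩
    rw [smul_eq_mul, smul_eq_mul, mul_comm]
    exact congrArg _ h2.symm
  have hg : ∀ (i : ι) (χ : Inj k J e), form (f i (op e' • χ)) (gen e') =
      form (f i χ) (gen e') := by
    intro i χ
    rw [map_smul, form_smul, unop_op]
    congr 1
    exact coe_smul_gen he' (gen e')
  have hsm : ∀ (i : ι) (c : k) (χ : Inj k J e), f i (c • χ) = c • f i χ := by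
    intro i c χ
    rw [← algebraMap_smul Jᵐᵒᵖ c χ, map_smul, algebraMap_smul]
  -- Applying `f i` to this expansion and evaluating at `e'` shows that the invertible matrix
  -- annihilates the vector of the values `φ(b_j)`.
  have h0 : (fun j => form φ (b j : (Ideal.span {e} : Ideal J))) = 0 := by
    refine Matrix.eq_zero_of_mulVec_eq_zero hf ?_
    funext i
    have h1 : form (f i (op e' • φ)) (gen e') = 0 := by
      rw [hg, hφ, map_zero, LinearMap.zero_apply]
    rw [key, map_sum, map_sum, LinearMap.sum_apply] at h1
    rw [Pi.zero_apply, ← h1, Matrix.mulVec, dotProduct]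
    refine Finset.sum_congr rfl fun j _ => ?_
    rw [hsm, map_smul, LinearMap.smul_apply, hg, Matrix.of_apply, smul_eq_mul, mul_comm]
  rw [key]
  refine Finset.sum_eq_zero fun j _ => ?_
  rw [show form φ (b j : (Ideal.span {e} : Ideal J)) = 0 from congrFun h0 j, zero_smul]

variable [Module.Finite k J]

instance : Module.Finite k (Ideal.span {e} : Ideal J) :=
  Module.Finite.of_injective ((Submodule.subtype (Ideal.span {e} : Ideal J)).restrictScalars k)
    Subtype.val_injective

theorem finrank_corner_le (e' : J) : Module.finrank k (corner k e e') ≤ Module.finrank k J :=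
  (Submodule.finrank_le _).trans (LinearMap.finrank_le_finrank_of_injective
    (f := (Submodule.subtype (Ideal.span {e} : Ideal J)).restrictScalars k) Subtype.val_injective)

/-- For a general morphism `f` from `I_e` to a direct sum of sufficiently many copies of the
`I_{e_n}`, the kernel of `f` is not supported on any of the `e_n`. -/
theorem holdsGenerically_ker_unsupported [DecidableEq ι] (e' : ι → J)
    (he' : ∀ n, e' n * e' n = e' n) (κ : ι → ℕ) (hκ : ∀ n, Module.finrank k J ≤ κ n) :
    HoldsGenerically k fun f : Inj k J e →ₗ[Jᵐᵒᵖ] ((n : ι) → Fin (κ n) → Inj k J (e' n)) =>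
      ∀ n, ∀ φ ∈ LinearMap.ker f, op (e' n) • φ = 0 := by
  classical
  let d : ι → ℕ := fun n => Module.finrank k (corner k e (e' n))
  have hd : ∀ n, d n ≤ κ n := fun n => (finrank_corner_le (e' n)).trans (hκ n)
  let b : (n : ι) → Module.Basis (Fin (d n)) k (corner k e (e' n)) :=
    fun n => Module.finBasis k (corner k e (e' n))
  have hex : ∀ n j, ∃ ψ : Inj k J e,
      (form ψ).comp (corner k e (e' n)).subtype = (b n).coord j := fun n j => by
    obtain ⟨g, hg⟩ := LinearMap.exists_extend ((b n).coord j)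
    exact ⟨form.symm g, hg⟩
  choose ψ hψ using hex
  let N : Type _ := (n : ι) × (Fin (d n) × Fin (d n))
  let E : N ≃ Fin (Fintype.card N) := Fintype.equivFin N
  -- Only the first `d n` of the `κ n` components into `I_{e_n}` are used, which makes the
  -- coordinate matrix for each `n` square.
  let L : (Inj k J e →ₗ[Jᵐᵒᵖ] ((n : ι) → Fin (κ n) → Inj k J (e' n))) →ₗ[k]
      (Fin (Fintype.card N) → k) :=
    { toFun := fun f t => form (f (ψ (E.symm t).1 (E.symm t).2.2) (E.symm t).1
        (Fin.castLE (hd _) (E.symm t).2.1)) (gen (e' (E.symm t).1))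
      map_add' := fun f g => by funext t; rfl
      map_smul' := fun c f => by funext t; rfl }
  have hL : ∀ f n i j, L f (E ⟨n, i, j⟩) =
      form (f (ψ n j) n (Fin.castLE (hd n) i)) (gen (e' n)) := by
    intro f n i j
    have : ∀ s : N, s = ⟨n, i, j⟩ → form (f (ψ s.1 s.2.2) s.1 (Fin.castLE (hd _) s.2.1))
        (gen (e' s.1)) = form (f (ψ n j) n (Fin.castLE (hd n) i)) (gen (e' n)) := by
      rintro _ rfl; rfl
    exact this _ (E.symm_apply_apply _)
  let M : (n : ι) → Matrix (Fin (d n)) (Fin (d n)) (MvPolynomial (Fin (Fintype.card N)) k) :=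
    fun n => Matrix.of fun i j => MvPolynomial.X (E ⟨n, i, j⟩)
  have hM : ∀ (v : Fin (Fintype.card N) → k), MvPolynomial.eval v (∏ n, (M n).det) =
      ∏ n, (Matrix.of fun i j => v (E ⟨n, i, j⟩) : Matrix (Fin (d n)) (Fin (d n)) k).det := by
    intro v
    rw [map_prod]
    refine Finset.prod_congr rfl fun n _ => ?_
    rw [RingHom.map_det]
    congr 1
    ext i j
    simp [M]
  refine ⟨Fintype.card N, L, ∏ n, (M n).det, ?_, ?_, ?_⟩
  -- Prescribed coordinates are realised by right multiplications: the `i`-th component is dual to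
  -- multiplication by `∑ j, w_{ij} b_j ∈ e_n J e`. The unused components are set to zero.
  · intro w
    have ha : ∀ (n : ι) (i : Fin (d n)),
        ((∑ j, w (E ⟨n, i, j⟩) • b n j : corner k e (e' n)) : (Ideal.span {e} : Ideal J)).1 ∈
          (Ideal.span {e} : Ideal J) := fun n i => Subtype.prop _
    refine ⟨LinearMap.pi fun n => LinearMap.pi fun i =>
      if hi : i.1 < d n then Inj.map (e' n) _ (ha n ⟨i, hi⟩) else 0, ?_⟩
    funext t
    obtain ⟨⟨n, i, j⟩, rfl⟩ := E.surjective t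
    rw [hL]
    simp only [LinearMap.pi_apply, Fin.val_castLE, Fin.is_lt, dif_pos, Fin.eta]
    rw [form_map]
    have h1 := LinearMap.congr_fun (hψ n j) (∑ j, w (E ⟨n, i, j⟩) • b n j)
    have h2 : (gen (e' n) : J) • ((∑ j, w (E ⟨n, i, j⟩) • b n j : corner k e (e' n)) :
        (Ideal.span {e} : Ideal J)) = _ := smul_of_mem_corner (he' n) (Subtype.prop _)
    refine (congrArg (form (ψ n j)) h2).trans (h1.trans ?_)
    simp [Finsupp.single_apply]
  -- At the identity matrices the product of the determinants is `1`, so the polynomial is not zero.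
  · intro h0
    have := hM (fun t => if (E.symm t).2.1 = (E.symm t).2.2 then 1 else 0)
    rw [h0, map_zero] at this
    refine zero_ne_one (this.trans (Finset.prod_eq_one fun n _ => ?_))
    convert Matrix.det_one (R := k) (n := Fin (d n)) using 2
    ext i j
    rw [Matrix.of_apply, Equiv.symm_apply_apply, Matrix.one_apply]
  · intro f hf n φ hφ
    rw [hM, Finset.prod_ne_zero_iff] at hf
    have hn := hf n (Finset.mem_univ n)
    simp only [hL] at hn
    refine smul_eq_zero_of_det_ne_zero (he' n) (b n) (ψ n) (hψ n)
      (fun i => (LinearMap.proj (Fin.castLE (hd n) i)).comp ((LinearMap.proj n).comp f)) hn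
      fun i => ?_
    have := LinearMap.mem_ker.1 hφ
    exact congrFun (congrFun this n) _

end Generic

end Inj

namespace Diamond

open FQuiver

/-! ### Arrows that end at a vertex of the path -/

section Steps

variable (k : Type*) [Field k] (l m : ℕ)

/-- The product of a list of arrows. -/
noncomputable def arwProd (L : List RawArrow) : JacAlg k l m := (L.map (arw k l m)).prod

theorem arwProd_nil : arwProd k l m [] = 1 := rfl

theorem arwProd_cons (a : RawArrow) (L : List RawArrow) :
    arwProd k l m (a :: L) = arw k l m a * arwProd k l m L := List.prod_cons

theorem arwProd_append (L M : List RawArrow) :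
    arwProd k l m (L ++ M) = arwProd k l m L * arwProd k l m M := by
  rw [arwProd, List.map_append, List.prod_append]; rfl

/-- Every step of the left ideal `K` that ends at a source of the suffix of a path, other than the
preceding arrow of the path, is zero modulo `K`; here `s` is the product of the rest of the path. -/
def Steps (K : Ideal (JacAlg k l m)) (s : JacAlg k l m) : List RawArrow → Prop
  | [] => True
  | a :: L => (∀ c ∈ arrowSet l m, c ≠ a → arw k l m c * (arwProd k l m L * s) ∈ K) ∧
      Steps K s L

variable {k l m} {K : Ideal (JacAlg k l m)}

theorem Steps.append {s : JacAlg k l m} {L M : List RawArrow}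
    (h1 : Steps k l m K (arwProd k l m M * s) L) (h2 : Steps k l m K s M) :
    Steps k l m K s (L ++ M) := by
  induction L with
  | nil => exact h2
  | cons a L ih =>
    refine ⟨?_, ih h1.2⟩
    have := h1.1
    rwa [← mul_assoc, ← arwProd_append] at this

theorem Steps.getElem {s : JacAlg k l m} {L : List RawArrow} (h : Steps k l m K s L) {i : ℕ}
    (hi : i < L.length) {c : RawArrow} (hc : c ∈ arrowSet l m) (hne : c ≠ L[i]) :
    arw k l m c * (arwProd k l m (L.drop (i + 1)) * s) ∈ K := by
  induction L generalizing i with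
  | nil => simp at hi
  | cons a L ih =>
    cases i with
    | zero => simpa using h.1 c hc (by simpa using hne)
    | succ i => simpa using ih h.2 (by simpa using hi) (by simpa using hne)

variable (k l m)

theorem westRaw_of_ne {τ : ℤˣ} {n : ℕ} {x y : ℤ} (h : τ * y ≠ -x) :
    westRaw l τ n x y = (westDir τ, n, x, y) := if_neg h

theorem exists_westRaw {c : RawArrow} (hc : c ∈ arrowSet l m) (hd : c.1 ≠ Dir.east)
    (hF : c ≠ (Dir.sw, 2, (l : ℤ), (l : ℤ))) : ∃ τ n x y, IsPoint l m n x y ∧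
      IsPoint l m n (x - 1) (y + (τ : ℤˣ)) ∧ c = westRaw l τ n x y := by
  obtain ⟨d, n, x, y⟩ := c
  obtain ⟨τ, rfl⟩ := exists_west hd
  rcases arrow_cases hc with ⟨h1, h2, h3⟩ | ⟨-, -, h⟩
  swap
  · exact absurd h hF
  simp only [westDir_dx, westDir_dy] at h1 h2 h3
  refine ⟨τ, n, x, y, h1, h2, ?_⟩
  by_cases e : τ * y = -x
  · have hE : OnLeftEdge (westDir τ, n, x, y) := by
      unfold OnLeftEdge
      simp only [westDir_dx, westDir_dy]
      rcases Int.units_eq_one_or τ with rfl | rfl <;> simp at e ⊢ <;> omega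
    obtain ⟨rfl, h4⟩ := h3 hE
    rw [westRaw_two_edge e, h4]
    rw [← westDir_neg_one, westDir_inj] at h4
    subst h4
    simp at e
    rw [e]
  · rw [westRaw_of_ne l e]

variable {k l m}

/-- It suffices to check the arrows inside the diamonds. -/
theorem forall_arw_mul_mem {M : Ideal (JacAlg k l m)}
    (hF : ∀ s ∈ M, vtx k l m (2, (l : ℤ), (l : ℤ)) * s ∈ K)
    {v : ℕ × ℤ × ℤ} {s : JacAlg k l m} (hs : s ∈ M) (hv : vtx k l m v * s = s) (a : RawArrow)
    (hE : ∀ n x y, (Dir.east, n, x, y) ≠ a → (n, x + 2, y) = v → eastArw k l m n x y * s ∈ K)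
    (hW : ∀ (τ : ℤˣ) n x y, IsPoint l m n x y → IsPoint l m n (x - 1) (y + τ) →
      glue l n (x - 1) (y + τ) = v → westRaw l τ n x y ≠ a → westArw k l m τ n x y * s ∈ K)
    (c : RawArrow) (hc : c ∈ arrowSet l m) (hca : c ≠ a) : arw k l m c * s ∈ K := by
  by_cases ht : rawTgt l c = v
  swap
  · rw [← hv, ← mul_assoc, arw_mul_vtx, if_neg ht, zero_mul]
    exact zero_mem _
  by_cases hd : c.1 = Dir.east
  · obtain ⟨d, n, x, y⟩ := c
    obtain rfl : d = Dir.east := hd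
    exact hE n x y hca (by rw [← ht, rawTgt_of_east hc])
  -- The arrow out of the frozen vertex `1` is no step between points of a diamond. It is covered by
  -- `hF`, since everything in `M` that starts at this vertex lies in `K`.
  by_cases hF' : c = (Dir.sw, 2, (l : ℤ), (l : ℤ))
  · have h := hF _ (M.mul_mem_left (arw k l m c) hs)
    rw [← mul_assoc, vtx_mul_arw, if_pos] at h
    · exact h
    · rw [rawSrc_of_ne_east hc hd, hF']
  · obtain ⟨τ, n, x, y, h1, h2, rfl⟩ := exists_westRaw l m hc hd hF'
    rw [rawTgt_westRaw h1 h2] at ht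
    rw [← westArw_of_isPoint k l m h1 h2]
    exact hW τ n x y h1 h2 ht hca

/-- A point off all edges is not glued to any other. Apart from a possible arrow out of the frozen
vertex `1`, only three steps end there, one in each direction. -/
theorem forall_arw_mul_mem_interior {M : Ideal (JacAlg k l m)}
    (hF : ∀ s ∈ M, vtx k l m (2, (l : ℤ), (l : ℤ)) * s ∈ K)
    {N : ℕ} {X Y : ℤ} (δ : ℤˣ) (h1 : -X < Y) (h2 : Y < X) (h3 : X + Y < 2 * l) (h4 : X - Y < 2 * l)
    {s : JacAlg k l m} (hs : s ∈ M) (hv : vtx k l m (N, X, Y) * s = s) (a : RawArrow)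
    (hE : (Dir.east, N, X - 2, Y) ≠ a → eastArw k l m N (X - 2) Y * s ∈ K)
    (hW : westRaw l δ N (X + 1) (Y - δ) ≠ a → westArw k l m δ N (X + 1) (Y - δ) * s ∈ K)
    (hW' : westRaw l (-δ) N (X + 1) (Y + δ) ≠ a → westArw k l m (-δ) N (X + 1) (Y + δ) * s ∈ K)
    (c : RawArrow) (hc : c ∈ arrowSet l m) (hca : c ≠ a) : arw k l m c * s ∈ K := by
  refine forall_arw_mul_mem hF hs hv a ?_ ?_ c hc hca
  · intro n x y hne he
    simp only [Prod.mk.injEq] at he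
    obtain ⟨rfl, rfl, rfl⟩ := he
    rw [add_sub_cancel_right] at hE
    exact hE hne
  · intro τ n x y hp hq he hne
    have he' : n = N ∧ x - 1 = X ∧ y + τ = Y := by
      rcases glue_cases hq with h | h | h | h
      · rw [h.2.2] at he
        simpa only [Prod.mk.injEq] using he
      all_goals
        rw [h.2.2] at he
        simp only [Prod.mk.injEq] at he
        omega
    obtain ⟨rfl, rfl, rfl⟩ := he'
    rw [sub_add_cancel] at hW hW'
    have hτ : τ = δ ∨ τ = -δ := by
      rcases Int.units_eq_one_or τ with rfl | rfl <;>
        rcases Int.units_eq_one_or δ with rfl | rfl <;> simp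
    rcases hτ with rfl | rfl
    · rw [add_sub_cancel_right] at hW
      exact hW hne
    · rw [Units.val_neg, neg_add_cancel_right] at hW'
      exact hW' hne

/-- In the diamond `N` an east step and a step along the edge end here. The diamond `N + 1` adds one
step from its interior, while its edge step is the one already counted. The arrow `a` may be the
east step or the interior step of `N + 1`: these are the arrows by which the two parts of `p_v`
arrive. -/
theorem forall_arw_mul_mem_right {M : Ideal (JacAlg k l m)}
    (hF : ∀ s ∈ M, vtx k l m (2, (l : ℤ), (l : ℤ)) * s ∈ K)
    {N : ℕ} {H : ℤ} (δ : ℤˣ) (hN : 2 ≤ N) (h1 : 1 ≤ H) (h2 : H < l)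
    {s : JacAlg k l m} (hs : s ∈ M) (hv : vtx k l m (N, 2 * l - H, δ * H) * s = s) (a : RawArrow)
    (hE : (Dir.east, N, 2 * (l : ℤ) - H - 2, δ * H) ≠ a →
      eastArw k l m N (2 * l - H - 2) (δ * H) * s ∈ K)
    (hW : westArw k l m δ N (2 * l - H + 1) (δ * (H - 1)) * s ∈ K)
    (hW' : westRaw l δ (N + 1) (l - H + 1) (δ * (l - H - 1)) ≠ a →
      westArw k l m δ (N + 1) (l - H + 1) (δ * (l - H - 1)) * s ∈ K)
    (c : RawArrow) (hc : c ∈ arrowSet l m) (hca : c ≠ a) : arw k l m c * s ∈ K := by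
  refine forall_arw_mul_mem hF hs hv a ?_ ?_ c hc hca
  · intro n x y hne he
    simp only [Prod.mk.injEq] at he
    obtain ⟨rfl, hx, rfl⟩ := he
    rw [← hx, add_sub_cancel_right] at hE
    exact hE hne
  · intro τ n x y hp hq he hne
    have hτ : τ = δ ∨ τ = -δ := by
      rcases Int.units_eq_one_or τ with rfl | rfl <;>
        rcases Int.units_eq_one_or δ with rfl | rfl <;> simp
    have he' : (n = N ∧ x = 2 * l - H + 1 ∧ y + τ = δ * H) ∨
        (n = N + 1 ∧ x = l - H + 1 ∧ y + τ = δ * (l - H)) := by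
      rcases glue_cases hq with h | h | h | h
      · rw [h.2.2] at he
        simp only [Prod.mk.injEq] at he
        left
        omega
      all_goals
        rw [h.2.2] at he
        simp only [Prod.mk.injEq] at he
        rcases Int.units_eq_one_or δ with rfl | rfl <;> simp at he ⊢ <;> omega
    rcases he' with ⟨rfl, rfl, hy⟩ | ⟨rfl, rfl, hy⟩
    · rcases hτ with rfl | rfl
      · obtain rfl : y = τ * (H - 1) := by linear_combination hy
        exact hW
      · exfalso
        unfold IsPoint at hp
        rcases Int.units_eq_one_or δ with rfl | rfl <;> simp at hy <;> omega
    · rcases hτ with rfl | rfl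
      · obtain rfl : y = τ * (l - H - 1) := by linear_combination hy
        exact hW' hne
      · obtain rfl : y = δ * (l - H + 1) := by
          rw [Units.val_neg] at hy
          linear_combination hy
        have hm : N < m := by have := hp.2.1; omega
        -- For `H = 1` the step would start at the removed corner `(l, ± l)` of the diamond `N + 1`.
        have hH : H ≠ 1 := by
          rintro rfl
          unfold IsPoint at hp
          rcases Int.units_eq_one_or δ with rfl | rfl <;> simp at hp
        have := westArw_right k l m (τ := δ) (n := N) (x := 2 * l - H + 1) (y := δ * (H - 1)) hN hm
          (by rw [units_mul_self_mul]; ring) (by omega)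
        rw [show 2 * (l : ℤ) - H + 1 - l = l - H + 1 by ring] at this
        rw [← this]
        exact hW

/-- No east arrow ends on a left edge. What remains is one step from the interior of each half and
the edge step that the two halves share. -/
theorem forall_arw_mul_mem_left {M : Ideal (JacAlg k l m)}
    (hF : ∀ s ∈ M, vtx k l m (2, (l : ℤ), (l : ℤ)) * s ∈ K)
    {X : ℤ} (δ : ℤˣ) {s : JacAlg k l m} (hs : s ∈ M) (hv : vtx k l m (2, X, X) * s = s)
    (a : RawArrow)
    (hW : westRaw l (-δ) 2 (X + 1) (-δ * (X - 1)) ≠ a →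
      westArw k l m (-δ) 2 (X + 1) (-δ * (X - 1)) * s ∈ K)
    (hW1 : westArw k l m δ 2 (X + 1) (δ * (X - 1)) * s ∈ K)
    (hW2 : westArw k l m (-δ) 2 (X + 1) (δ * (X + 1)) * s ∈ K)
    (c : RawArrow) (hc : c ∈ arrowSet l m) (hca : c ≠ a) : arw k l m c * s ∈ K := by
  refine forall_arw_mul_mem hF hs hv a ?_ ?_ c hc hca
  · intro n x y hne he
    simp only [Prod.mk.injEq] at he
    obtain ⟨rfl, hx, rfl⟩ := he
    rw [eastArw_of_not_src, zero_mul]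
    · exact zero_mem _
    · unfold IsPoint
      omega
  · intro τ n x y hp hq he hne
    have he' : n = 2 ∧ x = X + 1 ∧ (y + τ = δ * X ∨ y + τ = -δ * X) := by
      rcases glue_cases hq with ⟨h1, h2, h3⟩ | ⟨h1, h2, h3⟩ | ⟨h1, h2, h3⟩ | ⟨h1, h2, h3⟩ <;>
        rw [h3] at he <;> simp only [Prod.mk.injEq] at he
      · omega
      · refine ⟨h1, by omega, ?_⟩
        rcases Int.units_eq_one_or δ with rfl | rfl <;>
          simp only [Units.val_one, Units.val_neg, one_mul, neg_mul, neg_neg] <;> omega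
      · unfold IsPoint at hq
        omega
      · unfold IsPoint at hq
        omega
    obtain ⟨rfl, rfl, hy⟩ := he'
    have hτ : τ = δ ∨ τ = -δ := by
      rcases Int.units_eq_one_or τ with rfl | rfl <;>
        rcases Int.units_eq_one_or δ with rfl | rfl <;> simp
    rcases hτ with rfl | rfl
    · rcases hy with hy | hy
      · obtain rfl : y = τ * (X - 1) := by linear_combination hy
        exact hW1
      · obtain rfl : y = -τ * (X + 1) := by linear_combination hy
        rw [← westArw_two_left]
        exact hW2
    · rw [Units.val_neg] at hy
      rcases hy with hy | hy
      · obtain rfl : y = δ * (X + 1) := by linear_combination hy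
        exact hW2
      · obtain rfl : y = -δ * (X - 1) := by linear_combination hy
        exact hW hne

end Steps

end Diamond

/-! ### Steps to a horizontal row of one diamond. -/

namespace Diamond

open FQuiver

section Rows

variable {k : Type*} [Field k] {l m : ℕ} {K M : Ideal (JacAlg k l m)}

theorem westArw_congr {τ : ℤˣ} {n : ℕ} {x y x' y' : ℤ} (hx : x = x') (hy : y = y') :
    westArw k l m τ n x y = westArw k l m τ n x' y' := by rw [hx, hy]

theorem eastArw_congr {n : ℕ} {x y x' y' : ℤ} (hx : x = x') (hy : y = y') :
    eastArw k l m n x y = eastArw k l m n x' y' := by rw [hx, hy]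

theorem line_congr {d : Dir} {n r : ℕ} {x y x' y' : ℤ} (hx : x = x') (hy : y = y') :
    line d n x y r = line d n x' y' r := by rw [hx, hy]

theorem neg_units_mul_self_mul (σ : ℤˣ) (x : ℤ) : ((-σ : ℤˣ) : ℤ) * (σ * x) = -x := by
  rw [Units.val_neg, neg_mul, units_mul_self_mul]

/-- The product of the last `i` arrows of the row at height `H` of the diamond `n`, and `s`. -/
noncomputable def rowProd (n : ℕ) (H : ℤ) (δ : ℤˣ) (s : JacAlg k l m) (i : ℕ) : JacAlg k l m :=
  arwProd k l m (line Dir.east n (2 * l - H - 2 * i) (δ * H) i) * s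

theorem line_row_succ (n : ℕ) (H : ℤ) (δ : ℤˣ) (i : ℕ) :
    line Dir.east n (2 * l - H - 2 * ((i + 1 : ℕ) : ℤ)) (δ * H) (i + 1) =
      (Dir.east, n, 2 * (l : ℤ) - H - 2 * i - 2, δ * H) ::
        line Dir.east n (2 * l - H - 2 * i) (δ * H) i := by
  rw [line]
  congr 1
  · simp only [Prod.mk.injEq, true_and, and_true]
    push_cast
    ring
  · refine line_congr ?_ ?_
    · simp only [Dir.dx]
      push_cast
      ring
    · simp [Dir.dy]

theorem rowProd_zero (n : ℕ) (H : ℤ) (δ : ℤˣ) (s : JacAlg k l m) : rowProd n H δ s 0 = s :=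
  one_mul s

theorem rowProd_succ (n : ℕ) (H : ℤ) (δ : ℤˣ) (s : JacAlg k l m) (i : ℕ) :
    rowProd n H δ s (i + 1) =
      eastArw k l m n (2 * l - H - 2 * i - 2) (δ * H) * rowProd n H δ s i := by
  rw [rowProd, line_row_succ, arwProd_cons, mul_assoc]
  rfl

theorem rowProd_mem {n : ℕ} {H : ℤ} {δ : ℤˣ} {s : JacAlg k l m} (hs : s ∈ M) (i : ℕ) :
    rowProd n H δ s i ∈ M := M.mul_mem_left _ hs

theorem vtx_mul_rowProd {n : ℕ} {H : ℤ} {δ : ℤˣ} {s : JacAlg k l m}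
    (hv : vtx k l m (glue l n (2 * l - H) (δ * H)) * s = s) (i : ℕ) :
    vtx k l m (glue l n (2 * l - H - 2 * i) (δ * H)) * rowProd n H δ s i = rowProd n H δ s i := by
  cases i with
  | zero => simpa [rowProd_zero] using hv
  | succ i =>
    rw [rowProd_succ, ← mul_assoc, vtx_mul_eastArw, if_pos]
    congr 1
    push_cast
    ring

/-- Steps in the directions `(-1, ± 1)` to the row at height `H` of the diamond `n`. -/
theorem westArw_mul_rowProd_mem {n : ℕ} {H : ℤ} {δ : ℤˣ} {s : JacAlg k l m} (hn : 2 ≤ n)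
    (h1 : 1 ≤ H)
    (hC : westArw k l m δ n (2 * l - H + 1) (δ * (H - 1)) * s ∈ K)
    (hC' : westArw k l m δ (n + 1) (l - H + 1) (δ * (l - H - 1)) * s ∈ K)
    {i : ℕ} (hi : (i : ℤ) ≤ l - H) :
    westArw k l m δ n (2 * l - H - 2 * i + 1) (δ * (H - 1)) * rowProd n H δ s i ∈ K ∧
      westArw k l m (-δ) n (2 * l - H - 2 * i + 1) (δ * (H + 1)) * rowProd n H δ s i ∈ K := by
  induction i with
  | zero =>
    rw [rowProd_zero]
    refine ⟨by simpa using hC, ?_⟩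
    -- At the right end of the row a step in direction `(-1, -δ)` would start outside the diamond.
    rw [westArw_of_not_src, zero_mul]
    · exact zero_mem _
    · unfold IsPoint
      rcases Int.units_eq_one_or δ with rfl | rfl <;> simp <;> omega
  | succ i ih =>
    obtain ⟨ha, hb⟩ := ih (by omega)
    have hx : 2 * (l : ℤ) - H - 2 * ((i + 1 : ℕ) : ℤ) + 1 = 2 * l - H - 2 * i - 1 := by
      push_cast; ring
    rw [hx, rowProd_succ]
    -- Commuting the step with the first east arrow of the row moves it one place to the right,
    -- where the induction hypothesis applies.
    constructor
    · have h := westArw_mul_eastArw k l m (τ := δ) (n := n) (x := 2 * l - H - 2 * i - 1)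
        (y := δ * (H - 1)) (by rw [units_mul_self_mul]; omega)
        (by rw [units_mul_self_mul]; omega)
      rw [eastArw_congr (k := k) (m := m) (x' := 2 * l - H - 2 * i - 2) (y' := δ * H) (by ring) (by ring),
        westArw_congr (k := k) (m := m) (x := 2 * l - H - 2 * i - 1 + 2)
          (x' := 2 * l - H - 2 * i + 1) (by ring) rfl] at h
      rw [← mul_assoc, h, mul_assoc]
      exact K.mul_mem_left _ ha
    -- One place before the right end, the step in direction `(-1, -δ)` starts on the right edge.
    -- The relation of the edge then continues in the next diamond, where `hC'` takes over.
    · by_cases h0 : i = 0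
      · subst h0
        have h := westArw_mul_eastArw_right k l m (τ := -δ) (n := n) (x := 2 * l - H - 1)
          (y := δ * (H + 1)) hn (by rw [neg_units_mul_self_mul]; ring)
        rw [eastArw_congr (k := k) (m := m) (x' := 2 * l - H - 2) (y' := δ * H) (by ring)
            (by rw [Units.val_neg]; ring),
          neg_neg, Units.val_neg, neg_neg,
          westArw_congr (k := k) (m := m) (x := 2 * l - H - 1 - l + 2) (x' := l - H + 1)
            (y' := δ * (l - H - 1)) (by ring) (by ring)] at h
        rw [rowProd_zero, Nat.cast_zero, mul_zero, sub_zero, ← mul_assoc, h, mul_assoc]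
        exact K.mul_mem_left _ hC'
      · have h := westArw_mul_eastArw k l m (τ := -δ) (n := n) (x := 2 * l - H - 2 * i - 1)
          (y := δ * (H + 1)) (by rw [neg_units_mul_self_mul]; omega)
          (by rw [neg_units_mul_self_mul]; omega)
        rw [eastArw_congr (k := k) (m := m) (x' := 2 * l - H - 2 * i - 2) (y' := δ * H) (by ring)
            (by rw [Units.val_neg]; ring),
          westArw_congr (k := k) (m := m) (x := 2 * l - H - 2 * i - 1 + 2)
            (x' := 2 * l - H - 2 * i + 1) (by ring) rfl] at h
        rw [← mul_assoc, h, mul_assoc]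
        exact K.mul_mem_left _ hb

/-- Only the targets of the arrows of the row are concerned. Its left end is left to the
continuation: the row of the preceding diamond or, in the diamond `2`, the diagonal. -/
theorem steps_row {n : ℕ} {H : ℤ} {δ : ℤˣ} {s : JacAlg k l m}
    (hF : ∀ s ∈ M, vtx k l m (2, (l : ℤ), (l : ℤ)) * s ∈ K) (hs : s ∈ M) (hn : 2 ≤ n)
    (h1 : 1 ≤ H) (h2 : H < l) (hv : vtx k l m (glue l n (2 * l - H) (δ * H)) * s = s)
    (hC : westArw k l m δ n (2 * l - H + 1) (δ * (H - 1)) * s ∈ K)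
    (hC' : westArw k l m δ (n + 1) (l - H + 1) (δ * (l - H - 1)) * s ∈ K)
    {i : ℕ} (hi : (i : ℤ) ≤ l - H) :
    Steps k l m K s (line Dir.east n (2 * l - H - 2 * i) (δ * H) i) := by
  induction i with
  | zero => trivial
  | succ i ih =>
    rw [line_row_succ]
    refine ⟨?_, ih (by omega)⟩
    have hv' := vtx_mul_rowProd hv i
    change ∀ c ∈ arrowSet l m, _ → arw k l m c * rowProd n H δ s i ∈ K
    rw [glue_of_lt (by rcases Int.units_eq_one_or δ with rfl | rfl <;> simp <;> omega)
      (by rcases Int.units_eq_one_or δ with rfl | rfl <;> simp <;> omega)] at hv'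
    by_cases h0 : i = 0
    · subst h0
      rw [rowProd_zero, Nat.cast_zero, mul_zero, sub_zero] at *
      exact forall_arw_mul_mem_right hF δ hn h1 h2 hs hv' _ (fun h => absurd rfl h) hC
        (fun _ => hC')
    · obtain ⟨ha, hb⟩ := westArw_mul_rowProd_mem hn h1 hC hC' (i := i) (by omega)
      refine forall_arw_mul_mem_interior hF δ ?_ ?_ ?_ ?_ (rowProd_mem hs i) hv' _
        (fun h => absurd rfl h) (fun _ => ?_) (fun _ => ?_)
      any_goals rcases Int.units_eq_one_or δ with rfl | rfl <;> simp <;> omega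
      · rwa [westArw_congr rfl (show (δ : ℤ) * H - δ = δ * (H - 1) by ring)]
      · rwa [westArw_congr rfl (show (δ : ℤ) * H + δ = δ * (H + 1) by ring)]

end Rows

end Diamond

/-! ### The second part of the path, from the last diamond back to the diamond `2`. -/

namespace Diamond

open FQuiver

section SecondPart

variable {k : Type*} [Field k] {l m : ℕ} {K M : Ideal (JacAlg k l m)}

theorem line_row_eq {n h : ℕ} (h2 : h < l) (δ : ℤˣ) :
    line Dir.east n h (δ * h) (l - h) =
      line Dir.east n (2 * l - h - 2 * ((l - h : ℕ) : ℤ)) (δ * h) (l - h) := by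
  refine line_congr ?_ rfl
  rw [Nat.cast_sub h2.le]
  ring

/-- Steps in the directions `(-1, ± 1)` to the left end of a row. -/
theorem westArw_mul_row_mem {n h : ℕ} {δ : ℤˣ} {s : JacAlg k l m} (hn : 2 ≤ n)
    (h1 : 1 ≤ h) (h2 : h < l)
    (hC : westArw k l m δ n (2 * l - h + 1) (δ * (h - 1)) * s ∈ K)
    (hC' : westArw k l m δ (n + 1) (l - h + 1) (δ * (l - h - 1)) * s ∈ K) :
    westArw k l m δ n (h + 1) (δ * (h - 1)) *
        (arwProd k l m (line Dir.east n h (δ * h) (l - h)) * s) ∈ K ∧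
      westArw k l m (-δ) n (h + 1) (δ * (h + 1)) *
        (arwProd k l m (line Dir.east n h (δ * h) (l - h)) * s) ∈ K := by
  have := westArw_mul_rowProd_mem hn (by exact_mod_cast h1) hC hC' (i := l - h)
    (by rw [Nat.cast_sub h2.le])
  have e : 2 * (l : ℤ) - h - 2 * ((l - h : ℕ) : ℤ) + 1 = h + 1 := by
    rw [Nat.cast_sub h2.le]
    ring
  rw [e, rowProd, ← line_row_eq h2] at this
  exact this

theorem vtx_mul_row {n h : ℕ} {δ : ℤˣ} {s : JacAlg k l m} (h2 : h < l)
    (hv : vtx k l m (glue l n (2 * l - h) (δ * h)) * s = s) :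
    vtx k l m (glue l n h (δ * h)) *
        (arwProd k l m (line Dir.east n h (δ * h) (l - h)) * s) =
      arwProd k l m (line Dir.east n h (δ * h) (l - h)) * s := by
  have := vtx_mul_rowProd hv (l - h)
  have e : 2 * (l : ℤ) - h - 2 * ((l - h : ℕ) : ℤ) = h := by
    rw [Nat.cast_sub h2.le]
    ring
  rw [e, rowProd, ← line_row_eq h2] at this
  exact this

/-- The left end of the row at height `h` is glued to the right edge vertex at height `l - h` of the
preceding diamond. The two steps known to vanish at the left end become the hypotheses `hC'` and
`hC` for the row there, so the argument repeats diamond by diamond. -/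
theorem steps_secondPart
    (hF : ∀ s ∈ M, vtx k l m (2, (l : ℤ), (l : ℤ)) * s ∈ K)
    (hF' : ∀ n, 2 ≤ n → n ≤ m → ∀ s ∈ M, vtx k l m (n, 2 * (l : ℤ), 0) * s ∈ K)
    {j : ℕ} (h1 : 1 ≤ j) (h2 : j < l) (ε : ℤˣ) (r : ℕ) (hr : r + 2 ≤ m) (h : ℕ)
    (hh : rowHeight l j (r + 2) = h) (s : JacAlg k l m)
    (hs : s ∈ M) (hv : vtx k l m (glue l (r + 2) (2 * l - h) (ε * h)) * s = s)
    (hC : westArw k l m ε (r + 2) (2 * l - h + 1) (ε * (h - 1)) * s ∈ K)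
    (hC' : westArw k l m ε (r + 3) (l - h + 1) (ε * (l - h - 1)) * s ∈ K) :
    Steps k l m K s (secondPart l j ε (r + 1)) ∧
      vtx k l m (2, (j : ℤ), (j : ℤ)) * (arwProd k l m (secondPart l j ε (r + 1)) * s) =
        arwProd k l m (secondPart l j ε (r + 1)) * s ∧
      westArw k l m ε 2 (j + 1) (ε * (j - 1)) *
        (arwProd k l m (secondPart l j ε (r + 1)) * s) ∈ K ∧
      westArw k l m (-ε) 2 (j + 1) (ε * (j + 1)) *
        (arwProd k l m (secondPart l j ε (r + 1)) * s) ∈ K := by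
  have hb : 1 ≤ h ∧ h < l := hh ▸ rowHeight_bounds h1 h2 (r + 2)
  have hsteps := steps_row hF hs (by omega) (by exact_mod_cast hb.1) (by exact_mod_cast hb.2) hv hC
    hC' (i := l - h) (by rw [Nat.cast_sub hb.2.le])
  rw [← line_row_eq hb.2] at hsteps
  obtain ⟨ha, hb'⟩ := westArw_mul_row_mem (by omega) hb.1 hb.2 hC hC'
  have hv' := vtx_mul_row hb.2 hv
  have hM : arwProd k l m (line Dir.east (r + 2) h (ε * h) (l - h)) * s ∈ M := M.mul_mem_left _ hs
  induction r generalizing s h with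
  | zero =>
    have e : h = j := by rw [← hh]; simp [rowHeight]
    subst e
    have : secondPart l h ε (0 + 1) = line Dir.east 2 h (ε * h) (l - h) := by
      simp [secondPart, hh]
    rw [this]
    rw [glue_two_edge] at hv'
    exact ⟨hsteps, hv', ha, hb'⟩
  | succ r ih =>
    have hh' : rowHeight l j (r + 2) = l - h := by
      have := rowHeight_succ h2.le (r + 2)
      rw [hh] at this
      have := (rowHeight_bounds h1 h2 (r + 2)).2
      omega
    have hc : ((l - h : ℕ) : ℤ) = l - h := Nat.cast_sub hb.2.le
    have hsec : secondPart l j ε (r + 1 + 1) =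
        secondPart l j ε (r + 1) ++ line Dir.east (r + 3) h (ε * h) (l - h) := by
      rw [secondPart, hh]
    generalize ht : arwProd k l m (line Dir.east (r + 3) h (ε * h) (l - h)) * s = t at *
    have hvt : vtx k l m (glue l (r + 2) (2 * l - (l - h : ℕ)) (ε * (l - h : ℕ))) * t = t := by
      rw [glue_left hb.1 hb.2] at hv'
      rw [hc, show 2 * (l : ℤ) - (l - h) = l + h by ring]
      exact hv'
    have hCt : westArw k l m ε (r + 2) (2 * l - (l - h : ℕ) + 1) (ε * ((l - h : ℕ) - 1)) * t ∈ K := by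
      rw [hc, show 2 * (l : ℤ) - (l - h) + 1 = l + h + 1 by ring]
      -- If `h + 1 = l`, the edge step starts at the right corner of the diamond `r + 2`, a frozen
      -- vertex at which `K` contains all of `M`. Otherwise it is glued to the edge step at the left
      -- end of the row.
      by_cases hl : h + 1 = l
      · have e : (ε : ℤ) * (l - h - 1) = 0 := by
          rw [← hl]; push_cast; ring
        have := hF' (r + 2) (by omega) (by omega) _
          (M.mul_mem_left (westArw k l m ε (r + 2) (l + h + 1) (ε * (l - h - 1))) hM)
        rw [← mul_assoc, vtx_mul_westArw, if_pos] at this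
        · exact this
        · rw [e, glue_of_lt (by omega) (by omega), ← hl]
          simp only [Prod.mk.injEq, true_and, and_true]
          push_cast
          ring
      · rw [westArw_right k l m (by omega) (by omega) (by rw [units_mul_self_mul]; ring)
          (by omega), westArw_congr (x' := h + 1) (y' := ε * (h + 1)) (by ring) (by ring)]
        exact hb'
    have hCt' : westArw k l m ε (r + 3) (l - (l - h : ℕ) + 1) (ε * (l - (l - h : ℕ) - 1)) * t ∈ K := by
      rw [hc, westArw_congr (x' := h + 1) (y' := ε * (h - 1)) (by ring) (by ring)]
      exact ha
    have hbl : 1 ≤ l - h ∧ l - h < l := by omega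
    have hst := steps_row hF hM (n := r + 2) (by omega) (by exact_mod_cast hbl.1)
      (by exact_mod_cast hbl.2) hvt hCt hCt' (i := l - (l - h)) (by rw [Nat.cast_sub hbl.2.le])
    rw [← line_row_eq hbl.2] at hst
    obtain ⟨hat, hbt⟩ := westArw_mul_row_mem (n := r + 2) (by omega) hbl.1 hbl.2 hCt hCt'
    obtain ⟨i1, i2, i3, i4⟩ := ih (by omega) (l - h) hh' t hM hvt hCt hCt' hbl hst hat hbt
      (vtx_mul_row hbl.2 hvt) (M.mul_mem_left _ hM)
    rw [hsec, arwProd_append, mul_assoc, ht]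
    refine ⟨Steps.append ?_ hsteps, i2, i3, i4⟩
    rw [ht]
    exact i1

end SecondPart

end Diamond

/-! ### The first part of the path: diagonals through the diamonds. -/

namespace Diamond

open FQuiver

section FirstPart

variable {k : Type*} [Field k] {l m : ℕ} {K M : Ideal (JacAlg k l m)}

/-- The properties of the product `s` of the arrows of a path from the left edge vertex
`(j, σ j)` of the diamond `n`, when the path enters this vertex in the direction `(-1, σ)`. -/
structure IsDiagonalEnd (K : Ideal (JacAlg k l m)) (j n : ℕ) (σ : ℤˣ) (s : JacAlg k l m) :
    Prop where
  vtx_mul : vtx k l m (glue l n j (σ * j)) * s = s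
  west : westArw k l m (-σ) n (j + 1) (σ * (j + 1)) * s ∈ K
  east : eastArw k l m n (j - 1) (σ * (j - 1)) * (westArw k l m σ n (j + 1) (σ * (j - 1)) * s) ∈ K
  steps : ∀ c ∈ arrowSet l m, c ≠ (westDir σ, n, (j : ℤ) + 1, σ * ((j : ℤ) - 1)) →
    arw k l m c * s ∈ K

/-- The product of the last `i` arrows of the diagonal of the diamond `n` that ends at the left
edge vertex `(j, σ j)`, and `s`. -/
noncomputable def diagProd (j n : ℕ) (σ : ℤˣ) (s : JacAlg k l m) (i : ℕ) : JacAlg k l m :=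
  arwProd k l m (line (westDir σ) n (j + i) (σ * (j - i)) i) * s

theorem line_diag_succ (j n : ℕ) (σ : ℤˣ) (i : ℕ) :
    line (westDir σ) n (j + (i + 1 : ℕ)) (σ * (j - (i + 1 : ℕ))) (i + 1) =
      (westDir σ, n, (j : ℤ) + i + 1, σ * ((j : ℤ) - i - 1)) ::
        line (westDir σ) n (j + i) (σ * (j - i)) i := by
  rw [line]
  congr 1
  · simp only [Prod.mk.injEq, true_and]
    constructor <;> push_cast <;> ring
  · refine line_congr ?_ ?_
    · rw [westDir_dx]
      push_cast
      ring
    · rw [westDir_dy]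
      push_cast
      ring

theorem arw_diag {j n i : ℕ} {σ : ℤˣ} (h2 : 2 ≤ n) (hm : n ≤ m) (h1 : 1 ≤ j) (hj : j < l)
    (hi : i < l) : arw k l m (westDir σ, n, (j : ℤ) + i + 1, σ * ((j : ℤ) - i - 1)) =
      westArw k l m σ n (j + i + 1) (σ * (j - i - 1)) := by
  rw [westArw_of_isPoint, westRaw_of_ne]
  · rw [units_mul_self_mul]
    omega
  all_goals
    unfold IsPoint
    rcases Int.units_eq_one_or σ with rfl | rfl <;> simp <;> omega

variable {j n : ℕ} {σ : ℤˣ} {s : JacAlg k l m}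

theorem diagProd_zero : diagProd j n σ s 0 = s := one_mul s

theorem diagProd_succ (h2 : 2 ≤ n) (hm : n ≤ m) (h1 : 1 ≤ j) (hj : j < l) {i : ℕ} (hi : i < l) :
    diagProd j n σ s (i + 1) =
      westArw k l m σ n (j + i + 1) (σ * (j - i - 1)) * diagProd j n σ s i := by
  rw [diagProd, line_diag_succ, arwProd_cons, mul_assoc, arw_diag h2 hm h1 hj hi]
  rfl

theorem vtx_mul_diagProd (hv : vtx k l m (glue l n j (σ * j)) * s = s) (i : ℕ) :
    vtx k l m (glue l n (j + i) (σ * (j - i))) * diagProd j n σ s i = diagProd j n σ s i := by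
  cases i with
  | zero => simpa [diagProd_zero] using hv
  | succ i =>
    rw [diagProd, line_diag_succ, arwProd_cons, mul_assoc, ← mul_assoc, vtx_mul_arw, if_pos]
    rw [rawSrc]
    congr 1
    push_cast
    ring

/-- Since the two west directions commute, the transverse step slides along the diagonal down to its
foot. -/
theorem westArw_mul_diagProd_mem (h2 : 2 ≤ n) (hm : n ≤ m) (h1 : 1 ≤ j) (hj : j < l)
    (hs : westArw k l m (-σ) n (j + 1) (σ * (j + 1)) * s ∈ K) {i : ℕ} (hi : i ≤ l) :
    westArw k l m (-σ) n (j + i + 1) (σ * (j - i + 1)) * diagProd j n σ s i ∈ K := by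
  induction i with
  | zero => simpa [diagProd_zero] using hs
  | succ i ih =>
    have h := westArw_mul_westArw k l m σ n (j + i + 2) (σ * (j - i))
    rw [westArw_congr (k := k) (m := m) (x := j + i + 2 - 1) (y := σ * (j - i) - σ)
        (x' := j + i + 1) (y' := σ * (j - i - 1)) (by ring) (by ring),
      westArw_congr (k := k) (m := m) (x := j + i + 2 - 1) (y := σ * (j - i) + σ)
        (x' := j + i + 1) (y' := σ * (j - i + 1)) (by ring) (by ring)] at h
    rw [diagProd_succ h2 hm h1 hj (by omega), westArw_congr (x' := j + i + 2) (y' := σ * (j - i))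
      (by push_cast; ring) (by push_cast; ring), ← mul_assoc, h, mul_assoc]
    exact K.mul_mem_left _ (ih (by omega))

/-- An east step slides down the diagonal together with the diagonal arrow that follows it. At the
foot that arrow belongs to the path and need not lie in `K`; this is why `IsDiagonalEnd.east` is a
condition on a product of two steps. -/
theorem eastArw_mul_diagProd_mem (h2 : 2 ≤ n) (hm : n ≤ m) (h1 : 1 ≤ j) (hj : j < l)
    (hs : eastArw k l m n (j - 1) (σ * (j - 1)) *
      (westArw k l m σ n (j + 1) (σ * (j - 1)) * s) ∈ K) {i : ℕ} (hi : i < l) :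
    eastArw k l m n (j + i - 1) (σ * (j - i - 1)) * diagProd j n σ s (i + 1) ∈ K := by
  induction i with
  | zero =>
    rw [diagProd_succ h2 hm h1 hj (by omega), diagProd_zero]
    simpa using hs
  | succ i ih =>
    have h := westArw_mul_eastArw k l m (τ := σ) (n := n) (x := j + i) (y := σ * (j - i - 2))
      (by rw [units_mul_self_mul]; omega) (by rw [units_mul_self_mul]; omega)
    rw [eastArw_congr (k := k) (m := m) (x := j + i - 1) (x' := j + i - 1)
        (y' := σ * (j - i - 1)) rfl (by ring)] at h
    rw [diagProd_succ h2 hm h1 hj hi, eastArw_congr (x' := j + i) (y' := σ * (j - i - 2))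
      (by push_cast; ring) (by push_cast; ring), westArw_congr (x' := j + i + 2)
      (y' := σ * (j - i - 2)) (by push_cast; ring) (by push_cast; ring), ← mul_assoc, ← h,
      mul_assoc]
    exact K.mul_mem_left _ (ih (by omega))

theorem steps_diag (hF : ∀ s ∈ M, vtx k l m (2, (l : ℤ), (l : ℤ)) * s ∈ K) (hs : s ∈ M)
    (h2 : 2 ≤ n) (hm : n ≤ m) (h1 : 1 ≤ j) (hj : j < l) (h : IsDiagonalEnd K j n σ s)
    {i : ℕ} (hi : i ≤ l) :
    Steps k l m K s (line (westDir σ) n (j + i) (σ * (j - i)) i) := by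
  induction i with
  | zero => trivial
  | succ i ih =>
    rw [line_diag_succ]
    refine ⟨?_, ih (by omega)⟩
    change ∀ c ∈ arrowSet l m, _ → arw k l m c * diagProd j n σ s i ∈ K
    cases i with
    | zero => simpa [diagProd_zero] using h.steps
    | succ i =>
      have hv := vtx_mul_diagProd h.vtx_mul (i + 1)
      rw [glue_of_lt (by rcases Int.units_eq_one_or σ with rfl | rfl <;> simp <;> omega)
        (by rcases Int.units_eq_one_or σ with rfl | rfl <;> simp <;> omega)] at hv
      have hE := eastArw_mul_diagProd_mem h2 hm h1 hj h.east (i := i) (by omega)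
      have hW := westArw_mul_diagProd_mem h2 hm h1 hj h.west (i := i + 1) (by omega)
      refine forall_arw_mul_mem_interior hF σ ?_ ?_ ?_ ?_ (M.mul_mem_left _ hs) hv _
        (fun _ => ?_) (fun hne => ?_) (fun _ => ?_)
      any_goals rcases Int.units_eq_one_or σ with rfl | rfl <;> simp <;> omega
      · rwa [eastArw_congr (x' := j + i - 1) (y' := σ * (j - i - 1)) (by push_cast; ring)
          (by push_cast; ring)]
      · refine absurd ?_ hne
        rw [westRaw_of_ne]
        · simp only [Prod.mk.injEq, true_and]
          ring
        · rw [mul_sub, units_mul_self_mul, Int.units_coe_mul_self]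
          omega
      · rwa [westArw_congr (x' := j + (i + 1 : ℕ) + 1) (y' := σ * (j - (i + 1 : ℕ) + 1))
          (by ring) (by ring)]

/-- Passing from a diamond to the next one. -/
theorem IsDiagonalEnd.diagProd (hF : ∀ s ∈ M, vtx k l m (2, (l : ℤ), (l : ℤ)) * s ∈ K)
    (hs : s ∈ M) (h2 : 2 ≤ n) (hm : n ≤ m) (h1 : 1 ≤ j) (hj : j < l)
    (h : IsDiagonalEnd K j n σ s) : IsDiagonalEnd K j (n + 1) (-σ) (diagProd j n σ s l) := by
  have hv : vtx k l m (n, (l : ℤ) + j, ((-σ : ℤˣ) : ℤ) * (l - j)) * Diamond.diagProd j n σ s l =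
      Diamond.diagProd j n σ s l := by
    have := vtx_mul_diagProd h.vtx_mul l
    rw [glue_of_lt (by rcases Int.units_eq_one_or σ with rfl | rfl <;> simp <;> omega)
        (by rcases Int.units_eq_one_or σ with rfl | rfl <;> simp <;> omega)] at this
    convert this using 3
    simp only [Prod.mk.injEq, true_and, Units.val_neg]
    constructor <;> ring
  have hW := westArw_mul_diagProd_mem h2 hm h1 hj h.west le_rfl
  have hE := eastArw_mul_diagProd_mem h2 hm h1 hj h.east (i := l - 1) (by omega)
  rw [Nat.sub_add_cancel (by omega), Nat.cast_sub (by omega), Nat.cast_one] at hE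
  have hW' : westArw k l m (-σ) n (2 * l - (l - j : ℤ) + 1) ((-σ : ℤˣ) * ((l - j : ℤ) - 1)) *
      Diamond.diagProd j n σ s l ∈ K := by
    rwa [westArw_congr (x' := j + l + 1) (y' := σ * (j - l + 1)) (by ring)
      (by rw [Units.val_neg]; ring)]
  have hE' : eastArw k l m n (2 * l - (l - j : ℤ) - 2) ((-σ : ℤˣ) * (l - j : ℤ)) *
      Diamond.diagProd j n σ s l ∈ K := by
    rwa [eastArw_congr (x' := j + (l - 1) - 1) (y' := σ * (j - (l - 1) - 1)) (by ring)
      (by rw [Units.val_neg]; ring)]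
  refine ⟨?_, ?_, ?_, ?_⟩
  · rw [glue_edge (by omega) (by omega)]
    exact hv
  · rw [neg_neg]
    -- If this fails, the step has no source: either there is no diamond `n + 1`, or the source
    -- would be a removed corner.
    by_cases hlt : n < m ∧ j + 1 < l
    · have := westArw_right k l m (τ := -σ) (n := n) (x := j + l + 1) (y := σ * (j - l + 1)) h2
        hlt.1 (by rw [neg_units_mul_self_mul]; ring) (by omega)
      rw [neg_neg, westArw_congr (k := k) (m := m) (n := n + 1) (x' := j + 1)
        (y' := (-σ : ℤˣ) * (j + 1)) (by ring) (by ring)] at this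
      rw [← this]
      exact hW
    · rw [westArw_of_not_src, zero_mul]
      · exact zero_mem _
      · unfold IsPoint
        rcases Int.units_eq_one_or σ with rfl | rfl <;> simp <;> omega
  -- The east-west path of the diamond `n + 1` equals a west-east path of the diamond `n`, and the
  -- last east step of the latter already sends the product into `K`.
  · have := westArw_mul_eastArw_right k l m (τ := σ) (n := n) (x := j + l - 1)
      (y := σ * (j - l - 1)) h2 (by rw [units_mul_self_mul]; ring)
    rw [← Units.val_neg, westArw_congr (k := k) (m := m) (n := n + 1) (x' := j + 1)
      (y' := (-σ : ℤˣ) * (j - 1)) (by ring) (by ring), eastArw_congr (k := k) (m := m) (n := n + 1)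
      (x' := j - 1) (y' := (-σ : ℤˣ) * (j - 1)) (by ring) (by ring)] at this
    rw [← mul_assoc, ← this, mul_assoc, eastArw_congr (x' := 2 * l - (l - j : ℤ) - 2)
      (y' := (-σ : ℤˣ) * (l - j : ℤ)) (by ring) (by rw [Units.val_neg]; ring)]
    exact K.mul_mem_left _ hE'
  · refine forall_arw_mul_mem_right hF (-σ) h2 (H := l - j) (by omega) (by omega)
      (M.mul_mem_left _ hs) ?_ _ (fun _ => hE') hW' (fun hne => absurd ?_ hne)
    · rwa [show 2 * (l : ℤ) - (l - j) = l + j by ring]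
    · rw [westRaw_of_ne]
      · simp only [Prod.mk.injEq, true_and]
        constructor <;> ring
      · rw [units_mul_self_mul]
        omega

/-- Here the path turns from the row in the half `ε` to the diagonal in the other half. The relation
of the left edge exchanges the east-west paths in the two halves, and in the half `ε` the west step
is zero modulo `K` by `ha`. This gives the condition on east steps. -/
theorem isDiagonalEnd_two (hF : ∀ s ∈ M, vtx k l m (2, (l : ℤ), (l : ℤ)) * s ∈ K) (hs : s ∈ M)
    {ε : ℤˣ} (h1 : 1 ≤ j) (hv : vtx k l m (2, (j : ℤ), (j : ℤ)) * s = s)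
    (ha : westArw k l m ε 2 (j + 1) (ε * (j - 1)) * s ∈ K)
    (hb : westArw k l m (-ε) 2 (j + 1) (ε * (j + 1)) * s ∈ K) :
    IsDiagonalEnd K j 2 (-ε) s := by
  refine ⟨?_, ?_, ?_, ?_⟩
  · rwa [glue_two_edge]
  · have := westArw_two_left k l m (-ε) (j + 1)
    rw [Units.val_neg, neg_neg] at this
    rw [neg_neg, Units.val_neg, this, neg_neg]
    exact hb
  · have := eastArw_mul_westArw_left k l m ε (j - 1)
    rw [show (j : ℤ) - 1 + 2 = j + 1 by ring] at this
    rw [Units.val_neg, ← mul_assoc, ← this, mul_assoc]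
    exact K.mul_mem_left _ ha
  · refine forall_arw_mul_mem_left hF ε hs hv _ (fun hne => absurd ?_ hne) ha hb
    rw [westRaw_of_ne, Units.val_neg]
    rw [← Units.val_neg, units_mul_self_mul]
    omega

theorem steps_firstPart (hF : ∀ s ∈ M, vtx k l m (2, (l : ℤ), (l : ℤ)) * s ∈ K) (hs : s ∈ M)
    {ε : ℤˣ} (h1 : 1 ≤ j) (hj : j < l) (h : IsDiagonalEnd K j 2 (-ε) s) (r : ℕ) (hr : r + 1 ≤ m) :
    Steps k l m K s (firstPart l j ε r) ∧
      IsDiagonalEnd K j (r + 2) (sgn ε (r + 2)) (arwProd k l m (firstPart l j ε r) * s) := by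
  induction r with
  | zero =>
    refine ⟨trivial, ?_⟩
    rw [firstPart, arwProd_nil, one_mul]
    simpa [sgn] using h
  | succ r ih =>
    obtain ⟨i1, i2⟩ := ih (by omega)
    have hM := M.mul_mem_left (arwProd k l m (firstPart l j ε r)) hs
    have hL : line (westDir (sgn ε (r + 2))) (r + 2) (l + j) (sgn ε (r + 2) * (j - l)) l =
        line (westDir (sgn ε (r + 2))) (r + 2) (j + l) (sgn ε (r + 2) * (j - l)) l :=
      line_congr (add_comm _ _) rfl
    rw [firstPart, hL]
    refine ⟨Steps.append (steps_diag hF hM (by omega) (by omega) h1 hj i2 le_rfl) i1, ?_⟩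
    rw [arwProd_append, mul_assoc, sgn_succ]
    exact i2.diagProd hF hM (by omega) (by omega) h1 hj

/-- All steps to the path of the boundary vertex, other than its arrows, are zero modulo `K`. -/
theorem steps_pathRaw {h : ℕ} (hm : 2 ≤ m) (h1 : 1 ≤ h) (h2 : h < l) (ε : ℤˣ)
    (hF : ∀ s ∈ M, vtx k l m (2, (l : ℤ), (l : ℤ)) * s ∈ K)
    (hF' : ∀ n, 2 ≤ n → n ≤ m → ∀ s ∈ M, vtx k l m (n, 2 * (l : ℤ), 0) * s ∈ K) (hs : s ∈ M)
    (hv : vtx k l m (glue l m (2 * l - h) (ε * h)) * s = s)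
    (hC : 2 ≤ h → arw k l m (westDir ε, m, 2 * (l : ℤ) - h + 1, ε * ((h : ℤ) - 1)) * s ∈ K) :
    Steps k l m K s (pathRaw l m h ε) ∧
      ∀ c ∈ arrowSet l m, arw k l m c * (arwProd k l m (pathRaw l m h ε) * s) ∈ K := by
  obtain ⟨r, rfl⟩ : ∃ r, m = r + 2 := ⟨m - 2, by omega⟩
  obtain ⟨hb1, hb2⟩ := rowHeight_bounds h1 h2 (r + 2)
  have hC0 : westArw k l (r + 2) ε (r + 2) (2 * l - h + 1) (ε * (h - 1)) * s ∈ K := by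
    by_cases hh : 2 ≤ h
    · rw [westArw_of_isPoint, westRaw_of_ne]
      · exact hC hh
      · rw [units_mul_self_mul]
        omega
      all_goals
        unfold IsPoint
        rcases Int.units_eq_one_or ε with rfl | rfl <;> simp <;> omega
    -- For a terminal `v` the edge arrow comes from the right corner, the frozen vertex `m`. The
    -- missing condition on a predecessor is thus replaced by the missing support.
    · obtain rfl : h = 1 := by omega
      have := hF' (r + 2) (by omega) le_rfl _ (M.mul_mem_left
        (westArw k l (r + 2) ε (r + 2) (2 * l - (1 : ℕ) + 1) (ε * ((1 : ℕ) - 1))) hs)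
      rw [← mul_assoc, vtx_mul_westArw, if_pos] at this
      · exact this
      · rw [glue_of_lt (by simp; omega) (by simp; omega)]
        simp
  -- There is no diamond after the last one, so this step is zero.
  have hC1 : westArw k l (r + 2) ε (r + 3) (l - h + 1) (ε * (l - h - 1)) * s ∈ K := by
    rw [westArw_of_not_src, zero_mul]
    · exact zero_mem _
    · unfold IsPoint
      omega
  obtain ⟨s1, s2, s3, s4⟩ := steps_secondPart hF hF' hb1 hb2 ε r le_rfl h
    (rowHeight_rowHeight h2.le (r + 2)) s hs hv hC0 hC1
  have hM := M.mul_mem_left (arwProd k l (r + 2)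
    (secondPart l (rowHeight l h (r + 2)) ε (r + 1))) hs
  obtain ⟨t1, t2⟩ := steps_firstPart hF hM hb1 hb2 (isDiagonalEnd_two hF hM hb1 s2 s3 s4) (r + 1)
    le_rfl
  have e : r + 2 - 1 = r + 1 := rfl
  refine ⟨Steps.append t1 s1, fun c hc => ?_⟩
  rw [pathRaw, e, arwProd_append, mul_assoc]
  refine t2.steps c hc ?_
  -- The only arrow exempted at the start of the path would lie in the diamond `m + 1`, which does
  -- not exist. Hence nothing extends the path.
  rintro rfl
  rcases arrow_cases hc with ⟨h, -, -⟩ | ⟨-, -, h⟩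
  · have := h.2.1
    simp only at this
    omega
  · simp only [Prod.mk.injEq] at h
    omega

end FirstPart

end Diamond

/-! ### Path modules as representations of the path algebra. -/

namespace FQuiver

theorem QPath.vert_last {V A : Type} {Q : FQuiver V A} (p : QPath Q) : p.vert (Fin.last _) = p.finish := by
  obtain ⟨u, L, w, h⟩ := p
  unfold QPath.vert
  simp only [Fin.val_last]
  induction L generalizing u with
  | nil => exact h
  | cons a L ih => exact ih _ h.2

section PathModule

variable (k : Type*) [CommRing k] {V A : Type} [Fintype V] [DecidableEq V] [DecidableEq A]
  {Q : FQuiver V A} (p : QPath Q)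

theorem QPath.rep_idemp (u : V) : p.rep k (idemp k Q u) = p.vertexMatrix k u := by
  unfold QPath.rep idemp
  rw [RingQuot.liftAlgHom_mkAlgHom_apply, FreeAlgebra.lift_ι_apply]
  rfl

theorem QPath.rep_arr (a : A) : p.rep k (arr k Q a) = p.arrowMatrix k a := by
  unfold QPath.rep arr
  rw [RingQuot.liftAlgHom_mkAlgHom_apply, FreeAlgebra.lift_ι_apply]
  rfl

theorem QPath.rep_arr_mul_arr {a b : A}
    (h : ∀ i : ℕ, p.arrows[i]? = some a → p.arrows[i + 1]? ≠ some b) :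
    p.rep k (arr k Q a * arr k Q b) = 0 := by
  rw [map_mul, QPath.rep_arr, QPath.rep_arr]
  ext i j
  rw [Matrix.mul_apply]
  refine Finset.sum_eq_zero fun x _ => ?_
  simp only [QPath.arrowMatrix, Matrix.of_apply]
  split_ifs with h1 h2
  · rw [← h1.1] at h2
    exact absurd h2.2 (h _ h1.2)
  all_goals simp

theorem QPath.rep_wordDeriv {a α β γ : A}
    (h1 : ∀ i : ℕ, p.arrows[i]? = some α → p.arrows[i + 1]? ≠ some β)
    (h2 : ∀ i : ℕ, p.arrows[i]? = some β → p.arrows[i + 1]? ≠ some γ)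
    (h3 : ∀ i : ℕ, p.arrows[i]? = some γ → p.arrows[i + 1]? ≠ some α) :
    p.rep k (wordDeriv k Q a [α, β, γ]) = 0 := by
  rw [wordDeriv_triple, map_add, map_add]
  have e : ∀ (c : Prop) [Decidable c] (x : PathAlg k Q), p.rep k x = 0 →
      p.rep k (if c then x else 0) = 0 := by
    intro c _ x hx
    split_ifs
    · exact hx
    · exact map_zero _
  rw [e _ _ (p.rep_arr_mul_arr k h1), e _ _ (p.rep_arr_mul_arr k h2),
    e _ _ (p.rep_arr_mul_arr k h3), add_zero, add_zero]

end PathModule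

end FQuiver

/-! ### The path module satisfies the relations of the Jacobian algebra. -/

namespace Diamond

open FQuiver

section Types

variable {l m : ℕ}

/-- The three arrows are of the three types `A`, `B`, `C`, in some order. -/
def IsMixed (u w t : RawArrow) : Prop :=
  (IsA u ∧ IsB w ∧ IsC t) ∨ (IsA u ∧ IsC w ∧ IsB t) ∨ (IsB u ∧ IsA w ∧ IsC t) ∨
    (IsB u ∧ IsC w ∧ IsA t) ∨ (IsC u ∧ IsA w ∧ IsB t) ∨ (IsC u ∧ IsB w ∧ IsA t)

theorem IsMixed.rotate {u w t : RawArrow} (h : IsMixed u w t) : IsMixed w t u := by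
  rcases h with h | h | h | h | h | h
  · exact Or.inr (Or.inr (Or.inr (Or.inl ⟨h.2.1, h.2.2, h.1⟩)))
  · exact Or.inr (Or.inr (Or.inr (Or.inr (Or.inr ⟨h.2.1, h.2.2, h.1⟩))))
  · exact Or.inr (Or.inl ⟨h.2.1, h.2.2, h.1⟩)
  · exact Or.inr (Or.inr (Or.inr (Or.inr (Or.inl ⟨h.2.1, h.2.2, h.1⟩))))
  · exact Or.inl ⟨h.2.1, h.2.2, h.1⟩
  · exact Or.inr (Or.inr (Or.inl ⟨h.2.1, h.2.2, h.1⟩))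

/-- No arrow completes `u`, `w` to a cycle with arrows of the three types. -/
def NoTriangle (l m : ℕ) (u w : RawArrow) : Prop :=
  ∀ t ∈ arrowSet l m, rawTgt l w = rawSrc l t → rawTgt l t = rawSrc l u → ¬ IsMixed u w t

theorem not_isB_of_east {a : RawArrow} (h : a.1 = Dir.east) : ¬ IsB a := by
  rw [isB_iff, h]
  exact fun h => westDir_ne_east _ h.symm

theorem not_isC_of_east {a : RawArrow} (ha : a ∈ arrowSet l m) (h : a.1 = Dir.east) : ¬ IsC a := by
  rw [isC_iff, h]
  rintro (h' | h')
  · exact westDir_ne_east _ h'.symm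
  · rcases arrow_cases ha with h3 | h3
    · have := (h3.2.2 h'.2).2
      rw [h] at this
      simp at this
    · rw [h3.2.2] at h
      simp at h

theorem noTriangle_of_east {u w : RawArrow} (hu : u ∈ arrowSet l m) (hw : w ∈ arrowSet l m)
    (h1 : u.1 = Dir.east) (h2 : w.1 = Dir.east) : NoTriangle l m u w := by
  intro t _ _ _ h
  have := not_isB_of_east h1
  have := not_isC_of_east hu h1
  have := not_isB_of_east h2
  have := not_isC_of_east hw h2
  unfold IsMixed at h
  tauto

/-- Both arrows are of the same single type, `B` for `τ = 1` and `C` for `τ = -1`, whereas a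
triangle of the potential needs all three types. -/
theorem noTriangle_of_west {u w : RawArrow} {τ : ℤˣ}
    (h1 : u.1 = westDir (τ * typeSign u.2.1)) (h1' : ¬ OnLeftEdge u)
    (h2 : w.1 = westDir (τ * typeSign w.2.1)) (h2' : ¬ OnLeftEdge w) : NoTriangle l m u w := by
  intro t _ _ _ h
  have a1 : ¬ IsA u := by unfold IsA; rw [h1]; exact westDir_ne_east _
  have a2 : ¬ IsA w := by unfold IsA; rw [h2]; exact westDir_ne_east _
  have key : ∀ a : RawArrow, a.1 = westDir (τ * typeSign a.2.1) → ¬ OnLeftEdge a →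
      (IsB a ↔ τ = 1) ∧ (IsC a ↔ τ = -1) := by
    intro a h h'
    rw [isB_iff, isC_iff, h, westDir_inj, westDir_inj]
    simp only [h', and_false, or_false, mul_eq_right, neg_eq_neg_one_mul (typeSign a.2.1),
      mul_left_inj, and_self]
  have k1 := key u h1 h1'
  have k2 := key w h2 h2'
  have : (-1 : ℤˣ) ≠ 1 := by decide
  unfold IsMixed at h
  rw [k1.1, k1.2, k2.1, k2.2] at h
  rcases Int.units_eq_one_or τ with rfl | rfl <;> tauto

theorem sgn_eq (ε : ℤˣ) (n : ℕ) : sgn ε n = ε * typeSign n := by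
  unfold sgn typeSign
  split_ifs <;> simp

/-- The diagonals change direction from diamond to diamond exactly as the types do, so the first
part of `p_v` stays within one type. It meets the left edges only at its targets. -/
theorem firstPart_west {j : ℕ} (h1 : 1 ≤ j) (hj : j < l) (ε : ℤˣ) (r : ℕ)
    {a : RawArrow} (ha : a ∈ firstPart l j ε r) :
    a.1 = westDir (ε * typeSign a.2.1) ∧ (-a.2.2.1 < a.2.2.2 ∧ a.2.2.2 < a.2.2.1) ∧
      a.2.2 ≠ (2 * (l : ℤ), 0) := by
  induction r with
  | zero => simp [firstPart] at ha
  | succ r ih =>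
    rcases List.mem_append.1 ha with ha | ha
    · obtain ⟨i, hi, rfl⟩ := mem_line ha
      rw [westDir_dx, westDir_dy]
      simp only [ne_eq, Prod.mk.injEq, sgn_eq, true_and]
      generalize ε * typeSign (r + 2) = σ
      rcases Int.units_eq_one_or σ with rfl | rfl <;> simp <;> omega
    · exact ih ha

theorem secondPart_east {j : ℕ} (ε : ℤˣ) (r : ℕ) {a : RawArrow} (ha : a ∈ secondPart l j ε r) :
    a.1 = Dir.east := by
  induction r with
  | zero => simp [secondPart] at ha
  | succ r ih =>
    rcases List.mem_append.1 ha with ha | ha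
    · exact ih ha
    · obtain ⟨i, hi, rfl⟩ := mem_line ha
      rfl

theorem line_succ_eq_append (d : Dir) (n : ℕ) (x y : ℤ) (r : ℕ) :
    line d n x y (r + 1) = line d n x y r ++ [(d, n, x + r * d.dx, y + r * d.dy)] := by
  induction r generalizing x y with
  | zero => simp [line]
  | succ r ih =>
    rw [line, ih, line, List.cons_append]
    congr 4
    simp only [Prod.mk.injEq, true_and]
    constructor <;> push_cast <;> ring

theorem firstPart_getLast {j : ℕ} (hl : 1 ≤ l) (ε : ℤˣ) (r : ℕ) :
    (firstPart l j ε (r + 1)).getLast? = some (westDir (-ε), 2, (j : ℤ) + 1, -ε * ((j : ℤ) - 1)) := by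
  induction r with
  | zero =>
    obtain ⟨l, rfl⟩ : ∃ l', l = l' + 1 := ⟨l - 1, by omega⟩
    rw [firstPart, firstPart, List.append_nil, line_succ_eq_append, List.getLast?_concat,
      westDir_dx, westDir_dy]
    simp only [Option.some.injEq, Prod.mk.injEq, sgn]
    refine ⟨by simp, by simp, ?_, ?_⟩
    · push_cast; ring
    · simp; ring
  | succ r ih =>
    rw [firstPart, List.getLast?_append, ih]
    rfl

theorem secondPart_head {j : ℕ} (hj : j < l) (ε : ℤˣ) (r : ℕ) :
    (secondPart l j ε (r + 1)).head? = some (Dir.east, 2, (j : ℤ), ε * (j : ℤ)) := by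
  induction r with
  | zero =>
    obtain ⟨i, rfl⟩ : ∃ i, l = j + (i + 1) := ⟨l - j - 1, by omega⟩
    simp [secondPart, rowHeight, line]
  | succ r ih =>
    rw [secondPart, List.head?_append, ih]
    rfl

/-- A closing arrow must be a west step out of `(j + 2, ε j)`. In direction `(-1, ε)` it returns to
the left edge, where the incoming arrow does not start. In direction `(-1, -ε)` it has the type of
the incoming arrow. For `j = 1` the latter does close a cycle, so the types are really needed. -/
theorem noTriangle_turn {j : ℕ} (h1 : 1 ≤ j) (hj : j < l) (ε : ℤˣ) (hm : 2 ≤ m) :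
    NoTriangle l m (westDir (-ε), 2, (j : ℤ) + 1, -ε * ((j : ℤ) - 1))
      (Dir.east, 2, (j : ℤ), ε * (j : ℤ)) := by
  intro t ht e1 e2 hmix
  have hu : (westDir (-ε), 2, (j : ℤ) + 1, -ε * ((j : ℤ) - 1)) ∈ arrowSet l m := by
    rw [mem_arrowSet]
    left
    unfold IsPoint OnLeftEdge
    simp only [westDir_dx, westDir_dy]
    rcases Int.units_eq_one_or ε with rfl | rfl <;> simp <;> omega
  have hd : t.1 ≠ Dir.east := by
    intro hd
    have := not_isB_of_east hd
    have := not_isC_of_east ht hd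
    have : ¬ IsB (Dir.east, 2, (j : ℤ), ε * (j : ℤ)) := not_isB_of_east rfl
    have : ¬ IsA (westDir (-ε), 2, (j : ℤ) + 1, -ε * ((j : ℤ) - 1)) := westDir_ne_east _
    have : ¬ (IsA t ∧ IsC (Dir.east, 2, (j : ℤ), ε * (j : ℤ))) := by
      rintro ⟨-, h⟩
      rcases isC_iff.1 h with h | h
      · exact westDir_ne_east _ h.symm
      · unfold OnLeftEdge at h
        simp [Dir.dx, Dir.dy] at h
        rcases Int.units_eq_one_or ε with rfl | rfl <;> simp at h <;> omega
    unfold IsMixed at hmix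
    tauto
  rw [rawSrc_of_ne_east ht hd] at e1
  rw [rawSrc_of_ne_east hu (westDir_ne_east _)] at e2
  obtain ⟨d, n, x, y⟩ := t
  obtain ⟨τ, rfl⟩ := exists_west hd
  have e3 : rawTgt l (Dir.east, 2, (j : ℤ), ε * (j : ℤ)) = (2, (j : ℤ) + 2, ε * (j : ℤ)) := by
    unfold rawTgt
    simp only [Dir.dx, Dir.dy, add_zero]
    apply glue_of_lt <;> rcases Int.units_eq_one_or ε with rfl | rfl <;> simp <;> omega
  rw [e3] at e1
  simp only [Prod.mk.injEq] at e1
  obtain ⟨rfl, rfl, rfl⟩ := e1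
  have hτ : τ = ε ∨ τ = -ε := by
    rcases Int.units_eq_one_or τ with rfl | rfl <;>
      rcases Int.units_eq_one_or ε with rfl | rfl <;> simp
  rcases hτ with rfl | rfl
  · unfold rawTgt at e2
    rw [westDir_dx, westDir_dy] at e2
    simp only at e2
    rw [show (j : ℤ) + 2 + -1 = j + 1 by ring, show (τ : ℤ) * j + τ = τ * (j + 1) by ring,
      glue_two_edge] at e2
    simp only [Prod.mk.injEq, true_and] at e2
    rcases Int.units_eq_one_or τ with rfl | rfl <;> simp at e2 <;> omega
  · have hB : IsB (westDir (-ε), 2, (j : ℤ) + 1, -ε * ((j : ℤ) - 1)) ↔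
        IsB (westDir (-ε), 2, (j : ℤ) + 2, ε * (j : ℤ)) := by rw [isB_iff, isB_iff]
    have hE : ∀ x y : ℤ, -x < y → y < x → ¬ OnLeftEdge (westDir (-ε), 2, x, y) := by
      intro x y h h' h''
      unfold OnLeftEdge at h''
      simp only at h''
      omega
    have hE1 := hE ((j : ℤ) + 1) (-ε * ((j : ℤ) - 1))
      (by rcases Int.units_eq_one_or ε with rfl | rfl <;> simp <;> omega)
      (by rcases Int.units_eq_one_or ε with rfl | rfl <;> simp <;> omega)
    have hE2 := hE ((j : ℤ) + 2) (ε * (j : ℤ))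
      (by rcases Int.units_eq_one_or ε with rfl | rfl <;> simp <;> omega)
      (by rcases Int.units_eq_one_or ε with rfl | rfl <;> simp <;> omega)
    have hC1 := isC_iff (a := (westDir (-ε), 2, (j : ℤ) + 1, -ε * ((j : ℤ) - 1)))
    have hC2 := isC_iff (a := (westDir (-ε), 2, (j : ℤ) + 2, ε * (j : ℤ)))
    have hB1 := isB_iff (a := (westDir (-ε), 2, (j : ℤ) + 1, -ε * ((j : ℤ) - 1)))
    simp only [hE1, hE2, and_false, or_false, typeSign_two, westDir_inj, neg_neg] at hC1 hC2 hB1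
    have : ¬ IsA (westDir (-ε), 2, (j : ℤ) + 1, -ε * ((j : ℤ) - 1)) := westDir_ne_east _
    have : ¬ IsA (westDir (-ε), 2, (j : ℤ) + 2, ε * (j : ℤ)) := westDir_ne_east _
    have : (-1 : ℤˣ) ≠ 1 := by decide
    unfold IsMixed at hmix
    rw [← hB, hC1, hC2, hB1] at hmix
    rcases Int.units_eq_one_or ε with rfl | rfl <;> simp at hmix <;> tauto

/-- Inside each of the two parts all arrows have the same type, so only the turn needs an argument
of its own. -/
theorem isChain_noTriangle {h : ℕ} (hm : 2 ≤ m) (h1 : 1 ≤ h) (h2 : h < l) (ε : ℤˣ) :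
    (pathRaw l m h ε).IsChain (NoTriangle l m) := by
  obtain ⟨r, rfl⟩ : ∃ r, m = r + 2 := ⟨m - 2, by omega⟩
  obtain ⟨hb1, hb2⟩ := rowHeight_bounds h1 h2 (r + 2)
  have e : r + 2 - 1 = r + 1 := rfl
  rw [pathRaw, e, List.isChain_append, firstPart_getLast (by omega), secondPart_head hb2]
  refine ⟨?_, ?_, ?_⟩
  · refine (List.pairwise_of_forall_mem_list fun a ha b hb => ?_).isChain
    obtain ⟨a1, a2, -⟩ := firstPart_west hb1 hb2 ε _ ha
    obtain ⟨b1, b2, -⟩ := firstPart_west hb1 hb2 ε _ hb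
    exact noTriangle_of_west a1 (fun h => by unfold OnLeftEdge at h; omega) b1
      (fun h => by unfold OnLeftEdge at h; omega)
  · refine (List.pairwise_of_forall_mem_list fun a ha b hb => ?_).isChain
    exact noTriangle_of_east (secondPart_mem hb1 hb2 ε _ (by omega) ha)
      (secondPart_mem hb1 hb2 ε _ (by omega) hb) (secondPart_east ε _ ha) (secondPart_east ε _ hb)
  · rintro a ⟨⟩ b ⟨⟩
    exact noTriangle_turn hb1 hb2 ε hm

end Types

section PathRep

variable (k : Type*) [Field k] (l m h : ℕ) (hm : 2 ≤ m) (h1 : 1 ≤ h) (h2 : h < l) (ε : ℤˣ)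

theorem getElem?_boundaryPath (i : ℕ) : (pathRaw l m h ε)[i]? =
    ((boundaryPath l m h hm h1 h2 ε).arrows[i]?).map Subtype.val := by
  rw [← List.getElem?_map]
  congr 1
  simp [boundaryPath, List.map_pmap]

/-- The derivative is a combination of pairs of composable arrows of triangles, and such a pair acts
as zero unless its arrows are consecutive on the path. -/
theorem rep_cyclicDeriv (a : Arrow l m) :
    (boundaryPath l m h hm h1 h2 ε).rep k (cyclicDeriv k (quiver l m) (potential k l m) a) = 0 := by
  classical
  have key : ∀ α β γ : Arrow l m, IsMixed α.1 β.1 γ.1 → IsTriangle l m α β γ →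
      (boundaryPath l m h hm h1 h2 ε).rep k (wordDeriv k (quiver l m) a [α, β, γ]) = 0 := by
    have hp : ∀ u w t : Arrow l m, IsMixed u.1 w.1 t.1 →
        (quiver l m).tgt w = (quiver l m).src t → (quiver l m).tgt t = (quiver l m).src u →
        ∀ i : ℕ, (boundaryPath l m h hm h1 h2 ε).arrows[i]? = some u →
          (boundaryPath l m h hm h1 h2 ε).arrows[i + 1]? ≠ some w := by
      intro u w t hmix e1 e2 i hu hw
      have e3 := getElem?_boundaryPath l m h hm h1 h2 ε i
      have e4 := getElem?_boundaryPath l m h hm h1 h2 ε (i + 1)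
      rw [hu, Option.map_some] at e3
      rw [hw, Option.map_some] at e4
      obtain ⟨hi, e3⟩ := List.getElem?_eq_some_iff.1 e3
      obtain ⟨hi', e4⟩ := List.getElem?_eq_some_iff.1 e4
      have := List.isChain_iff_getElem.1 (isChain_noTriangle hm h1 h2 ε) i hi'
      rw [e3, e4] at this
      exact this t.1 t.2 (congrArg Subtype.val e1) (congrArg Subtype.val e2) hmix
    intro α β γ hmix htri
    obtain ⟨t1, t2, t3⟩ := htri
    refine QPath.rep_wordDeriv k _ (hp α β γ hmix t2 t3) (hp β γ α hmix.rotate t3 t1)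
      (hp γ α β hmix.rotate.rotate t1 t2)
  rw [cyclicDeriv_potential_eq_sum, map_sum]
  refine Finset.sum_eq_zero fun α _ => ?_
  rw [map_sum]
  refine Finset.sum_eq_zero fun β _ => ?_
  rw [map_sum]
  refine Finset.sum_eq_zero fun γ _ => ?_
  split_ifs with c c1 c2 c2
  · rw [map_sub, key _ _ _ (Or.inl c) c1, key _ _ _ (Or.inr (Or.inl ⟨c.1, c.2.2, c.2.1⟩)) c2,
      sub_zero]
  · rw [sub_zero, key _ _ _ (Or.inl c) c1]
  · rw [map_sub, map_zero, key _ _ _ (Or.inr (Or.inl ⟨c.1, c.2.2, c.2.1⟩)) c2, sub_zero]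
  · rw [sub_zero, map_zero]
  · exact map_zero _

/-- The path module as a module over the Jacobian algebra. -/
noncomputable def jacRep : JacAlg k l m →ₐ[k] Matrix
    (Fin ((boundaryPath l m h hm h1 h2 ε).arrows.length + 1))
    (Fin ((boundaryPath l m h hm h1 h2 ε).arrows.length + 1)) k :=
  RingQuot.liftAlgHom k ⟨(boundaryPath l m h hm h1 h2 ε).rep k, by
    rintro x y ⟨a, rfl, rfl⟩
    rw [rep_cyclicDeriv, map_zero]⟩

theorem jacRep_toJac (c : PathAlg k (quiver l m)) :
    jacRep k l m h hm h1 h2 ε (toJac k (quiver l m) (potential k l m) c) =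
      (boundaryPath l m h hm h1 h2 ε).rep k c := by
  rw [jacRep, toJac]
  exact RingQuot.liftAlgHom_mkAlgHom_apply k _ _ c

end PathRep

end Diamond

/-! ### The action of the generators on coordinates of the path module. -/

namespace FQuiver

section PathModule

variable (k : Type*) [CommRing k] {V A : Type} {Q : FQuiver V A} (p : QPath Q)

theorem QPath.vecMul_vertexMatrix [DecidableEq V] (w : Fin (p.arrows.length + 1) → k) (u : V)
    (i : Fin (p.arrows.length + 1)) :
    Matrix.vecMul w (p.vertexMatrix k u) i = if p.vert i = u then w i else 0 := by
  rw [QPath.vertexMatrix, Matrix.vecMul_diagonal]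
  simp

variable [DecidableEq A]

theorem QPath.vecMul_arrowMatrix_zero (w : Fin (p.arrows.length + 1) → k) (a : A) :
    Matrix.vecMul w (p.arrowMatrix k a) 0 = 0 := by
  rw [Matrix.vecMul, dotProduct]
  refine Finset.sum_eq_zero fun j _ => ?_
  simp [QPath.arrowMatrix]

theorem QPath.vecMul_arrowMatrix_succ (w : Fin (p.arrows.length + 1) → k) (a : A)
    (i : Fin p.arrows.length) :
    Matrix.vecMul w (p.arrowMatrix k a) i.succ = if p.arrows[i] = a then w i.castSucc else 0 := by
  rw [Matrix.vecMul, dotProduct, Finset.sum_eq_single i.castSucc]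
  · simp [QPath.arrowMatrix]
  · intro j _ hj
    simp only [QPath.arrowMatrix, Matrix.of_apply]
    rw [if_neg, mul_zero]
    rintro ⟨h, -⟩
    refine hj (Fin.ext ?_)
    simpa using h
  · simp

end PathModule

end FQuiver

/-! ### The annihilator of a submodule of an injective module. -/

namespace Inj

open MulOpposite

variable {k J : Type*} [Field k] [Ring J] [Algebra k J] {e : J}

/-- The elements of `Je` at which all linear forms in the submodule `T` of `I_e` vanish. -/
def annihilator (T : Submodule Jᵐᵒᵖ (Inj k J e)) : Ideal J where
  carrier := {x | ∃ hx : x ∈ (Ideal.span {e} : Ideal J), ∀ φ ∈ T, form φ ⟨x, hx⟩ = 0}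
  zero_mem' := ⟨zero_mem _, fun φ _ => map_zero (form φ)⟩
  add_mem' := by
    rintro x y ⟨hx, hx'⟩ ⟨hy, hy'⟩
    refine ⟨add_mem hx hy, fun φ hφ => ?_⟩
    have := map_add (form φ) ⟨x, hx⟩ ⟨y, hy⟩
    rw [hx' φ hφ, hy' φ hφ, add_zero] at this
    exact this
  smul_mem' := by
    rintro c x ⟨hx, hx'⟩
    exact ⟨Ideal.mul_mem_left _ c hx, fun φ hφ => hx' (op c • φ) (T.smul_mem _ hφ)⟩

theorem form_eq_zero_of_mem_annihilator {T : Submodule Jᵐᵒᵖ (Inj k J e)}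
    {x : (Ideal.span {e} : Ideal J)} (hx : (x : J) ∈ annihilator T) {φ : Inj k J e} (hφ : φ ∈ T) :
    form φ x = 0 := hx.2 φ hφ

end Inj

/-! ### The isomorphism of the boundary representation with the path module. -/

namespace Diamond

open FQuiver MulOpposite

section Iso

variable (k : Type*) [Field k] (l m h : ℕ) (hm : 2 ≤ m) (h1 : 1 ≤ h) (h2 : h < l) (ε : ℤˣ)

theorem idem_mul_self (u : Vertex l m) : idem k l m u * idem k l m u = idem k l m u := by
  rw [← vtx_coe, vtx_mul_self]

theorem idem_mul_of_ne {u w : Vertex l m} (h : u ≠ w) : idem k l m u * idem k l m w = 0 := by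
  rw [← vtx_coe, ← vtx_coe, vtx_mul_of_ne]
  exact fun h' => h (Subtype.ext h')

theorem idem_src_mul_arw (a : Arrow l m) :
    idem k l m ((quiver l m).src a) * arw k l m a.1 = arw k l m a.1 := by
  rw [← vtx_coe, vtx_mul_arw]
  exact if_pos rfl

theorem arw_mul_idem_tgt (a : Arrow l m) :
    arw k l m a.1 * idem k l m ((quiver l m).tgt a) = arw k l m a.1 := by
  rw [← vtx_coe, arw_mul_vtx]
  exact if_pos rfl

theorem length_pathRaw :
    (pathRaw l m h ε).length = (boundaryPath l m h hm h1 h2 ε).arrows.length := by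
  simp [boundaryPath]

theorem getElem_pathRaw (i : Fin (boundaryPath l m h hm h1 h2 ε).arrows.length) :
    (pathRaw l m h ε)[i.1]'(by rw [length_pathRaw l m h hm h1 h2 ε]; exact i.2) =
      ((boundaryPath l m h hm h1 h2 ε).arrows[i]).1 := by
  rw [Fin.getElem_fin]
  simp only [boundaryPath, List.getElem_pmap]

/-- The product of the arrows of the path from its `i`-th vertex on, as an element of `J e_v`. -/
noncomputable def suffix (i : ℕ) :
    (Ideal.span {idem k l m (boundaryVertex l m h hm h1 h2 ε)} : Ideal (JacAlg k l m)) :=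
  arwProd k l m ((pathRaw l m h ε).drop i) • Inj.gen (idem k l m (boundaryVertex l m h hm h1 h2 ε))

theorem suffix_last : suffix k l m h hm h1 h2 ε (boundaryPath l m h hm h1 h2 ε).arrows.length =
    Inj.gen (idem k l m (boundaryVertex l m h hm h1 h2 ε)) := by
  rw [suffix, ← length_pathRaw l m h hm h1 h2 ε, List.drop_length, arwProd_nil, one_smul]

theorem suffix_castSucc (i : Fin (boundaryPath l m h hm h1 h2 ε).arrows.length) :
    suffix k l m h hm h1 h2 ε i = arw k l m ((boundaryPath l m h hm h1 h2 ε).arrows[i]).1 •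
      suffix k l m h hm h1 h2 ε (i + 1) := by
  have hi : i.1 < (pathRaw l m h ε).length := by
    rw [length_pathRaw l m h hm h1 h2 ε]; exact i.2
  rw [suffix, List.drop_eq_getElem_cons hi, arwProd_cons, mul_smul, getElem_pathRaw]
  rfl

theorem vtx_smul_suffix (i : Fin ((boundaryPath l m h hm h1 h2 ε).arrows.length + 1)) :
    idem k l m ((boundaryPath l m h hm h1 h2 ε).vert i) • suffix k l m h hm h1 h2 ε i =
      suffix k l m h hm h1 h2 ε i := by
  induction i using Fin.lastCases with
  | last =>
    rw [QPath.vert_last, Fin.val_last, suffix_last]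
    exact Subtype.ext (idem_mul_self k l m _)
  | cast i =>
    have hv : (boundaryPath l m h hm h1 h2 ε).vert i.castSucc =
      (quiver l m).src (boundaryPath l m h hm h1 h2 ε).arrows[i] :=
        QPath.vert_castSucc _ i.1 i.2
    rw [hv, Fin.val_castSucc, suffix_castSucc, ← mul_smul, idem_src_mul_arw]

theorem idem_smul_suffix (u : Vertex l m)
    (i : Fin ((boundaryPath l m h hm h1 h2 ε).arrows.length + 1)) :
    idem k l m u • suffix k l m h hm h1 h2 ε i =
      if (boundaryPath l m h hm h1 h2 ε).vert i = u then suffix k l m h hm h1 h2 ε i else 0 := by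
  split_ifs with hu
  · rw [← hu, vtx_smul_suffix]
  · rw [← vtx_smul_suffix, ← mul_smul, idem_mul_of_ne k l m (Ne.symm hu), zero_smul]

variable {k l m h ε}

/-- The action on the values of a linear form at the suffixes of the path. -/
theorem form_smul_suffix
    {T : Submodule (JacAlg k l m)ᵐᵒᵖ (injAt k l m (boundaryVertex l m h hm h1 h2 ε))}
    (hS : Steps k l m (Inj.annihilator T) (idem k l m (boundaryVertex l m h hm h1 h2 ε))
      (pathRaw l m h ε))
    (h0 : ∀ c ∈ arrowSet l m, arw k l m c * (arwProd k l m (pathRaw l m h ε) *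
      idem k l m (boundaryVertex l m h hm h1 h2 ε)) ∈ Inj.annihilator T)
    (c : PathAlg k (quiver l m)) (φ : injAt k l m (boundaryVertex l m h hm h1 h2 ε)) (hφ : φ ∈ T)
    (i : Fin ((boundaryPath l m h hm h1 h2 ε).arrows.length + 1)) :
    Inj.form φ (toJac k (quiver l m) (potential k l m) c • suffix k l m h hm h1 h2 ε i) =
      Matrix.vecMul (fun j : Fin ((boundaryPath l m h hm h1 h2 ε).arrows.length + 1) =>
          Inj.form φ (suffix k l m h hm h1 h2 ε j))
        ((boundaryPath l m h hm h1 h2 ε).rep k c) i := by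
  induction c using pathAlg_induction generalizing φ i with
  | hk c =>
    rw [AlgHom.commutes, AlgHom.commutes, algebraMap_smul, map_smul, Algebra.algebraMap_eq_smul_one,
      Matrix.vecMul_smul, Matrix.vecMul_one]
    rfl
  | he u =>
    rw [QPath.rep_idemp, QPath.vecMul_vertexMatrix]
    change Inj.form φ (idem k l m u • _) = _
    rw [idem_smul_suffix]
    split_ifs
    · rfl
    · exact map_zero _
  | ha a =>
    rw [QPath.rep_arr, ← arw_coe]
    induction i using Fin.cases with
    | zero =>
      rw [QPath.vecMul_arrowMatrix_zero]
      exact Inj.form_eq_zero_of_mem_annihilator (h0 a.1 a.2) hφ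
    | succ i =>
      rw [QPath.vecMul_arrowMatrix_succ]
      split_ifs with ha
      · rw [Fin.val_castSucc, suffix_castSucc, ha]
        rfl
      · refine Inj.form_eq_zero_of_mem_annihilator (hS.getElem ?_ a.2 ?_) hφ
        · rw [length_pathRaw l m h hm h1 h2 ε]
          exact i.2
        · rw [getElem_pathRaw l m h hm h1 h2 ε i]
          exact fun h' => ha (Subtype.ext h'.symm)
  | hmul x y hx hy =>
    -- Since `φ(x y z) = (x • φ)(y z)`, the hypothesis for `y` is applied to `x • φ` in place of
    -- `φ`; hence the induction runs over all forms in `T` at once.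
    have e : Inj.form φ (toJac k (quiver l m) (potential k l m) (x * y) •
        suffix k l m h hm h1 h2 ε i) =
        Inj.form (op (toJac k (quiver l m) (potential k l m) x) • φ)
          (toJac k (quiver l m) (potential k l m) y • suffix k l m h hm h1 h2 ε i) := by
      rw [map_mul, mul_smul]
      rfl
    rw [e, hy _ (T.smul_mem _ hφ), map_mul, ← Matrix.vecMul_vecMul]
    congr 2
    funext j
    exact hx φ hφ j
  | hadd x y hx hy =>
    rw [map_add, map_add, add_smul, map_add, Matrix.vecMul_add, Pi.add_apply, hx φ hφ, hy φ hφ]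

variable (k) in
theorem jacRep_idem (u : Vertex l m) : jacRep k l m h hm h1 h2 ε (idem k l m u) =
    (boundaryPath l m h hm h1 h2 ε).vertexMatrix k u := by
  rw [idem, jacRep_toJac, QPath.rep_idemp]

variable (k) in
theorem jacRep_arw (a : Arrow l m) : jacRep k l m h hm h1 h2 ε (arw k l m a.1) =
    (boundaryPath l m h hm h1 h2 ε).arrowMatrix k a := by
  rw [arw_coe, jacRep_toJac, QPath.rep_arr]

/-- The linear form on `J e_v` given by a vector of the path module. -/
noncomputable def pathForm
    (w : Fin ((boundaryPath l m h hm h1 h2 ε).arrows.length + 1) → k) :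
    injAt k l m (boundaryVertex l m h hm h1 h2 ε) :=
  Inj.form.symm
    { toFun := fun x => Matrix.vecMul w (jacRep k l m h hm h1 h2 ε x.1) (Fin.last _)
      map_add' := fun x y => by
        rw [Submodule.coe_add, map_add, Matrix.vecMul_add, Pi.add_apply]
      map_smul' := fun c x => by
        have : ((c • x : (Ideal.span {idem k l m (boundaryVertex l m h hm h1 h2 ε)} :
          Ideal (JacAlg k l m))) : JacAlg k l m) = c • (x : JacAlg k l m) := rfl
        rw [this, map_smul, Matrix.vecMul_smul]
        rfl }

theorem form_pathForm (w : Fin ((boundaryPath l m h hm h1 h2 ε).arrows.length + 1) → k)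
    (x : (Ideal.span {idem k l m (boundaryVertex l m h hm h1 h2 ε)} : Ideal (JacAlg k l m))) :
    Inj.form (pathForm hm h1 h2 w) x =
      Matrix.vecMul w (jacRep k l m h hm h1 h2 ε x.1) (Fin.last _) := rfl

/-- Each arrow of the path shifts coordinates by one place, so the last coordinate of `w` multiplied
by the suffix from the `i`-th vertex is `w i`. -/
theorem form_pathForm_suffix (w : Fin ((boundaryPath l m h hm h1 h2 ε).arrows.length + 1) → k)
    (i : Fin ((boundaryPath l m h hm h1 h2 ε).arrows.length + 1)) :
    Inj.form (pathForm hm h1 h2 w) (suffix k l m h hm h1 h2 ε i) = w i := by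
  induction i using Fin.reverseInduction generalizing w with
  | last =>
    rw [Fin.val_last, suffix_last, form_pathForm]
    change Matrix.vecMul w (jacRep k l m h hm h1 h2 ε (idem k l m _)) _ = _
    rw [jacRep_idem, QPath.vecMul_vertexMatrix]
    exact if_pos (QPath.vert_last _)
  | cast i ih =>
    rw [Fin.val_castSucc, suffix_castSucc, form_pathForm]
    change Matrix.vecMul w (jacRep k l m h hm h1 h2 ε (_ * _)) _ = _
    rw [map_mul, ← Matrix.vecMul_vecMul, jacRep_arw]
    refine (ih _).trans ?_
    rw [QPath.vecMul_arrowMatrix_succ, if_pos rfl]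

theorem source_not_frozen {a : RawArrow} (ha : a ∈ pathRaw l m h ε) (hm : 2 ≤ m) (h1 : 1 ≤ h)
    (h2 : h < l) :
    rawSrc l a ≠ (2, (l : ℤ), (l : ℤ)) ∧ ∀ n, rawSrc l a ≠ (n, 2 * (l : ℤ), 0) := by
  obtain ⟨hb1, hb2⟩ := rowHeight_bounds h1 h2 m
  have ha' := pathRaw_mem hm h1 h2 ε a ha
  rcases List.mem_append.1 ha with ha | ha
  · obtain ⟨a1, a2, a3⟩ := firstPart_west hb1 hb2 ε _ ha
    have hd : a.1 ≠ Dir.east := a1 ▸ westDir_ne_east _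
    rw [rawSrc_of_ne_east ha' hd]
    obtain ⟨d, n, x, y⟩ := a
    simp only [ne_eq, Prod.mk.injEq] at a2 a3 ⊢
    constructor
    · omega
    · intro n
      omega
  · have hd := secondPart_east ε _ ha
    obtain ⟨d, n, x, y⟩ := a
    obtain rfl : d = Dir.east := hd
    obtain ⟨hp, hq⟩ := east_mem_arrowSet.1 ha'
    unfold rawSrc
    unfold IsPoint at hp hq
    rcases glue_cases (east_mem_arrowSet.1 ha').1 with h | h | h | h <;>
      rw [h.2.2] <;> simp only [ne_eq, Prod.mk.injEq] <;>
      exact ⟨by omega, fun n => by omega⟩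

theorem vert_ne_detVertex (hl : 2 ≤ l) (n : Fin m)
    (i : Fin ((boundaryPath l m h hm h1 h2 ε).arrows.length + 1)) :
    (boundaryPath l m h hm h1 h2 ε).vert i ≠ detVertex l m hl hm n := by
  have key : ((boundaryPath l m h hm h1 h2 ε).vert i).1 ≠ (2, (l : ℤ), (l : ℤ)) ∧
      ∀ n, ((boundaryPath l m h hm h1 h2 ε).vert i).1 ≠ (n, 2 * (l : ℤ), 0) := by
    induction i using Fin.lastCases with
    | last =>
      rw [QPath.vert_last]
      change glue l m (2 * l - h) (ε * h) ≠ _ ∧ ∀ n, glue l m (2 * l - h) (ε * h) ≠ _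
      rw [glue_of_lt (by rcases Int.units_eq_one_or ε with rfl | rfl <;> simp <;> omega)
        (by rcases Int.units_eq_one_or ε with rfl | rfl <;> simp <;> omega)]
      simp only [ne_eq, Prod.mk.injEq]
      rcases Int.units_eq_one_or ε with rfl | rfl <;> simp <;> omega
    | cast i =>
      have hv : (boundaryPath l m h hm h1 h2 ε).vert i.castSucc =
        (quiver l m).src (boundaryPath l m h hm h1 h2 ε).arrows[i] :=
          QPath.vert_castSucc _ i.1 i.2
      rw [hv]
      refine source_not_frozen (ε := ε) ?_ hm h1 h2
      rw [← getElem_pathRaw]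
      exact List.getElem_mem _
  intro h'
  rw [h'] at key
  unfold detVertex at key
  split_ifs at key with hn
  · exact key.1 rfl
  · exact key.2 _ rfl

theorem jacRep_detVertex (hl : 2 ≤ l) (n : Fin m) :
    jacRep k l m h hm h1 h2 ε (idem k l m (detVertex l m hl hm n)) = 0 := by
  rw [jacRep_idem, QPath.vertexMatrix]
  ext i j
  simp [vert_ne_detVertex hm h1 h2 hl n]

/-- The path ends with an east arrow, so no other arrow reaches its last basis vector. -/
theorem vecMul_arrowMatrix_last (w : Fin ((boundaryPath l m h hm h1 h2 ε).arrows.length + 1) → k)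
    (a : Arrow l m) (ha : a.1.1 ≠ Dir.east) :
    Matrix.vecMul w ((boundaryPath l m h hm h1 h2 ε).arrowMatrix k a) (Fin.last _) = 0 := by
  rw [Matrix.vecMul, dotProduct]
  refine Finset.sum_eq_zero fun j _ => ?_
  simp only [QPath.arrowMatrix, Matrix.of_apply]
  rw [if_neg, mul_zero]
  rintro ⟨e1, e2⟩
  have e3 := getElem?_boundaryPath l m h hm h1 h2 ε j
  have e4 : (pathRaw l m h ε).getLast? = some a.1 := by
    rw [List.getLast?_eq_getElem?, length_pathRaw l m h hm h1 h2 ε]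
    rw [Fin.val_last] at e1
    rw [← e1, Nat.add_sub_cancel, e3, e2]
    rfl
  obtain ⟨r, rfl⟩ : ∃ r, m = r + 2 := ⟨m - 2, by omega⟩
  obtain ⟨hb1, hb2⟩ := rowHeight_bounds h1 h2 (r + 2)
  have e5 : r + 2 - 1 = r + 1 := rfl
  have hne : secondPart l (rowHeight l h (r + 2)) ε (r + 1) ≠ [] := by
    intro h0
    have := secondPart_head hb2 ε r
    rw [h0] at this
    simp at this
  rw [pathRaw, e5, List.getLast?_append_of_ne_nil _ hne] at e4
  exact ha (secondPart_east ε _ (List.mem_of_getLast? e4))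

theorem mem_boundaryRep {hl : 2 ≤ l} {κ : Fin m → ℕ}
    {f : injAt k l m (boundaryVertex l m h hm h1 h2 ε) →ₗ[(JacAlg k l m)ᵐᵒᵖ]
      detInj k l m hl hm κ} {φ : injAt k l m (boundaryVertex l m h hm h1 h2 ε)} :
    φ ∈ boundaryRep k l m h hl hm h1 h2 ε κ f ↔
      (∀ hp : 2 ≤ h, predMap k l m h hm hp h2 ε φ = 0) ∧ f φ = 0 := by
  unfold boundaryRep
  split_ifs with hp
  · rw [LinearMap.ker_prod, Submodule.mem_inf, LinearMap.mem_ker, LinearMap.mem_ker]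
    exact ⟨fun h' => ⟨fun _ => h'.1, h'.2⟩, fun h' => ⟨h'.1 hp, h'.2⟩⟩
  · rw [LinearMap.mem_ker]
    exact ⟨fun h' => ⟨fun hp' => absurd hp' hp, h'⟩, fun h' => h'.2⟩

/-- This needs no condition on `f`. The arrow `a_{v',v}` points west and is not the last arrow of
`p_v`, so it acts as zero. Since `p_v` avoids the frozen vertices `1, …, m`, the form vanishes on
every `J e_n J e_v`, and then every morphism to `I_n` annihilates it. -/
theorem pathForm_mem_boundaryRep {hl : 2 ≤ l} {κ : Fin m → ℕ}
    (f : injAt k l m (boundaryVertex l m h hm h1 h2 ε) →ₗ[(JacAlg k l m)ᵐᵒᵖ]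
      detInj k l m hl hm κ) (w : Fin ((boundaryPath l m h hm h1 h2 ε).arrows.length + 1) → k) :
    pathForm hm h1 h2 w ∈ boundaryRep k l m h hl hm h1 h2 ε κ f := by
  rw [mem_boundaryRep]
  constructor
  · intro hp
    refine Inj.ext_form fun x => ?_
    change Matrix.vecMul w (jacRep k l m h hm h1 h2 ε (x.1 * toJac k (quiver l m) (potential k l m)
      (arr k (quiver l m) (boundaryArrow l m h hm hp h2 ε)))) (Fin.last _) = 0
    rw [map_mul, ← Matrix.vecMul_vecMul, jacRep_toJac, QPath.rep_arr]
    exact vecMul_arrowMatrix_last hm h1 h2 _ _ (westDir_ne_east _)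
  · funext n i
    refine Inj.apply_eq_zero_of_form_eq_zero (e' := idem k l m (detVertex l m hl hm n))
      (idem_mul_self k l m _)
      ((LinearMap.proj i).comp ((LinearMap.proj n).comp f)) fun y z => ?_
    change Matrix.vecMul w (jacRep k l m h hm h1 h2 ε (y * (_ * _))) (Fin.last _) = 0
    rw [map_mul, map_mul, jacRep_detVertex, zero_mul, mul_zero, Matrix.vecMul_zero]
    rfl

/-- The isomorphism evaluates a form at the suffixes of `p_v`. It is injective because the suffixes
span `J e_v` modulo the annihilator of `T`, and surjective because the forms coming from the path
module lie in `T`. -/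
theorem isoPathModule_of_unsupported {hl : 2 ≤ l} {κ : Fin m → ℕ}
    (f : injAt k l m (boundaryVertex l m h hm h1 h2 ε) →ₗ[(JacAlg k l m)ᵐᵒᵖ]
      detInj k l m hl hm κ)
    (hT : DetUnsupported hl hm (boundaryRep k l m h hl hm h1 h2 ε κ f)) :
    IsoPathModule (boundaryRep k l m h hl hm h1 h2 ε κ f) (boundaryPath l m h hm h1 h2 ε) := by
  generalize hTdef : boundaryRep k l m h hl hm h1 h2 ε κ f = T at hT ⊢
  have hunsup : ∀ n : Fin m, ∀ s ∈ (Ideal.span {idem k l m (boundaryVertex l m h hm h1 h2 ε)} :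
      Ideal (JacAlg k l m)), vtx k l m (detVertex l m hl hm n).1 * s ∈ Inj.annihilator T := by
    intro n s hs
    rw [vtx_coe]
    refine ⟨Ideal.mul_mem_left _ _ hs, fun φ hφ => ?_⟩
    have := Inj.form_eq_zero_of_unsupported (hT n) hφ 1 ⟨s, hs⟩
    rw [one_smul] at this
    exact this
  have hgen : idem k l m (boundaryVertex l m h hm h1 h2 ε) ∈
      (Ideal.span {idem k l m (boundaryVertex l m h hm h1 h2 ε)} : Ideal (JacAlg k l m)) :=
    Ideal.subset_span rfl
  obtain ⟨hS, h0⟩ := steps_pathRaw (K := Inj.annihilator T) hm h1 h2 ε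
    (hunsup ⟨0, by omega⟩) (fun n hn hn' s hs => by
      have := hunsup ⟨n - 1, by omega⟩ s hs
      simp only [detVertex] at this
      rwa [if_neg (by omega), Nat.sub_add_cancel (by omega)] at this) hgen
    (by
      have := idem_mul_self k l m (boundaryVertex l m h hm h1 h2 ε)
      nth_rewrite 1 [← vtx_coe] at this
      exact this)
    (fun hp => by
      -- Evaluating `predMap φ = 0` at the generator `e_{v'}` shows that `φ` vanishes at the arrow
      -- `a_{v',v}`.
      have ht := arw_mul_idem_tgt k l m (boundaryArrow l m h hm hp h2 ε)
      have hs := idem_src_mul_arw k l m (boundaryArrow l m h hm hp h2 ε)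
      rw [boundaryArrow_tgt] at ht
      rw [boundaryArrow_src] at hs
      refine ⟨Ideal.mul_mem_left _ _ hgen, fun φ hφ => ?_⟩
      rw [← hTdef, mem_boundaryRep] at hφ
      have hz : Inj.form (predMap k l m h hm hp h2 ε φ) (Inj.gen _) = 0 := by
        rw [hφ.1 hp, map_zero, LinearMap.zero_apply]
      rw [predMap, arrowMap, Inj.form_map] at hz
      refine Eq.trans (congrArg (Inj.form φ) (Subtype.ext ?_)) hz
      refine ht.trans (hs.symm.trans ?_)
      rw [arw_coe]
      rfl)
  let Φ : T →ₗ[k] (Fin ((boundaryPath l m h hm h1 h2 ε).arrows.length + 1) → k) :=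
    { toFun := fun φ i => Inj.form φ.1 (suffix k l m h hm h1 h2 ε i)
      map_add' := fun φ ψ => rfl
      map_smul' := fun c φ => rfl }
  have hΦ : Function.Bijective Φ := by
    constructor
    -- Every element of `J e_v` has the form `c e_v`, and `e_v` is the last suffix.
    · intro φ ψ hφψ
      refine Subtype.ext (Inj.ext_form fun x => ?_)
      obtain ⟨c, hc⟩ := RingQuot.mkAlgHom_surjective k
        (JacRel k (quiver l m) (potential k l m)) x.1
      have hx : x = toJac k (quiver l m) (potential k l m) c •
          suffix k l m h hm h1 h2 ε (Fin.last (boundaryPath l m h hm h1 h2 ε).arrows.length) := by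
        rw [Fin.val_last, suffix_last, toJac, hc]
        exact (Inj.coe_smul_gen (idem_mul_self k l m _) x).symm
      rw [hx, form_smul_suffix hm h1 h2 hS h0 c φ.1 φ.2, form_smul_suffix hm h1 h2 hS h0 c ψ.1 ψ.2]
      exact congrArg (fun w => Matrix.vecMul w _ _) hφψ
    · intro w
      refine ⟨⟨pathForm hm h1 h2 w, hTdef ▸ pathForm_mem_boundaryRep hm h1 h2 f w⟩, ?_⟩
      funext i
      exact form_pathForm_suffix hm h1 h2 w i
  refine ⟨LinearEquiv.ofBijective Φ hΦ, fun c φ => ?_⟩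
  funext i
  exact form_smul_suffix hm h1 h2 hS h0 c φ.1 φ.2 i

/-- `T_v` is contained in the kernel of `f`, whether or not a predecessor exists, so it suffices
that this kernel is unsupported. -/
theorem holdsGenerically_detUnsupported (hl : 2 ≤ l) (κ : Fin m → ℕ)
    (hκ : ∀ n, Module.finrank k (JacAlg k l m) ≤ κ n) :
    HoldsGenerically k fun f : injAt k l m (boundaryVertex l m h hm h1 h2 ε)
        →ₗ[(JacAlg k l m)ᵐᵒᵖ] detInj k l m hl hm κ =>
      DetUnsupported hl hm (boundaryRep k l m h hl hm h1 h2 ε κ f) := by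
  have := finite_jacAlg k l m
  obtain ⟨d, L, P, hL, hP, hgen⟩ := Inj.holdsGenerically_ker_unsupported
    (e := idem k l m (boundaryVertex l m h hm h1 h2 ε))
    (fun n => idem k l m (detVertex l m hl hm n)) (fun n => idem_mul_self k l m _) κ hκ
  refine ⟨d, L, P, hL, hP, fun f hf n φ hφ => hgen f hf n φ ?_⟩
  rw [mem_boundaryRep] at hφ
  exact hφ.2

end Iso

end Diamond

theorem mainTheorem7 (k : Type*) [Field k] [IsAlgClosed k] [CharZero k] (l m : ℕ)
    (hl : 2 ≤ l) (hm : 2 ≤ m) (h : ℕ) (h1 : 1 ≤ h) (h2 : h < l) (ε : ℤˣ) :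
    (∃ K : ℕ, ∀ κ : Fin m → ℕ, (∀ n, K ≤ κ n) →
      HoldsGenerically k fun f : Diamond.injAt k l m (Diamond.boundaryVertex l m h hm h1 h2 ε)
          →ₗ[(Diamond.JacAlg k l m)ᵐᵒᵖ] Diamond.detInj k l m hl hm κ =>
        Diamond.DetUnsupported hl hm (Diamond.boundaryRep k l m h hl hm h1 h2 ε κ f)) ∧
    (∀ (κ : Fin m → ℕ)
      (f : Diamond.injAt k l m (Diamond.boundaryVertex l m h hm h1 h2 ε)
          →ₗ[(Diamond.JacAlg k l m)ᵐᵒᵖ] Diamond.detInj k l m hl hm κ),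
      Diamond.DetUnsupported hl hm (Diamond.boundaryRep k l m h hl hm h1 h2 ε κ f) →
        Diamond.IsoPathModule (Diamond.boundaryRep k l m h hl hm h1 h2 ε κ f)
          (Diamond.boundaryPath l m h hm h1 h2 ε)) :=
  -- The dimension of `J` bounds the dimension of every corner `e_n J e_v`, so it serves as a common
  -- bound for all `n`.
  ⟨⟨Module.finrank k (Diamond.JacAlg k l m), fun κ hκ =>
      Diamond.holdsGenerically_detUnsupported hm h1 h2 hl κ hκ⟩,
    fun _ f hf => Diamond.isoPathModule_of_unsupported hm h1 h2 f hf⟩
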